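/- **Setting.** Let $k$ be a field. Let $\widetilde P$ be the smooth toric fourfold over $k$ whose fan consists of the 120 Weyl chambers of the root lattice $A_4$ and their faces. Its torus is $T=\{(X_1:\dots:X_5)\in\mathbb P^4:\prod X_i\neq 0\}$, and it is covered by charts $\mathbb A^4_\varsigma$, $\varsigma\in S_5$, with coordinates $(x,y,z,w)=\left(\frac{X_{\varsigma(1)}}{X_{\varsigma(2)}},\frac{X_{\varsigma(2)}}{X_{\varsigma(3)}},\frac{X_{\varsigma(3)}}{X_{\varsigma(4)}},\frac{X_{\varsigma(4)}}{X_{\varsigma(5)}}\right)$. For $\boldsymbol a=(a_1:\dots:a_6)\in\mathbb P^5(k)$ with all $a_i\ne 0$, let $X_{\boldsymbol a}\subset\widetilde P$ be the closure of $$\Big\{(X_1+\dots+X_5)\Big(\frac{a_1}{X_1}+\dots+\frac{a_5}{X_5}\Big)=a_6\Big\}\subset T ,$$ that is, the hypersurface with equation $$(a_{\varsigma(1)}+a_{\varsigma(2)}x+a_{\varsigma(3)}xy+a_{\varsigma(4)}xyz+a_{\varsigma(5)}xyzw)(1+w+wz+wzy+wzyx)=a_6xyzw$$ in the chart $\mathbb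 A^4_\varsigma$. Let $\overline X_{\boldsymbol a}$ be the blow-up of $X_{\boldsymbol a}$ along the ten disjoint surfaces which are the closures of $\{a_{\varsigma(1)}+a_{\varsigma(2)}x=y=0\}\subset\mathbb A^4_\varsigma$ (one for each set $\{\varsigma(1),\varsigma(2)\}$); it is a small resolution of the 30 nodes of $X_{\boldsymbol a}$ outside $T$. The big resolution $\widetilde{\overline X}_{\boldsymbol a}$ of $\overline X_{\boldsymbol a}$ is obtained by blowing up the remaining singular points, which are the (geometric) singular points of $X_{\boldsymbol a}$ in $T$. Let $$\phi:T\to\mathbb P^5,\qquad \phi(b_1:\dots:b_5)=\big(b_1^2:\dots:b_5^2:(b_1+\dots+b_5)^2\big),$$ and let $\mathcal E_{a,b,c,t}\subset\mathbb P^2$ be the plane cubic $(x+y+z)(axy+byz+czx)=t\,xyz$. **Reduction.** Let $p$ be a prime and let $\boldsymbol a=(a_1:\dots:a_6)\in\mathbb P^5(\mathbb Q)$, written with integers $a_i$ that are not all divisible by $p$. The reduction mod $p$ of $\widetilde{\overline X}_{\boldsymbol a}$ is obtained from $X_{\boldsymbol a \bmod p}$ by blowing up the ten surfaces and the reductions of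 the singular points in $T$ of $X_{\boldsymbol a}$ over $\overline{\mathbb Q}$. We say that $\widetilde{\overline X}_{\boldsymbol a}$ has smooth reduction mod $p$ if all $a_i$ are nonzero mod $p$ (so that $X_{\boldsymbol a \bmod p}$ is irreducible), the singular points in $T$ over $\overline{\mathbb Q}$ reduce to nodes (ordinary double points), and this reduction is smooth over $\overline{\mathbb F}_p$. Let $\#\widetilde{\overline X}_{\boldsymbol a}(\mathbb F_p)$ be the number of $\mathbb F_p$-points of the reduction. **Lemma.** If $\widetilde{\overline X}_{\boldsymbol a}$ has smooth reduction mod $p$, then $$\begin{aligned}\#\widetilde{\overline X}_{\boldsymbol a}(\mathbb F_p)={}&48p^2+46p+14\\ &+\sum_{x,y,z\in\mathbb F_p^\times}\left(\left(\frac{\big((1+x+y+z)(\frac{a_2}{x}+\frac{a_3}{y}+\frac{a_4}{z}+a_5)-a_1-a_6\big)^2-4a_1a_6}{p}\right)+1\right)\\ &+\sum_{\substack{\boldsymbol b=(b_1:\dots:b_5)\in T(\mathbb F_p)\\ \phi(\boldsymbol b)=\boldsymbol a\bmod p}}p\left(p+1+\left(\frac{b_1b_2b_3b_4b_5(b_1+\dots+b_5)}{p}\right)\right)\\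 &+\rho(a_1,a_6)\big(\#\mathcal E_{a_2,a_3,a_5,a_4}(\mathbb F_p)-6\big),\end{aligned}$$ where $\rho(a_1,a_6)=p$ if $a_1\equiv a_6 \bmod p$ and $0$ otherwise, and $\left(\frac{\cdot}{p}\right)$ is the Legendre symbol. -/

import Mathlib

open scoped LinearAlgebra.Projectivization

noncomputable section

namespace A4

/-! ### Charts of the toric variety and the threefold

`P` is the smooth toric variety over a field `K` whose fan consists of the Weyl chambers of `A₄` and
their faces.  It is covered by the `120` affine spaces `𝔸⁴_ς`, `ς ∈ S₅`, with coordinates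
`(x, y, z, w) = (v 0, v 1, v 2, v 3)`, where `v k = X_{ς k} / X_{ς (k + 1)}` on the torus
`T = ℙ⁴ ∖ {X₁ X₂ X₃ X₄ X₅ = 0}`.  Indices are counted from `0`, so that the parameter
`(a₁ : ⋯ : a₆)` is `a 0, …, a 5`. -/

/-- Coordinates in the chart `ς` of the torus point with homogeneous coordinates `b`. -/
def chartCoords {K : Type*} [Field K] (ς : Equiv.Perm (Fin 5)) (b : Fin 5 → K) : Fin 4 → K :=
  fun k => b (ς k.castSucc) / b (ς k.succ)

/-- The monomial `X_i / X_{ς 4}` as a polynomial in the coordinates of the chart `ς`: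
for `i = ς 0, ς 1, ς 2, ς 3, ς 4` it is `xyzw, yzw, zw, w, 1`. -/
def homCoord (K : Type*) [Field K] (ς : Equiv.Perm (Fin 5)) (i : Fin 5) :
    MvPolynomial (Fin 4) K :=
  ∏ m ∈ Finset.univ.filter (fun m : Fin 4 => ς.symm i ≤ m.castSucc), MvPolynomial.X m

/-- The equation of the threefold `X_a` in the chart `ς`. -/
def localEq {K : Type*} [Field K] (a : Fin 6 → K) (ς : Equiv.Perm (Fin 5)) :
    MvPolynomial (Fin 4) K :=
  let x : MvPolynomial (Fin 4) K := MvPolynomial.X 0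
  let y : MvPolynomial (Fin 4) K := MvPolynomial.X 1
  let z : MvPolynomial (Fin 4) K := MvPolynomial.X 2
  let w : MvPolynomial (Fin 4) K := MvPolynomial.X 3
  let c : Fin 5 → MvPolynomial (Fin 4) K := fun k => MvPolynomial.C (a (ς k).castSucc)
  (c 0 + c 1 * x + c 2 * (x * y) + c 3 * (x * y * z) + c 4 * (x * y * z * w))
      * (1 + w + w * z + w * z * y + w * z * y * x)
    - MvPolynomial.C (a 5) * (x * y * z * w)

/-- `v` is a singular point of the affine hypersurface `F = 0`. -/
def IsSingularAt {K : Type*} [Field K] {n : ℕ} (F : MvPolynomial (Fin n) K) (v : Fin n → K) :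
    Prop :=
  MvPolynomial.eval v F = 0 ∧ ∀ i, MvPolynomial.eval v (MvPolynomial.pderiv i F) = 0

/-- `v` is a node of the hypersurface `F = 0` in affine `4`-space: a singular point at which the
Hessian (the polar form of the quadratic part of `F`) is nondegenerate. -/
def IsNodeAt {K : Type*} [Field K] (F : MvPolynomial (Fin 4) K) (v : Fin 4 → K) : Prop :=
  IsSingularAt F v ∧
    (Matrix.of fun i j : Fin 4 =>
      MvPolynomial.eval v (MvPolynomial.pderiv i (MvPolynomial.pderiv j F))).det ≠ 0

/-! ### Blowing up -/

/-- Let `A = K[v₁, …, vₙ] / (F)` and let `I ⊆ A` be the ideal generated by the family `f`.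
For a local `K`-algebra `L`, an `L`-valued point of the blow-up `Proj (⨁ Iᵈ)` of `Spec A` along `I`
is a pair `(P, s)` with `P : A → L` and `s` a family in `L` with an invertible member, up to
multiplication of `s` by units, at which all homogeneous relations between the `f i` over `A`
vanish.  (The relation `F` itself, of degree `0`, says that `P` lies on `F = 0`.)  We use `L = K` for
points and `L = K[ε]` for tangent vectors. -/
def IsBlowUpPoint {K : Type*} [Field K] {n : ℕ} {ι : Type*} (F : MvPolynomial (Fin n) K)
    (f : ι → MvPolynomial (Fin n) K) {L : Type*} [CommRing L] [Algebra K L]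
    (P : Fin n → L) (s : ι → L) : Prop :=
  (∃ i, IsUnit (s i)) ∧
    ∀ (d : ℕ) (G : MvPolynomial ι (MvPolynomial (Fin n) K)), G.IsHomogeneous d →
      MvPolynomial.eval f G ∈ Ideal.span {F} →
        MvPolynomial.eval₂ (MvPolynomial.aeval P : MvPolynomial (Fin n) K →ₐ[K] L).toRingHom s G = 0

/-- Generators `(a_{ς 0} + a_{ς 1} x, y)` of the ideal, in the chart `ς`, of the surface
`S : a_{ς 0} + a_{ς 1} x = y = 0`.  This surface depends only on the set `{ς 0, ς 1}`, and the other
nine of the ten surfaces do not meet the chart. -/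
def surfaceGens {K : Type*} [Field K] (a : Fin 6 → K) (ς : Equiv.Perm (Fin 5)) :
    Fin 2 → MvPolynomial (Fin 4) K :=
  ![MvPolynomial.C (a (ς 0).castSucc) + MvPolynomial.C (a (ς 1).castSucc) * MvPolynomial.X 0,
    MvPolynomial.X 1]

/-- Generators `X_i b_j - X_j b_i` of the ideal, in the chart `ς`, of the torus point `b`. -/
def pointGens {K : Type*} [Field K] (b : Fin 5 → K) (ς : Equiv.Perm (Fin 5)) :
    Fin 5 × Fin 5 → MvPolynomial (Fin 4) K :=
  fun ij => homCoord K ς ij.1 * MvPolynomial.C (b ij.2) - homCoord K ς ij.2 * MvPolynomial.C (b ij.1)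

/-- A `K`-point, seen in a chart, of the variety obtained from `X_a` by blowing up the ten surfaces
and then the torus points in `B`.  The centres are pairwise disjoint, so this is the fibre
product over `X_a` of the blow-ups in the single centres. -/
structure ChartPoint (K : Type*) [Field K] (a : Fin 6 → K) (B : Set (ℙ K (Fin 5 → K))) where
  chart : Equiv.Perm (Fin 5)
  pt : Fin 4 → K
  on_threefold : MvPolynomial.eval pt (localEq a chart) = 0
  dir : ℙ K (Fin 2 → K)
  dir_mem : IsBlowUpPoint (localEq a chart) (surfaceGens a chart) pt dir.rep
  exc : B → ℙ K (Fin 5 × Fin 5 → K)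
  exc_mem : ∀ b : B, IsBlowUpPoint (localEq a chart) (pointGens b.1.rep chart) pt (exc b).rep

/-- `(ratioPart ς v i j : ratioPart ς v j i)` is the value in `ℙ¹` of the rational function
`(X_i : X_j)` at the point of the chart `ς` with coordinates `v`. -/
def ratioPart {K : Type*} [Field K] (ς : Equiv.Perm (Fin 5)) (v : Fin 4 → K) (i j : Fin 5) : K :=
  if ς.symm i < ς.symm j then
    ∏ m ∈ Finset.univ.filter (fun m : Fin 4 => ς.symm i ≤ m.castSucc ∧ m.castSucc < ς.symm j), v m
  else 1

/-- The value of `X_i / X_j` at a point where this function is finite and nonzero. -/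
def ratioVal {K : Type*} [Field K] (ς : Equiv.Perm (Fin 5)) (v : Fin 4 → K) (i j : Fin 5) : K :=
  ratioPart ς v i j / ratioPart ς v j i

/-- Two points in charts are the same point of the glued variety: they lie over the same point of
the toric variety, they agree over the surface centre, where the two generators in the chart `ς` are
`(a_i X_j + a_j X_i) / X_{ς 1}` and `X_{ς 1} / X_{ς 2}` with `{i, j} = {ς 0, ς 1}`, and they agree
over the point centres, where the generators in different charts differ by a common monomial
factor. -/
def Glued {K : Type*} [Field K] {a : Fin 6 → K} {B : Set (ℙ K (Fin 5 → K))}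
    (P Q : ChartPoint K a B) : Prop :=
  (∀ i j, ratioPart P.chart P.pt i j * ratioPart Q.chart Q.pt j i
      = ratioPart Q.chart Q.pt i j * ratioPart P.chart P.pt j i) ∧
  (({P.chart 0, P.chart 1} : Set (Fin 5)) = {Q.chart 0, Q.chart 1} →
    P.dir.rep 0 * Q.dir.rep 1 * ratioVal P.chart P.pt (P.chart 1) (Q.chart 1) ^ 2
        * ratioVal P.chart P.pt (Q.chart 2) (P.chart 2)
      = Q.dir.rep 0 * P.dir.rep 1) ∧
  P.exc = Q.exc

/-- The set of `K`-points of the blow-up, in the set `B` of nodes in the torus, of the small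
resolution `X̄_a` of `X_a`.  (Over a node that is not defined over `K` there are no `K`-points, so
`B` only has to contain the `K`-rational ones.) -/
def BigResolution (K : Type*) [Field K] (a : Fin 6 → K) (B : Set (ℙ K (Fin 5 → K))) : Type _ :=
  Quot (Glued (K := K) (a := a) (B := B))

/-- The Zariski tangent vectors of the blow-up at a point, in terms of coordinates of the chart and
of homogeneous coordinates of each of the fibre points.  The rescalings of the latter are not divided
out. -/
def tangentVectors {K : Type*} [Field K] {a : Fin 6 → K} {B : Set (ℙ K (Fin 5 → K))}
    (P : ChartPoint K a B) :
    Set ((Fin 4 → K) × (Fin 2 → K) × (B → Fin 5 × Fin 5 → K)) :=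
  {t | IsBlowUpPoint (localEq a P.chart) (surfaceGens a P.chart)
        (fun k => (TrivSqZeroExt.inl (P.pt k) + TrivSqZeroExt.inr (t.1 k) : DualNumber K))
        (fun k => (TrivSqZeroExt.inl (P.dir.rep k) + TrivSqZeroExt.inr (t.2.1 k) : DualNumber K)) ∧
      ∀ b : B, IsBlowUpPoint (localEq a P.chart) (pointGens b.1.rep P.chart)
        (fun k => (TrivSqZeroExt.inl (P.pt k) + TrivSqZeroExt.inr (t.1 k) : DualNumber K))
        (fun k => (TrivSqZeroExt.inl ((P.exc b).rep k) + TrivSqZeroExt.inr (t.2.2 b k) :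
          DualNumber K))}

/-- The threefold is nonsingular at the point: the Zariski tangent space is `3`-dimensional.  The
homogeneous coordinates in the fibres over the centres (one surface, and the points in `B`)
contribute one dimension of rescalings each. -/
def IsNonsingularAt {K : Type*} [Field K] {a : Fin 6 → K} {B : Set (ℙ K (Fin 5 → K))}
    (P : ChartPoint K a B) : Prop :=
  Module.finrank K (Submodule.span K (tangentVectors P)) = 3 + (1 + Nat.card B)

/-! ### Reduction modulo `p` -/

/-- The ring of all algebraic integers. -/
abbrev AlgInt : Type := integralClosure ℤ (AlgebraicClosure ℚ)

/-- `v`, a vector over an algebraic closure of `𝔽_p`, represents the reduction at a place over `p` of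
a singular point in the torus of the threefold `X_a` over an algebraic closure of `ℚ`. -/
def IsReductionOfNode (p : ℕ) [Fact p.Prime] (a : Fin 6 → ℤ)
    (v : Fin 5 → AlgebraicClosure (ZMod p)) : Prop :=
  ∃ (red : AlgInt →+* AlgebraicClosure (ZMod p)) (β : Fin 5 → AlgInt),
    (∀ i, β i ≠ 0) ∧
    IsSingularAt (localEq (fun i => (a i : AlgebraicClosure ℚ)) 1)
      (chartCoords 1 fun i => (β i : AlgebraicClosure ℚ)) ∧
    ∃ c : AlgebraicClosure (ZMod p), c ≠ 0 ∧ ∀ i, v i = c * red (β i)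

/-- The reductions modulo `p` of the nodes in the torus that are defined over `K`, a field between
`𝔽_p` and its algebraic closure. -/
def reducedNodes (p : ℕ) [Fact p.Prime] (a : Fin 6 → ℤ) (K : Type) [Field K]
    [Algebra K (AlgebraicClosure (ZMod p))] : Set (ℙ K (Fin 5 → K)) :=
  {b | IsReductionOfNode p a fun i => algebraMap K (AlgebraicClosure (ZMod p)) (b.rep i)}

/-- The `K`-points of the reduction modulo `p` of the big resolution of `X̄_a`, for homogeneous
integral coordinates `a` that are not all divisible by `p`. -/
abbrev ReducedBigResolution (p : ℕ) [Fact p.Prime] (a : Fin 6 → ℤ) (K : Type) [Field K]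
    [Algebra K (AlgebraicClosure (ZMod p))] : Type :=
  BigResolution K (fun i => (a i : K)) (reducedNodes p a K)

/-- The big resolution of `X̄_a` has smooth reduction modulo `p`: the reduction of `X_a` is
irreducible, i.e. has nonzero parameters (otherwise it is not a member of the family), the nodes in
the torus reduce to nodes, and blowing up the ten surfaces and these nodes gives a variety that is
nonsingular at every point over an algebraic closure of `𝔽_p`. -/
def HasSmoothReduction (p : ℕ) [Fact p.Prime] (a : Fin 6 → ℤ) : Prop :=
  (∀ i, (a i : ZMod p) ≠ 0) ∧
  (∀ b ∈ reducedNodes p a (AlgebraicClosure (ZMod p)),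
    IsNodeAt (localEq (fun i => (a i : AlgebraicClosure (ZMod p))) 1) (chartCoords 1 b.rep)) ∧
  ∀ P : ChartPoint (AlgebraicClosure (ZMod p)) (fun i => (a i : AlgebraicClosure (ZMod p)))
      (reducedNodes p a (AlgebraicClosure (ZMod p))),
    IsNonsingularAt P

/-! ### The ingredients of the formula -/

/-- The map `(b₁, …, b₅) ↦ (b₁², …, b₅², (b₁ + ⋯ + b₅)²)`. -/
def phiVec {K : Type*} [Field K] (b : Fin 5 → K) : Fin 6 → K :=
  Fin.snoc (fun i => b i ^ 2) ((∑ i, b i) ^ 2)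

/-- The points `b` of the torus in `ℙ⁴` with `φ(b) = a` in `ℙ⁵`. -/
def phiFibre {K : Type*} [Field K] (a : Fin 6 → K) : Set (ℙ K (Fin 5 → K)) :=
  {b | (∀ i, b.rep i ≠ 0) ∧ ∃ c : K, c ≠ 0 ∧ ∀ i, phiVec b.rep i = c * a i}

/-- The plane cubic `(x + y + z)(a x y + b y z + c z x) = t x y z`. -/
def ellipticCurve {K : Type*} [Field K] (a b c t : K) : Set (ℙ K (Fin 3 → K)) :=
  {P | (P.rep 0 + P.rep 1 + P.rep 2)
      * (a * (P.rep 0 * P.rep 1) + b * (P.rep 1 * P.rep 2) + c * (P.rep 2 * P.rep 0))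
        = t * (P.rep 0 * P.rep 1 * P.rep 2)}

/-- The quantity whose Legendre symbol is summed over `x, y, z ∈ 𝔽_pˣ`. -/
def discr {K : Type*} [Field K] (a : Fin 6 → K) (x y z : K) : K :=
  ((1 + x + y + z) * (a 1 / x + a 2 / y + a 3 / z + a 4) - a 0 - a 5) ^ 2 - 4 * a 0 * a 5

end A4

end

namespace A4

open MvPolynomial

/-! ### Generalities on blow-ups -/

section BlowUp

variable {K : Type*} [Field K] {n : ℕ} {ι : Type*}

/-! The count is a sum of fibre sizes over the points of the threefold, with `q` the number of
elements of the field.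

Unique representatives. The vanishing coordinates of a point in a chart cut the five indices into an
ordered partition, which depends only on the point of the toric variety. The charts containing the
point are the permutations refining this partition, and exactly one of them is increasing on every
block. Hence the glued variety is the set of such normal points of the threefold, each with a point
in every fibre (`card_bigResolution`).

Fibres. In a chart the equation has the determinantal form `A * S + y * C` (`eqVal_eq`), where `A =
y = 0` is the surface. The blow-up of the surface is therefore an isomorphism on points except where
all four functions vanish; over each of these 30 boundary nodes it has a projective line. At a node
`b` of the torus a Lagrange-type identity (`sum_coneCoeff`) writes the equation, up to a unit, as a
quadratic form in the generators of the ideal of `b`. The fibre is then a quadric surface with `1 +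
q (q + 1 + χ)` points, where `χ` is the quadratic character of `(∏ b i) * ∑ b i`.
`card_bigResolution_eq` collects these contributions.

Points of the threefold. On the boundary orbits the equation factors into linear pieces, which gives
`50 q ^ 2 + 10 q + 20` points (`card_normalPoint`). In the torus, fixing three coordinates leaves an
equation of degree at most two in the last one, and the Legendre symbol of its discriminant counts
the roots. Corrections occur when the constant or the leading coefficient vanishes, and `q` is added
when all coefficients do. The last case needs `a 0 = a 5` and happens along the torus part of a
plane cubic, which misses six points of the cubic (`sum_torus`).

Centres. The singular points in the torus are the points with `φ(b) = a`, a closed condition that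
survives reduction. Conversely, a singular point that is not a centre would remain singular on the
blow-up, its tangent space being too large. So under smooth reduction the centres are precisely the
fibre of `φ` (`HasSmoothReduction.reducedNodes_eq`). The same argument excludes `p = 2`: there `(1 :
⋯ : 1)` is a singular point with degenerate Hessian. -/

lemma eval₂_mul_of_isHomogeneous {R S : Type*} [CommSemiring R] [CommSemiring S]
    {G : MvPolynomial ι R} {d : ℕ} (hG : G.IsHomogeneous d) (φ : R →+* S) (u : S) (s : ι → S) :
    eval₂ φ (fun i => u * s i) G = u ^ d * eval₂ φ s G := by
  rw [eval₂_eq, eval₂_eq, Finset.mul_sum]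
  refine Finset.sum_congr rfl fun m hm => ?_
  have hd : ∑ i ∈ m.support, m i = d := by
    have := hG (mem_support_iff.mp hm)
    rw [Finsupp.weight_apply] at this
    simpa [Finsupp.sum] using this
  simp only [mul_pow, Finset.prod_mul_distrib]
  rw [Finset.prod_pow_eq_pow_sum, hd]
  ring

variable {F : MvPolynomial (Fin n) K} {f : ι → MvPolynomial (Fin n) K}
  {L : Type*} [CommRing L] [Algebra K L] {P : Fin n → L} {s : ι → L}

/-- This is the criterion by strict transforms. `Ψ` parametrises an affine piece of the blow-up of
the ambient space, `t` is the equation of the exceptional divisor and `E` that of the strict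
transform of `F`. A homogeneous relation among the `f i` modulo `F` becomes, after division by a
power of `t`, a multiple of `E`, so it vanishes wherever `E` does. -/
lemma isBlowUpPoint_of_lift {D : Type*} [CommRing D] [IsDomain D]
    (Ψ : MvPolynomial (Fin n) K →+* D) (ρ : D →+* L) {t E : D} {e : ℕ} (ht : Prime t)
    (hE : ¬ t ∣ E) (g : ι → D) (hf : ∀ i, Ψ (f i) = t * g i) (hF : Ψ F = t ^ e * E)
    (hρ : ∀ q, ρ (Ψ q) = aeval P q) (hg : ∀ i, ρ (g i) = s i) (hE0 : ρ E = 0)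
    (hu : ∃ i, IsUnit (s i)) : IsBlowUpPoint F f P s := by
  refine ⟨hu, fun d G hG hGF => ?_⟩
  obtain ⟨H, hH⟩ := Ideal.mem_span_singleton.mp hGF
  have h1 : Ψ (eval f G) = t ^ d * eval₂ Ψ g G := by
    rw [← eval₂_mul_of_isHomogeneous hG]
    have : eval f G = eval₂ (RingHom.id _) f G := rfl
    rw [this, eval₂_comp_left Ψ (RingHom.id _) f G]
    simp only [Function.comp_def, hf, RingHom.comp_id]
  have h2 : t ^ d * eval₂ Ψ g G = t ^ e * (E * Ψ H) := by
    rw [← h1, hH, map_mul, hF]; ring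
  have h3 : eval₂ (aeval P : MvPolynomial (Fin n) K →ₐ[K] L).toRingHom s G
      = ρ (eval₂ Ψ g G) := by
    rw [eval₂_comp_left ρ Ψ g G]
    congr 1
    · exact RingHom.ext fun q => (hρ q).symm
    · funext i; simp [hg]
  rw [h3]
  -- For `d ≤ e` one cancels `t ^ d` and the factor `E` is visible. For `d ≥ e` the leftover power
  -- of `t` divides `E * Ψ H`, hence divides `Ψ H`, because `t` is prime and does not divide `E`.
  rcases le_total d e with hde | hde
  · obtain ⟨k, rfl⟩ := Nat.exists_eq_add_of_le hde
    rw [pow_add, mul_assoc] at h2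
    rw [mul_left_cancel₀ (pow_ne_zero d ht.ne_zero) h2]
    simp [hE0]
  · obtain ⟨k, rfl⟩ := Nat.exists_eq_add_of_le hde
    rw [pow_add, mul_assoc] at h2
    have h4 := mul_left_cancel₀ (pow_ne_zero e ht.ne_zero) h2
    obtain ⟨h, hh⟩ := ht.pow_dvd_of_dvd_mul_left k hE (Dvd.intro _ h4)
    rw [hh, mul_left_comm] at h4
    rw [mul_left_cancel₀ (pow_ne_zero k ht.ne_zero) h4]
    simp [hE0]

lemma aeval_eval (P : Fin n → L) (f : ι → MvPolynomial (Fin n) K)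
    (G : MvPolynomial ι (MvPolynomial (Fin n) K)) :
    aeval P (eval f G) = eval₂ (aeval P : MvPolynomial (Fin n) K →ₐ[K] L).toRingHom
      (fun i => aeval P (f i)) G := by
  have : eval f G = eval₂ (RingHom.id _) f G := rfl
  rw [this]
  exact eval₂_comp_left (aeval P : MvPolynomial (Fin n) K →ₐ[K] L).toRingHom (RingHom.id _) f G

/-- Away from the centre the fibre coordinates are those of the generators themselves, and a
relation modulo `F` then holds because `F` vanishes at `P`. It also serves for dual number points.
-/
lemma isBlowUpPoint_of_eq_mul (hF : aeval P F = 0) (u : L)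
    (hs : ∀ i, s i = u * aeval P (f i)) (hu : ∃ i, IsUnit (s i)) : IsBlowUpPoint F f P s := by
  refine ⟨hu, fun d G hG hGF => ?_⟩
  obtain ⟨H, hH⟩ := Ideal.mem_span_singleton.mp hGF
  rw [show s = fun i => u * aeval P (f i) from funext hs, eval₂_mul_of_isHomogeneous hG,
    ← aeval_eval, hH]
  simp [hF]

lemma IsBlowUpPoint.mul_left (h : IsBlowUpPoint F f P s) {u : L} (hu : IsUnit u) :
    IsBlowUpPoint F f P (fun i => u * s i) := by
  refine ⟨h.1.imp fun i hi => hu.mul hi, fun d G hG hGF => ?_⟩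
  rw [eval₂_mul_of_isHomogeneous hG, h.2 d G hG hGF, mul_zero]

lemma IsBlowUpPoint.linear [Fintype ι] (h : IsBlowUpPoint F f P s)
    (c : ι → MvPolynomial (Fin n) K) (hc : ∑ i, c i * f i ∈ Ideal.span {F}) :
    ∑ i, aeval P (c i) * s i = 0 := by
  have := h.2 1 (∑ i, C (c i) * X i)
    (IsHomogeneous.sum _ _ _ fun i _ => by
      simpa using (isHomogeneous_C ι (c i)).mul (isHomogeneous_X _ i)) (by simpa using hc)
  simpa [eval₂_sum] using this

lemma IsBlowUpPoint.quadratic [Fintype ι] (h : IsBlowUpPoint F f P s)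
    (c : ι → MvPolynomial (Fin n) K) (hc : ∑ i, c i * f i ^ 2 ∈ Ideal.span {F}) :
    ∑ i, aeval P (c i) * s i ^ 2 = 0 := by
  have := h.2 2 (∑ i, C (c i) * X i ^ 2)
    (IsHomogeneous.sum _ _ _ fun i _ => by
      simpa using (isHomogeneous_C ι (c i)).mul ((isHomogeneous_X _ i).pow 2)) (by simpa using hc)
  simpa [eval₂_sum] using this

lemma IsBlowUpPoint.mul_comm_eq [Fintype ι] [DecidableEq ι] (h : IsBlowUpPoint F f P s) (i j : ι) :
    aeval P (f i) * s j = aeval P (f j) * s i := by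
  have := h.linear (fun k => (if k = j then f i else 0) - (if k = i then f j else 0)) (by
    simp only [sub_mul, Finset.sum_sub_distrib, ite_mul, zero_mul, Finset.sum_ite_eq',
      Finset.mem_univ, if_true]
    rw [mul_comm, sub_self]; exact zero_mem _)
  simp only [map_sub, sub_mul, Finset.sum_sub_distrib, apply_ite (aeval P), map_zero, ite_mul,
    zero_mul, Finset.sum_ite_eq', Finset.mem_univ, if_true] at this
  exact sub_eq_zero.mp this

end BlowUp

/-! ### The blow-up of the surface in a chart -/

section Surface

variable {K : Type*} [Field K]

/-- The sum of the homogeneous coordinates, in units of the last one of the chart. -/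
def coordSum {L : Type*} [CommRing L] (v : Fin 4 → L) : L :=
  1 + v 3 + v 3 * v 2 + v 3 * v 2 * v 1 + v 3 * v 2 * v 1 * v 0

/-- The cofactor of `y` in the equation of the threefold. -/
def cofactor {L : Type*} [CommRing L] (c : Fin 6 → L) (v : Fin 4 → L) : L :=
  v 0 * ((c 2 + c 3 * v 2 + c 4 * (v 2 * v 3)) * coordSum v - c 5 * (v 2 * v 3))

/-- The parameters of the threefold, permuted as required by the chart. -/
def chartParam {K : Type*} (a : Fin 6 → K) (ς : Equiv.Perm (Fin 5)) : Fin 6 → K :=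
  Fin.snoc (fun k => a (ς k).castSucc) (a 5)

lemma chartParam_castSucc {K : Type*} (a : Fin 6 → K) (ς : Equiv.Perm (Fin 5))
    (k : Fin 5) : chartParam a ς k.castSucc = a (ς k).castSucc := by
  simp [chartParam]

lemma chartParam_five {K : Type*} (a : Fin 6 → K) (ς : Equiv.Perm (Fin 5)) : chartParam a ς 5 = a 5 :=
  Fin.snoc_last (α := fun _ => K) _ _

/-- The value of the equation of the threefold in terms of permuted parameters. -/
def eqVal {L : Type*} [CommRing L] (c : Fin 6 → L) (v : Fin 4 → L) : L :=
  (c 0 + c 1 * v 0 + c 2 * (v 0 * v 1) + c 3 * (v 0 * v 1 * v 2) + c 4 * (v 0 * v 1 * v 2 * v 3))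
      * coordSum v - c 5 * (v 0 * v 1 * v 2 * v 3)

/-- This form shows that the equation lies in the ideal of the surface. It is the determinant of the
two linear conditions on a direction in `IsDir`, which therefore describe the small resolution. -/
lemma eqVal_eq {L : Type*} [CommRing L] (c : Fin 6 → L) (v : Fin 4 → L) :
    eqVal c v = (c 0 + c 1 * v 0) * coordSum v + v 1 * cofactor c v := by
  simp only [eqVal, cofactor]; ring

lemma hom_localEq {L : Type*} [CommRing L] (φ : MvPolynomial (Fin 4) K →+* L) (a : Fin 6 → K)
    (ς : Equiv.Perm (Fin 5)) :
    φ (localEq a ς) = eqVal (fun i => φ (C (chartParam a ς i))) (fun k => φ (X k)) := by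
  have h (k : Fin 5) := chartParam_castSucc a ς k
  have h0 := h 0; have h1 := h 1; have h2 := h 2; have h3 := h 3; have h4 := h 4
  simp only [Fin.castSucc_zero, Fin.reduceCastSucc] at h0 h1 h2 h3 h4
  simp only [localEq, eqVal, coordSum, chartParam_five, h0, h1, h2, h3, h4, map_sub, map_mul,
    map_add, map_one]

lemma aeval_localEq {L : Type*} [CommRing L] [Algebra K L] (v : Fin 4 → L) (a : Fin 6 → K)
    (ς : Equiv.Perm (Fin 5)) :
    aeval v (localEq a ς) = eqVal (fun i => algebraMap K L (chartParam a ς i)) v := by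
  have := hom_localEq (aeval v : MvPolynomial (Fin 4) K →ₐ[K] L).toRingHom a ς
  simpa using this

lemma eval_localEq (v : Fin 4 → K) (a : Fin 6 → K) (ς : Equiv.Perm (Fin 5)) :
    eval v (localEq a ς) = eqVal (chartParam a ς) v := by
  have := hom_localEq (eval v) a ς
  simpa using this

lemma map_coordSum {L M : Type*} [CommRing L] [CommRing M] (φ : L →+* M) (v : Fin 4 → L) :
    φ (coordSum v) = coordSum fun k => φ (v k) := by
  simp [coordSum]

lemma map_cofactor {L M : Type*} [CommRing L] [CommRing M] (φ : L →+* M) (c : Fin 6 → L)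
    (v : Fin 4 → L) : φ (cofactor c v) = cofactor (fun i => φ (c i)) fun k => φ (v k) := by
  simp [cofactor, map_coordSum]

/-- The points of the blow-up of the surface, by equations. -/
def IsDir (c : Fin 6 → K) (v : Fin 4 → K) (d : Fin 2 → K) : Prop :=
  d ≠ 0 ∧ d 0 * v 1 = d 1 * (c 0 + c 1 * v 0) ∧ d 0 * coordSum v + d 1 * cofactor c v = 0

lemma surfaceGens_eq (a : Fin 6 → K) (ς : Equiv.Perm (Fin 5)) :
    surfaceGens a ς = ![C (chartParam a ς 0) + C (chartParam a ς 1) * X 0, X 1] := by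
  have h0 := chartParam_castSucc a ς 0
  have h1 := chartParam_castSucc a ς 1
  simp only [Fin.castSucc_zero, Fin.reduceCastSucc] at h0 h1
  rw [h0, h1]; rfl

lemma IsBlowUpPoint.isDir {a : Fin 6 → K} {ς : Equiv.Perm (Fin 5)} {v : Fin 4 → K}
    {d : Fin 2 → K} (h : IsBlowUpPoint (localEq a ς) (surfaceGens a ς) v d) :
    IsDir (chartParam a ς) v d := by
  refine ⟨?_, ?_, ?_⟩
  · rintro rfl
    obtain ⟨i, hi⟩ := h.1
    simp at hi
  · have := h.mul_comm_eq 0 1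
    rw [surfaceGens_eq] at this
    simp at this
    linear_combination -this
  · have := h.linear ![coordSum X, cofactor (fun i => C (chartParam a ς i)) X] (by
      rw [Fin.sum_univ_two, surfaceGens_eq]
      refine Ideal.subset_span ?_
      have := hom_localEq (RingHom.id _) a ς
      simp only [RingHom.id_apply] at this
      rw [Set.mem_singleton_iff, this, eqVal_eq]
      simp only [Matrix.cons_val_zero, Matrix.cons_val_one]
      have e : (fun k => X k : Fin 4 → MvPolynomial (Fin 4) K) = X := rfl
      simp only [e]
      ring)
    rw [Fin.sum_univ_two] at this
    simp only [Matrix.cons_val_zero, Matrix.cons_val_one] at this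
    have h1 := map_coordSum (aeval v : MvPolynomial (Fin 4) K →ₐ[K] K).toRingHom X
    have h2 := map_cofactor (aeval v : MvPolynomial (Fin 4) K →ₐ[K] K).toRingHom
      (fun i => C (chartParam a ς i)) X
    simp at h1 h2
    have e (q : MvPolynomial (Fin 4) K) : aeval v q = eval v q := rfl
    rw [e, e, h1, h2] at this
    linear_combination this

/-- Both affine pieces of the blow-up are treated by `isBlowUpPoint_of_lift`. With `A = c 0 + c 1 *
x` as coordinate in place of `x`, which needs `c 1 ≠ 0`, one substitutes `y = τ A` or `A = σ y`. The
equation becomes `A * (S + τ C)` or `y * (σ S + C)`. -/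
lemma isBlowUpPoint_surface_of_isDir {a : Fin 6 → K} {ς : Equiv.Perm (Fin 5)} {v : Fin 4 → K}
    {d : Fin 2 → K} (h1 : chartParam a ς 1 ≠ 0)
    (h : IsDir (chartParam a ς) v d) :
    IsBlowUpPoint (localEq a ς) (surfaceGens a ς) v d := by
  obtain ⟨hd, h2, h3⟩ := h
  set c := chartParam a ς with hc
  by_cases hd1 : d 1 = 0
  · have hd0 : d 0 ≠ 0 := fun h => hd (by ext i; fin_cases i <;> simp [h, hd1])
    -- chart `y = τ A`
    set w : Fin 4 → K := ![c 0 + c 1 * v 0, d 1 / d 0, v 2, v 3] with hw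
    set Φ : Fin 4 → MvPolynomial (Fin 4) K := ![C (c 1)⁻¹ * (X 0 - C (c 0)), X 1 * X 0, X 2, X 3]
      with hΦ
    have hv : ∀ k, eval w (Φ k) = v k := by
      intro k
      fin_cases k
      · simp [Φ, w, h1]
      · simp [Φ, w]
        rw [div_mul_eq_mul_div, ← h2]; field_simp
      · simp [Φ, w]
      · simp [Φ, w]
    have key : IsBlowUpPoint (localEq a ς) (surfaceGens a ς) v ![1, d 1 / d 0] := by
      refine isBlowUpPoint_of_lift (aeval Φ : _ →ₐ[K] MvPolynomial (Fin 4) K).toRingHom (eval w)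
        (t := X 0) (e := 1) (E := coordSum Φ + X 1 * cofactor (fun i => C (c i)) Φ)
        (MvPolynomial.X_prime) ?_ ![1, X 1] ?_ ?_ ?_ ?_ ?_ ⟨0, by simp⟩
      · intro h
        have := map_dvd (eval (0 : Fin 4 → K)) h
        simp [coordSum, cofactor, Φ] at this
      · intro i
        rw [surfaceGens_eq]
        fin_cases i
        · simp [Φ, ← hc, ← mul_assoc, ← C_mul, h1]
        · simp [Φ, mul_comm]
      · rw [hom_localEq, eqVal_eq]
        simp only [AlgHom.toRingHom_eq_coe, RingHom.coe_coe, aeval_X, algHom_C, algebraMap_eq,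
          ← hc]
        have e0 : Φ 0 = C (c 1)⁻¹ * (X 0 - C (c 0)) := rfl
        have e1 : Φ 1 = X 1 * X 0 := rfl
        have e2 : C (c 0) + C (c 1) * Φ 0 = X 0 := by
          rw [e0, ← mul_assoc, ← C_mul, mul_inv_cancel₀ h1, C_1]; ring
        rw [e2, e1]; ring
      · intro q
        have : (eval w).comp (aeval Φ : _ →ₐ[K] MvPolynomial (Fin 4) K).toRingHom
            = (aeval v : MvPolynomial (Fin 4) K →ₐ[K] K).toRingHom := by
          ext i
          · simp
          · simp [hv]
        exact congrArg (fun φ => φ q) this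
      · intro i; fin_cases i <;> simp [w]
      · rw [map_add, map_mul, map_coordSum, map_cofactor]
        simp only [hv, eval_C, eval_X]
        change coordSum v + d 1 / d 0 * cofactor c v = 0
        field_simp
        linear_combination h3
    convert key.mul_left (u := d 0) hd0.isUnit using 1
    ext i; fin_cases i <;> simp; field_simp
  · set w : Fin 4 → K := ![d 0 / d 1, v 1, v 2, v 3] with hw
    set Φ : Fin 4 → MvPolynomial (Fin 4) K := ![C (c 1)⁻¹ * (X 0 * X 1 - C (c 0)), X 1, X 2, X 3]
      with hΦ
    have hv : ∀ k, eval w (Φ k) = v k := by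
      intro k
      fin_cases k
      · simp [Φ, w]
        rw [div_mul_eq_mul_div, h2]; field_simp; ring
      · simp [Φ, w]
      · simp [Φ, w]
      · simp [Φ, w]
    have key : IsBlowUpPoint (localEq a ς) (surfaceGens a ς) v ![d 0 / d 1, 1] := by
      refine isBlowUpPoint_of_lift (aeval Φ : _ →ₐ[K] MvPolynomial (Fin 4) K).toRingHom (eval w)
        (t := X 1) (e := 1) (E := X 0 * coordSum Φ + cofactor (fun i => C (c i)) Φ)
        (MvPolynomial.X_prime) ?_ ![X 0, 1] ?_ ?_ ?_ ?_ ?_ ⟨1, by simp⟩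
      · intro h
        -- At `y = z = w = 0` the strict transform is `σ - c 0 * c 2 / c 1`. This `σ` makes it equal
        -- to `1`, so it is not divisible by `y`.
        have := map_dvd (eval (![1 + (c 1)⁻¹ * c 0 * c 2, 0, 0, 0] : Fin 4 → K)) h
        simp [coordSum, cofactor, Φ] at this
      · intro i
        rw [surfaceGens_eq]
        fin_cases i
        · simp [Φ, ← hc, ← mul_assoc, ← C_mul, h1, mul_comm]
        · simp [Φ]
      · rw [hom_localEq, eqVal_eq]
        simp only [AlgHom.toRingHom_eq_coe, RingHom.coe_coe, aeval_X, algHom_C, algebraMap_eq,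
          ← hc]
        have e0 : Φ 0 = C (c 1)⁻¹ * (X 0 * X 1 - C (c 0)) := rfl
        have e1 : Φ 1 = X 1 := rfl
        have e2 : C (c 0) + C (c 1) * Φ 0 = X 0 * X 1 := by
          rw [e0, ← mul_assoc, ← C_mul, mul_inv_cancel₀ h1, C_1]; ring
        rw [e2, e1]; ring
      · intro q
        have : (eval w).comp (aeval Φ : _ →ₐ[K] MvPolynomial (Fin 4) K).toRingHom
            = (aeval v : MvPolynomial (Fin 4) K →ₐ[K] K).toRingHom := by
          ext i
          · simp
          · simp [hv]
        exact congrArg (fun φ => φ q) this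
      · intro i; fin_cases i <;> simp [w]
      · rw [map_add, map_mul, map_coordSum, map_cofactor]
        simp only [hv, eval_C, eval_X]
        change d 0 / d 1 * coordSum v + cofactor c v = 0
        field_simp
        linear_combination h3
    convert key.mul_left (u := d 1) (Ne.isUnit hd1) using 1
    ext i; fin_cases i <;> simp; field_simp

end Surface


open MvPolynomial

/-! ### Points of the toric variety -/

section Toric

variable {K : Type*} [Field K]

/-- The product of the coordinates between two positions. -/
def segProd (v : Fin 4 → K) (k l : Fin 5) : K :=
  if k < l then
    ∏ m ∈ Finset.univ.filter (fun m : Fin 4 => k ≤ m.castSucc ∧ m.castSucc < l), v m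
  else 1

lemma ratioPart_eq (ς : Equiv.Perm (Fin 5)) (v : Fin 4 → K) (i j : Fin 5) :
    ratioPart ς v i j = segProd v (ς.symm i) (ς.symm j) := rfl

lemma ratioPart_apply (ς : Equiv.Perm (Fin 5)) (v : Fin 4 → K) (k l : Fin 5) :
    ratioPart ς v (ς k) (ς l) = segProd v k l := by
  simp [ratioPart_eq]

lemma segProd_of_le (v : Fin 4 → K) {k l : Fin 5} (h : l ≤ k) : segProd v k l = 1 :=
  if_neg h.not_gt

lemma segProd_castSucc_succ (v : Fin 4 → K) (m : Fin 4) : segProd v m.castSucc m.succ = v m := by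
  rw [segProd, if_pos (Fin.castSucc_lt_succ)]
  convert Finset.prod_singleton v m
  ext n
  simp only [Finset.mem_filter, Finset.mem_univ, true_and, Finset.mem_singleton, Fin.ext_iff,
    Fin.le_def, Fin.lt_def, Fin.val_castSucc, Fin.val_succ]
  omega

lemma segProd_mul (v : Fin 4 → K) {k l m : Fin 5} (h1 : k ≤ l) (h2 : l ≤ m) :
    segProd v k l * segProd v l m = segProd v k m := by
  rcases h1.eq_or_lt with rfl | h1
  · simp [segProd_of_le]
  rcases h2.eq_or_lt with rfl | h2
  · simp [segProd_of_le]
  rw [segProd, segProd, segProd, if_pos h1, if_pos h2, if_pos (h1.trans h2),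
    ← Finset.prod_union]
  · congr 1
    ext n
    simp only [Finset.mem_union, Finset.mem_filter, Finset.mem_univ, true_and]
    constructor
    · rintro (⟨h, h'⟩ | ⟨h, h'⟩)
      · exact ⟨h, h'.trans h2⟩
      · exact ⟨h1.le.trans h, h'⟩
    · rintro ⟨h, h'⟩
      rcases lt_or_ge n.castSucc l with hl | hl
      · exact Or.inl ⟨h, hl⟩
      · exact Or.inr ⟨hl, h'⟩
  · rw [Finset.disjoint_filter]
    rintro n - ⟨-, h⟩ ⟨h', -⟩
    exact absurd h h'.not_gt

/-- The identity is symmetric up to sign, so it reduces to ordered positions, where it is the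
multiplicativity of products over adjacent segments. -/
lemma segProd_cocycle (v : Fin 4 → K) (k l m : Fin 5) :
    segProd v k l * segProd v l m * segProd v m k
      = segProd v l k * segProd v m l * segProd v k m := by
  have key : ∀ {k l m : Fin 5}, k ≤ l → l ≤ m →
      segProd v k l * segProd v l m * segProd v m k
      = segProd v l k * segProd v m l * segProd v k m := by
    intro k l m h1 h2
    rw [segProd_mul v h1 h2, segProd_of_le v h1, segProd_of_le v h2,
      segProd_of_le v (h1.trans h2)]
    ring
  rcases le_total k l with h1 | h1 <;> rcases le_total l m with h2 | h2 <;>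
    rcases le_total k m with h3 | h3
  · exact key h1 h2
  · exact key h1 h2
  · linear_combination -key h3 h2
  · linear_combination key h3 h1
  · linear_combination -key h1 h3
  · linear_combination key h2 h3
  · linear_combination -key h2 h1
  · linear_combination -key h2 h1

variable (ς : Equiv.Perm (Fin 5)) (v : Fin 4 → K)

lemma ratioPart_cocycle (i j k : Fin 5) :
    ratioPart ς v i j * ratioPart ς v j k * ratioPart ς v k i
      = ratioPart ς v j i * ratioPart ς v k j * ratioPart ς v i k :=
  segProd_cocycle v _ _ _

lemma ratioPart_of_le {i j : Fin 5} (h : ς.symm j ≤ ς.symm i) : ratioPart ς v i j = 1 :=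
  segProd_of_le v h

lemma ratioPart_self (i : Fin 5) : ratioPart ς v i i = 1 := ratioPart_of_le ς v le_rfl

lemma ratioPart_zero (i : Fin 5) : ratioPart ς v i (ς 0) = 1 := ratioPart_of_le ς v (by simp)

lemma ratioPart_four (i : Fin 5) : ratioPart ς v (ς 4) i = 1 :=
  ratioPart_of_le ς v (by rw [Equiv.symm_apply_apply]; exact Fin.le_last _)

lemma ratioPart_eq_one_or (i j : Fin 5) : ratioPart ς v i j = 1 ∨ ratioPart ς v j i = 1 :=
  (le_total (ς.symm j) (ς.symm i)).imp (ratioPart_of_le ς v) (ratioPart_of_le ς v)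

open Classical in
/-- The number of vanishing coordinates before the position of an index. -/
noncomputable def level (i : Fin 5) : ℕ :=
  (Finset.univ.filter fun m : Fin 4 => m.castSucc < ς.symm i ∧ v m = 0).card

lemma level_mono {i j : Fin 5} (h : ς.symm i ≤ ς.symm j) : level ς v i ≤ level ς v j := by
  classical
  exact Finset.card_le_card (Finset.monotone_filter_right _
    fun m _ hm => ⟨hm.1.trans_le h, hm.2⟩)

/-- The product between two positions vanishes exactly when a zero coordinate lies between them.
Thus the levels record the ordered partition of the indices, that is, the torus orbit of the point.
-/
lemma ratioPart_eq_zero_iff (i j : Fin 5) :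
    ratioPart ς v i j = 0 ↔ level ς v i < level ς v j := by
  classical
  constructor
  · intro h
    rw [ratioPart] at h
    split_ifs at h with hlt
    · obtain ⟨m, hm, hm0⟩ := Finset.prod_eq_zero_iff.mp h
      simp only [Finset.mem_filter, Finset.mem_univ, true_and] at hm
      refine Finset.card_lt_card (Finset.ssubset_iff_of_subset
        (Finset.monotone_filter_right _ fun m _ hm => ⟨hm.1.trans hlt, hm.2⟩) |>.mpr ⟨m, ?_, ?_⟩)
      · simp [hm.2, hm0]
      · simp [hm.1]
    · exact absurd h one_ne_zero
  · intro h
    have hlt : ς.symm i < ς.symm j := by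
      by_contra hc
      exact absurd h (level_mono ς v (not_lt.mp hc)).not_gt
    rw [ratioPart, if_pos hlt, Finset.prod_eq_zero_iff]
    by_contra hc
    refine h.ne (congrArg Finset.card ?_)
    ext m
    simp only [Finset.mem_filter, Finset.mem_univ, true_and]
    refine ⟨fun hm => ⟨hm.1.trans hlt, hm.2⟩, fun hm => ⟨?_, hm.2⟩⟩
    by_contra hm'
    exact hc ⟨m, by simpa using ⟨not_lt.mp hm', hm.1⟩, hm.2⟩

/-- Two points in charts lie over the same point of the toric variety. -/
def SamePoint (ς : Equiv.Perm (Fin 5)) (v : Fin 4 → K) (ς' : Equiv.Perm (Fin 5))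
    (v' : Fin 4 → K) : Prop :=
  ∀ i j, ratioPart ς v i j * ratioPart ς' v' j i = ratioPart ς' v' i j * ratioPart ς v j i

/-- Coordinates with the same level are in increasing order. -/
def Normal : Prop :=
  ∀ k l : Fin 5, k < l → level ς v (ς k) = level ς v (ς l) → ς k < ς l

variable {ς v} {ς' ς'' : Equiv.Perm (Fin 5)} {v' v'' : Fin 4 → K}

namespace SamePoint

lemma symm (h : SamePoint ς v ς' v') : SamePoint ς' v' ς v := fun i j => (h i j).symm

lemma eq_zero_imp (h : SamePoint ς v ς' v') {i j : Fin 5} (h0 : ratioPart ς v i j = 0) :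
    ratioPart ς' v' i j = 0 := by
  have h1 := h i j
  rw [h0, zero_mul] at h1
  rcases ratioPart_eq_one_or ς v i j with h2 | h2
  · exact absurd (h0.symm.trans h2) zero_ne_one
  · simpa [h2] using h1.symm

lemma eq_zero_iff (h : SamePoint ς v ς' v') {i j : Fin 5} :
    ratioPart ς v i j = 0 ↔ ratioPart ς' v' i j = 0 :=
  ⟨h.eq_zero_imp, h.symm.eq_zero_imp⟩

/-- If the part in the middle chart is nonzero, it can be cancelled. If it is zero, the
corresponding parts in the outer charts vanish as well. -/
lemma trans (h : SamePoint ς v ς' v') (h' : SamePoint ς' v' ς'' v'') :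
    SamePoint ς v ς'' v'' := by
  intro i j
  have h1 := h i j
  have h2 := h' i j
  rcases ratioPart_eq_one_or ς' v' i j with h3 | h3 <;> rw [h3] at h1 h2
  · by_cases h4 : ratioPart ς' v' j i = 0
    · have h5 := (h.eq_zero_iff (i := j)).mpr h4
      have h6 := (h'.eq_zero_iff (i := j)).mp h4
      rw [h5, h6]; ring
    · refine mul_left_cancel₀ h4 ?_
      linear_combination ratioPart ς'' v'' j i * h1 + ratioPart ς v j i * h2
  · by_cases h4 : ratioPart ς' v' i j = 0
    · have h5 := (h.eq_zero_iff (i := i)).mpr h4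
      have h6 := (h'.eq_zero_iff (i := i)).mp h4
      rw [h5, h6]; ring
    · refine mul_left_cancel₀ h4 ?_
      linear_combination ratioPart ς' v' i j * ratioPart ς'' v'' j i * h1
        + ratioPart ς' v' i j * ratioPart ς v j i * h2

lemma level_lt_iff (h : SamePoint ς v ς' v') {i j : Fin 5} :
    level ς v i < level ς v j ↔ level ς' v' i < level ς' v' j := by
  rw [← ratioPart_eq_zero_iff, ← ratioPart_eq_zero_iff, h.eq_zero_iff]

lemma level_eq_iff (h : SamePoint ς v ς' v') {i j : Fin 5} :
    level ς v i = level ς v j ↔ level ς' v' i = level ς' v' j := by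
  have h1 := h.level_lt_iff (i := i) (j := j)
  have h2 := h.level_lt_iff (i := j) (j := i)
  omega

/-- The comparison of levels depends only on the point, and being normal says that the chart sorts
the levels with ties broken by the index. This is the stable sort, so the normal chart is unique. -/
lemma normal_iff (h : SamePoint ς v ς' v') : Normal ς' v' ↔ ς' = Tuple.sort (level ς v) := by
  rw [Tuple.eq_sort_iff]
  constructor
  · intro hn
    refine ⟨fun k l hkl => ?_, fun k l hkl hl => hn k l hkl (h.level_eq_iff.mp hl)⟩
    by_contra hc
    have := h.level_lt_iff.mp (not_le.mp hc)
    exact absurd (level_mono ς' v' (i := ς' k) (j := ς' l) (by simpa using hkl)) this.not_ge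
  · exact fun hs k l hkl hl => hs.2 k l hkl (h.level_eq_iff.mpr hl)

lemma eq_of_chart_eq (h : SamePoint ς v ς v') : v = v' := by
  funext m
  have h1 := h (ς m.castSucc) (ς m.succ)
  simp only [ratioPart_apply, segProd_castSucc_succ,
    segProd_of_le _ (Fin.castSucc_lt_succ (i := m)).le, mul_one] at h1
  exact h1

lemma refl (ς : Equiv.Perm (Fin 5)) (v : Fin 4 → K) : SamePoint ς v ς v := fun _ _ => rfl

lemma chart_eq_of_normal (h : SamePoint ς v ς' v') (hn : Normal ς v) (hn' : Normal ς' v') :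
    ς = ς' :=
  ((refl ς v).normal_iff.mp hn).trans (h.normal_iff.mp hn').symm

end SamePoint

lemma segProd_of_mul {g : Fin 5 → Fin 5 → K} (h1 : ∀ k, g k k = 1)
    (h2 : ∀ k l m, k ≤ l → l ≤ m → g k l * g l m = g k m) (k l : Fin 5) (hkl : k ≤ l) :
    segProd (fun m : Fin 4 => g m.castSucc m.succ) k l = g k l := by
  induction l using Fin.induction with
  | zero =>
    obtain rfl : k = 0 := Fin.le_zero_iff.mp hkl
    rw [segProd_of_le _ le_rfl, h1]
  | succ l ih =>
    rcases hkl.eq_or_lt with rfl | hlt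
    · rw [segProd_of_le _ le_rfl, h1]
    · have h3 : k ≤ l.castSucc := Fin.le_castSucc_iff.mpr hlt
      have h4 : l.castSucc ≤ l.succ := Fin.castSucc_lt_succ.le
      rw [← segProd_mul _ h3 h4, ih h3, segProd_castSucc_succ, h2 _ _ _ h3 h4]

/-- Sorting the indices by level makes all ratios of an earlier coordinate by a later one finite.
These ratios, for neighbouring indices, are the coordinates in the new chart. -/
lemma exists_normal (ς : Equiv.Perm (Fin 5)) (v : Fin 4 → K) :
    ∃ ς' v', Normal ς' v' ∧ SamePoint ς v ς' v' := by
  set ς' := Tuple.sort (level ς v) with hς'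
  have hmono : Monotone (level ς v ∘ ς') := Tuple.monotone_sort _
  have hne : ∀ k l, k ≤ l → ratioPart ς v (ς' l) (ς' k) ≠ 0 := fun k l hkl h0 =>
    absurd (hmono hkl) ((ratioPart_eq_zero_iff ς v _ _).mp h0).not_ge
  set g : Fin 5 → Fin 5 → K := fun k l =>
    ratioPart ς v (ς' k) (ς' l) / ratioPart ς v (ς' l) (ς' k) with hg
  set v' : Fin 4 → K := fun m => g m.castSucc m.succ with hv'
  have hseg : ∀ k l, k ≤ l → segProd v' k l = g k l := by
    refine segProd_of_mul (fun k => by simp [g, ratioPart_self]) fun k l m h1 h2 => ?_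
    have := hne _ _ h1
    have := hne _ _ h2
    have := hne _ _ (h1.trans h2)
    simp only [g]
    field_simp
    linear_combination ratioPart_cocycle ς v (ς' k) (ς' l) (ς' m)
  have hle : ∀ k l, k ≤ l → ratioPart ς v (ς' k) (ς' l) * ratioPart ς' v' (ς' l) (ς' k)
      = ratioPart ς' v' (ς' k) (ς' l) * ratioPart ς v (ς' l) (ς' k) := by
    intro k l hkl
    rw [ratioPart_apply ς', ratioPart_apply ς', segProd_of_le _ hkl, hseg _ _ hkl]
    simp only [g]
    rw [div_mul_cancel₀ _ (hne _ _ hkl), mul_one]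
  have hsame : SamePoint ς v ς' v' := by
    intro i j
    obtain ⟨k, rfl⟩ := ς'.surjective i
    obtain ⟨l, rfl⟩ := ς'.surjective j
    rcases le_total k l with h | h
    · exact hle k l h
    · linear_combination -hle l k h
  exact ⟨ς', v', hsame.normal_iff.mpr hς', hsame⟩

/-! ### Change of charts -/

lemma SamePoint.ne_zero (h : SamePoint ς v ς' v') {i j : Fin 5}
    (h1 : ratioPart ς v j i = 1) (h2 : ratioPart ς' v' i j = 1) : ratioPart ς v i j ≠ 0 := by
  have := h i j
  rw [h1, h2, mul_one] at this
  exact left_ne_zero_of_mul (this ▸ one_ne_zero)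

/-- This is `X_k / X_i = (X_k / X_l) * (X_l / X_i)` for finite ratios, with the second factor read
in the other chart. The cocycle identity is divided by a part that is nonzero because `X_i / X_l`
does not vanish in the other chart. -/
lemma SamePoint.mul_left (h : SamePoint ς v ς' v') {i k l : Fin 5}
    (h1 : ratioPart ς v i k = 1) (h2 : ratioPart ς v l k = 1) (h3 : ratioPart ς' v' i l = 1) :
    ratioPart ς v k i = ratioPart ς v k l * ratioPart ς' v' l i := by
  have h4 := ratioPart_cocycle ς v k l i
  have h5 := h l i
  rw [h1, h2] at h4
  rw [h3] at h5
  have h6 : ratioPart ς v i l ≠ 0 := fun h0 => by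
    rw [h.eq_zero_iff, h3] at h0
    exact one_ne_zero h0
  refine mul_left_cancel₀ h6 ?_
  linear_combination -h4 + ratioPart ς v k l * h5

lemma SamePoint.mul_right (h : SamePoint ς v ς' v') {i k l : Fin 5}
    (h1 : ratioPart ς v k i = 1) (h2 : ratioPart ς v k l = 1) (h3 : ratioPart ς' v' l i = 1) :
    ratioPart ς v i k = ratioPart ς v l k * ratioPart ς' v' i l := by
  have h4 := ratioPart_cocycle ς v i l k
  have h5 := h i l
  rw [h1, h2] at h4
  rw [h3] at h5
  have h6 : ratioPart ς v l i ≠ 0 := fun h0 => by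
    rw [h.eq_zero_iff, h3] at h0
    exact one_ne_zero h0
  refine mul_left_cancel₀ h6 ?_
  linear_combination -h4 + ratioPart ς v l k * h5

/-! ### Homogeneous coordinates and the equation in different charts. -/

lemma aeval_homCoord {L : Type*} [CommRing L] [Algebra K L] (ς : Equiv.Perm (Fin 5))
    (v : Fin 4 → L) (i : Fin 5) : aeval v (homCoord K ς i)
      = ∏ m ∈ Finset.univ.filter (fun m : Fin 4 => ς.symm i ≤ m.castSucc), v m := by
  simp [homCoord]

lemma eval_homCoord (ς : Equiv.Perm (Fin 5)) (v : Fin 4 → K) (i : Fin 5) :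
    eval v (homCoord K ς i) = ratioPart ς v i (ς 4) := by
  obtain ⟨k, rfl⟩ := ς.surjective i
  rw [ratioPart_apply, homCoord, map_prod]
  simp only [Equiv.symm_apply_apply, eval_X]
  have h4 : k ≤ 4 := Fin.le_last k
  rcases h4.eq_or_lt with rfl | h
  · rw [segProd_of_le _ le_rfl]
    refine Finset.prod_eq_one fun m hm => ?_
    simp only [Finset.mem_filter, Finset.mem_univ, true_and, Fin.le_def,
      Fin.val_castSucc] at hm
    change 4 ≤ _ at hm
    omega
  · rw [segProd, if_pos h]
    congr 1
    ext m
    simp only [Finset.mem_filter, Finset.mem_univ, true_and, iff_self_and]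
    exact fun _ => Fin.castSucc_lt_last m

lemma segProd_values (v : Fin 4 → K) :
    segProd v 0 1 = v 0 ∧ segProd v 0 2 = v 0 * v 1 ∧ segProd v 0 3 = v 0 * v 1 * v 2 ∧
    segProd v 0 4 = v 0 * v 1 * v 2 * v 3 ∧ segProd v 1 2 = v 1 ∧
    segProd v 1 4 = v 1 * v 2 * v 3 ∧ segProd v 2 3 = v 2 ∧
    segProd v 2 4 = v 2 * v 3 ∧ segProd v 3 4 = v 3 := by
  have h1 : segProd v 0 1 = v 0 := segProd_castSucc_succ v 0
  have h2 : segProd v 1 2 = v 1 := segProd_castSucc_succ v 1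
  have h3 : segProd v 2 3 = v 2 := segProd_castSucc_succ v 2
  have h4 : segProd v 3 4 = v 3 := segProd_castSucc_succ v 3
  have h5 : segProd v 0 2 = v 0 * v 1 := by
    rw [← segProd_mul v (l := 1) (by decide) (by decide), h1, h2]
  have h6 : segProd v 0 3 = v 0 * v 1 * v 2 := by
    rw [← segProd_mul v (l := 2) (by decide) (by decide), h5, h3]
  have h7 : segProd v 0 4 = v 0 * v 1 * v 2 * v 3 := by
    rw [← segProd_mul v (l := 3) (by decide) (by decide), h6, h4]
  have h8 : segProd v 2 4 = v 2 * v 3 := by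
    rw [← segProd_mul v (l := 3) (by decide) (by decide), h3, h4]
  have h9 : segProd v 1 4 = v 1 * v 2 * v 3 := by
    rw [← segProd_mul v (l := 2) (by decide) (by decide), h2, h8, mul_assoc]
  exact ⟨h1, h5, h6, h7, h2, h9, h3, h8, h4⟩

lemma coordSum_eq_sum (ς : Equiv.Perm (Fin 5)) (v : Fin 4 → K) :
    coordSum v = ∑ i, ratioPart ς v i (ς 4) := by
  obtain ⟨-, -, -, h1, -, h2, -, h3, h4⟩ := segProd_values v
  rw [← Equiv.sum_comp ς]
  simp only [ratioPart_apply, Fin.sum_univ_five, h1, h2, h3, h4, segProd_of_le v le_rfl, coordSum]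
  ring

/-- In this form the equation is the torus equation multiplied by `X_{ς 0} / X_{ς 4}`. Passing to
another chart containing the point only changes this factor, so the equation changes by a ratio, as
recorded in `SamePoint.eqVal_eq`. -/
lemma eqVal_chartParam (a : Fin 6 → K) (ς : Equiv.Perm (Fin 5)) (v : Fin 4 → K) :
    eqVal (chartParam a ς) v = (∑ i, a i.castSucc * ratioPart ς v (ς 0) i)
      * (∑ i, ratioPart ς v i (ς 4)) - a 5 * ratioPart ς v (ς 0) (ς 4) := by
  obtain ⟨h1, h2, h3, h4, -⟩ := segProd_values v
  have e (k : Fin 5) := chartParam_castSucc a ς k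
  have e0 := e 0; have e1 := e 1; have e2 := e 2; have e3 := e 3; have e4 := e 4
  simp only [Fin.castSucc_zero, Fin.reduceCastSucc] at e0 e1 e2 e3 e4
  rw [eqVal, coordSum_eq_sum ς v, ← Equiv.sum_comp ς fun i => a i.castSucc * ratioPart ς v (ς 0) i]
  simp only [ratioPart_apply, Fin.sum_univ_five, h1, h2, h3, h4, segProd_of_le v le_rfl, e0, e1,
    e2, e3, e4, chartParam_five]
  ring

lemma SamePoint.ratioPart_last (h : SamePoint ς v ς' v') (i : Fin 5) :
    ratioPart ς v i (ς 4) = ratioPart ς v (ς' 4) (ς 4) * ratioPart ς' v' i (ς' 4) :=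
  h.mul_right (ratioPart_four ς v i) (ratioPart_four ς v _) (ratioPart_four ς' v' i)

lemma SamePoint.ratioPart_first (h : SamePoint ς v ς' v') (i : Fin 5) :
    ratioPart ς v (ς 0) i = ratioPart ς v (ς 0) (ς' 0) * ratioPart ς' v' (ς' 0) i :=
  h.mul_left (ratioPart_zero ς v i) (ratioPart_zero ς v _) (ratioPart_zero ς' v' i)

lemma SamePoint.last_ne_zero (h : SamePoint ς v ς' v') : ratioPart ς v (ς' 4) (ς 4) ≠ 0 :=
  h.ne_zero (ratioPart_four ς v _) (ratioPart_four ς' v' _)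

lemma SamePoint.coordSum_eq (h : SamePoint ς v ς' v') :
    coordSum v = ratioPart ς v (ς' 4) (ς 4) * coordSum v' := by
  rw [coordSum_eq_sum ς, coordSum_eq_sum ς', Finset.mul_sum]
  exact Finset.sum_congr rfl fun i _ => h.ratioPart_last i

/-- A homogeneous coordinate in terms of an earlier one. -/
lemma ratioPart_last_eq_mul {i j : Fin 5} (hij : ratioPart ς v j i = 1) :
    ratioPart ς v i (ς 4) = ratioPart ς v i j * ratioPart ς v j (ς 4) := by
  have := ratioPart_cocycle ς v i j (ς 4)
  rw [ratioPart_four, ratioPart_four, hij] at this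
  linear_combination -this

lemma SamePoint.eqVal_eq (h : SamePoint ς v ς' v') (a : Fin 6 → K) :
    eqVal (chartParam a ς) v = ratioPart ς v (ς' 4) (ς 4) * ratioPart ς v (ς 0) (ς' 0)
      * eqVal (chartParam a ς') v' := by
  have h1 : ∑ i, a i.castSucc * ratioPart ς v (ς 0) i
      = ratioPart ς v (ς 0) (ς' 0) * ∑ i, a i.castSucc * ratioPart ς' v' (ς' 0) i := by
    rw [Finset.mul_sum]
    exact Finset.sum_congr rfl fun i _ => by rw [h.ratioPart_first]; ring
  rw [eqVal_chartParam, eqVal_chartParam, h1, ← coordSum_eq_sum, ← coordSum_eq_sum, h.coordSum_eq,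
    ratioPart_last_eq_mul (ratioPart_zero ς v (ς' 0)), h.ratioPart_last (ς' 0)]
  ring

end Toric


open MvPolynomial

/-! ### Directions in the blow-up of the surfaces -/

section Dir

variable {K : Type*} [Field K] {c : Fin 6 → K} {v : Fin 4 → K} {d d' : Fin 2 → K}

lemma IsDir.smul (h : IsDir c v d) {u : K} (hu : u ≠ 0) : IsDir c v (u • d) := by
  refine ⟨smul_ne_zero hu h.1, ?_, ?_⟩
  · simp only [Pi.smul_apply, smul_eq_mul]
    linear_combination u * h.2.1
  · simp only [Pi.smul_apply, smul_eq_mul]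
    linear_combination u * h.2.2

/-- The two conditions are linear in the direction, so a single nonzero coefficient determines the
direction up to scaling. -/
lemma IsDir.cross_eq (h : IsDir c v d) (h' : IsDir c v d')
    (hne : v 1 ≠ 0 ∨ c 0 + c 1 * v 0 ≠ 0 ∨ coordSum v ≠ 0 ∨ cofactor c v ≠ 0) :
    d 0 * d' 1 = d' 0 * d 1 := by
  obtain ⟨-, h1, h2⟩ := h
  obtain ⟨-, h1', h2'⟩ := h'
  rcases hne with hne | hne | hne | hne <;> refine mul_left_cancel₀ hne ?_
  · linear_combination d' 1 * h1 - d 1 * h1'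
  · linear_combination d' 0 * h1 - d 0 * h1'
  · linear_combination d' 1 * h2 - d 1 * h2'
  · linear_combination -d' 0 * h2 + d 0 * h2'

/-- Off the surface the direction is `(A : y)`; on it, it is `(C : -S)` unless both entries vanish,
and then every direction is allowed. -/
lemma exists_isDir (h : eqVal c v = 0) : ∃ d, IsDir c v d := by
  rw [eqVal_eq] at h
  by_cases h1 : v 1 = 0 ∧ c 0 + c 1 * v 0 = 0
  · by_cases h2 : coordSum v = 0 ∧ cofactor c v = 0
    · exact ⟨![1, 0], by simp [funext_iff], by simp [h1], by simp [h2]⟩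
    · refine ⟨![cofactor c v, -coordSum v], fun h3 => h2 ?_, by simp [h1], ?_⟩
      · have e0 := congrFun h3 0
        have e1 := congrFun h3 1
        simp at e0 e1
        exact ⟨e1, e0⟩
      · simp; ring
  · refine ⟨![c 0 + c 1 * v 0, v 1], fun h3 => h1 ?_, ?_, ?_⟩
    · have e0 := congrFun h3 0
      have e1 := congrFun h3 1
      simp at e0 e1
      exact ⟨e1, e0⟩
    · simp; ring
    · simpa using h

variable {ς ς' : Equiv.Perm (Fin 5)} {v' : Fin 4 → K}

lemma two_le_symm_of_pair_eq (hs : ({ς 0, ς 1} : Set (Fin 5)) = {ς' 0, ς' 1}) {m : Fin 5}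
    (hm : 2 ≤ m) : 2 ≤ ς.symm (ς' m) := by
  by_contra hc
  have h1 : ς.symm (ς' m) = 0 ∨ ς.symm (ς' m) = 1 := by
    generalize ς.symm (ς' m) = k at hc
    revert hc; revert k; decide
  have h2 : ς' m ∈ ({ς 0, ς 1} : Set (Fin 5)) := by
    rcases h1 with h1 | h1 <;> rw [← h1] <;> simp
  rw [hs] at h2
  rcases h2 with h2 | h2 <;> rw [ς'.injective h2] at hm <;> exact absurd hm (by decide)

lemma two_le_symm_iff_of_pair_eq (hs : ({ς 0, ς 1} : Set (Fin 5)) = {ς' 0, ς' 1}) (i : Fin 5) :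
    2 ≤ ς.symm i ↔ 2 ≤ ς'.symm i := by
  constructor
  · intro h
    have := two_le_symm_of_pair_eq hs.symm h
    rwa [Equiv.apply_symm_apply] at this
  · intro h
    have := two_le_symm_of_pair_eq hs h
    rwa [Equiv.apply_symm_apply] at this

lemma cofactor_chartParam (a : Fin 6 → K) (ς : Equiv.Perm (Fin 5)) (v : Fin 4 → K) :
    cofactor (chartParam a ς) v
      = v 0 * ((∑ i ∈ Finset.univ.filter (fun i => 2 ≤ ς.symm i),
          a i.castSucc * ratioPart ς v (ς 2) i) * coordSum v
        - a 5 * ratioPart ς v (ς 2) (ς 4)) := by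
  obtain ⟨-, -, -, -, -, -, h1, h2, -⟩ := segProd_values v
  have e (k : Fin 5) := chartParam_castSucc a ς k
  have e2 := e 2; have e3 := e 3; have e4 := e 4
  simp only [Fin.reduceCastSucc] at e2 e3 e4
  rw [Finset.sum_filter, ← Equiv.sum_comp ς]
  have l0 : ¬ (2 : Fin 5) ≤ 0 := by decide
  have l1 : ¬ (2 : Fin 5) ≤ 1 := by decide
  have l3 : (2 : Fin 5) ≤ 3 := by decide
  have l4 : (2 : Fin 5) ≤ 4 := by decide
  simp only [ratioPart_apply, Equiv.symm_apply_apply, Fin.sum_univ_five, h1, h2,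
    segProd_of_le v le_rfl, l0, l1, l3, l4, le_refl, if_true, if_false, cofactor, e2, e3, e4,
    chartParam_five]
  ring

/-- The cofactor is `x` times an expression in the last three coordinates which transforms by a
ratio. The factors `v 0` and `v' 0` are kept on both sides because they may vanish. -/
lemma SamePoint.cofactor_eq (h : SamePoint ς v ς' v')
    (hs : ({ς 0, ς 1} : Set (Fin 5)) = {ς' 0, ς' 1}) (a : Fin 6 → K) :
    v' 0 * cofactor (chartParam a ς) v = v 0 * ratioPart ς v (ς 2) (ς' 2)
      * ratioPart ς v (ς' 4) (ς 4) * cofactor (chartParam a ς') v' := by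
  have h2 : ratioPart ς v (ς' 2) (ς 2) = 1 := ratioPart_of_le _ _ (by
    rw [Equiv.symm_apply_apply]; exact two_le_symm_of_pair_eq hs le_rfl)
  have h1 : ∑ i ∈ Finset.univ.filter (fun i => 2 ≤ ς.symm i),
      a i.castSucc * ratioPart ς v (ς 2) i
      = ratioPart ς v (ς 2) (ς' 2) * ∑ i ∈ Finset.univ.filter (fun i => 2 ≤ ς'.symm i),
        a i.castSucc * ratioPart ς' v' (ς' 2) i := by
    rw [Finset.mul_sum]
    refine Finset.sum_congr (Finset.filter_congr fun i _ => two_le_symm_iff_of_pair_eq hs i)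
      fun i hi => ?_
    rw [Finset.mem_filter] at hi
    rw [h.mul_left (i := i) (k := ς 2) (l := ς' 2) (ratioPart_of_le _ _ (by
      rw [Equiv.symm_apply_apply]; exact (two_le_symm_iff_of_pair_eq hs i).mpr hi.2)) h2
      (ratioPart_of_le _ _ (by rw [Equiv.symm_apply_apply]; exact hi.2))]
    ring
  rw [cofactor_chartParam, cofactor_chartParam, h1, h.coordSum_eq, ratioPart_last_eq_mul h2,
    h.ratioPart_last (ς' 2)]
  ring

lemma SamePoint.segProd_one_mul (h : SamePoint ς v ς' v')
    (hs : ({ς 0, ς 1} : Set (Fin 5)) = {ς' 0, ς' 1}) :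
    v' 1 = ratioPart ς v (ς' 1) (ς 2) * ratioPart ς v (ς 2) (ς' 2) := by
  have hj : ς.symm (ς' 1) ≤ 2 := by
    have : ς' 1 ∈ ({ς 0, ς 1} : Set (Fin 5)) := by rw [hs]; simp
    rcases this with h | h <;> rw [h, Equiv.symm_apply_apply] <;> decide
  have hl : 2 ≤ ς.symm (ς' 2) := two_le_symm_of_pair_eq hs le_rfl
  have h1 := ratioPart_cocycle ς v (ς' 1) (ς 2) (ς' 2)
  rw [ratioPart_of_le ς v (i := ς' 2) (j := ς' 1) (hj.trans hl),
    ratioPart_of_le ς v (i := ς 2) (j := ς' 1) (by simpa using hj),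
    ratioPart_of_le ς v (i := ς' 2) (j := ς 2) (by simpa using hl)] at h1
  have h2 := h (ς' 1) (ς' 2)
  rw [ratioPart_of_le ς v (i := ς' 2) (j := ς' 1) (hj.trans hl), ratioPart_apply ς',
    ratioPart_apply ς', segProd_of_le v' (k := 2) (l := 1) (by decide),
    (segProd_values v').2.2.2.2.1] at h2
  linear_combination -h1 - h2

lemma ratioVal_self (i : Fin 5) : ratioVal ς v i i = 1 := by
  simp [ratioVal, ratioPart_self]

/-- Change of charts for directions, for charts that meet the same surface. -/
noncomputable def changeDir (ς : Equiv.Perm (Fin 5)) (v : Fin 4 → K) (ς' : Equiv.Perm (Fin 5))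
    (d : Fin 2 → K) : Fin 2 → K :=
  ![d 0 * ratioVal ς v (ς 1) (ς' 1) ^ 2 * ratioVal ς v (ς' 2) (ς 2), d 1]

lemma SamePoint.ratioVal_two (h : SamePoint ς v ς' v')
    (hs : ({ς 0, ς 1} : Set (Fin 5)) = {ς' 0, ς' 1}) :
    ratioPart ς v (ς 2) (ς' 2) ≠ 0 ∧
      ratioVal ς v (ς' 2) (ς 2) = (ratioPart ς v (ς 2) (ς' 2))⁻¹ := by
  have h2 : ratioPart ς v (ς' 2) (ς 2) = 1 := ratioPart_of_le _ _ (by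
    rw [Equiv.symm_apply_apply]; exact two_le_symm_of_pair_eq hs le_rfl)
  refine ⟨h.ne_zero h2 (ratioPart_of_le _ _ (by
    rw [Equiv.symm_apply_apply]; exact two_le_symm_of_pair_eq hs.symm le_rfl)), ?_⟩
  rw [ratioVal, h2, one_div]

lemma SamePoint.mul_eq_one_of_swap (h : SamePoint ς v ς' v') (h0 : ς 0 = ς' 1)
    (h1 : ς 1 = ς' 0) : v 0 * v' 0 = 1 ∧ ratioVal ς v (ς 1) (ς' 1) = (v 0)⁻¹ := by
  have e := h (ς 0) (ς 1)
  have e1 : ratioPart ς' v' (ς 0) (ς 1) = 1 := by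
    rw [h0, h1, ratioPart_apply, segProd_of_le _ (by decide)]
  have e2 : ratioPart ς' v' (ς 1) (ς 0) = v' 0 := by
    rw [h0, h1, ratioPart_apply, (segProd_values v').1]
  have e3 : ratioPart ς v (ς 1) (ς 0) = 1 := by
    rw [ratioPart_apply, segProd_of_le _ (by decide)]
  have e4 : ratioPart ς v (ς 0) (ς 1) = v 0 := by
    rw [ratioPart_apply, (segProd_values v).1]
  rw [e1, e2, e3, e4, one_mul] at e
  exact ⟨e, by rw [ratioVal, ← h0, e3, e4, one_div]⟩

lemma SamePoint.ratioVal_one_ne_zero (h : SamePoint ς v ς' v')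
    (hs : ({ς 0, ς 1} : Set (Fin 5)) = {ς' 0, ς' 1}) : ratioVal ς v (ς 1) (ς' 1) ≠ 0 := by
  rcases Set.pair_eq_pair_iff.mp hs with ⟨-, h1⟩ | ⟨h0, h1⟩
  · rw [← h1, ratioVal_self]; exact one_ne_zero
  · obtain ⟨e, e'⟩ := h.mul_eq_one_of_swap h0 h1
    rw [e']
    exact inv_ne_zero (left_ne_zero_of_mul (e ▸ one_ne_zero))

/-- If the first two indices agree, then `A` is unchanged and `y` is multiplied by `t`. If they are
swapped, then `A' = A / x` and `y' = x * y * t`. In both cases `(A' : y')` arises from `(A : y)` by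
the factor in `changeDir`, and the second condition on directions transforms accordingly. -/
lemma SamePoint.isDir_changeDir (h : SamePoint ς v ς' v')
    (hs : ({ς 0, ς 1} : Set (Fin 5)) = {ς' 0, ς' 1}) {a : Fin 6 → K}
    (hd : IsDir (chartParam a ς) v d) :
    IsDir (chartParam a ς') v' (changeDir ς v ς' d) := by
  obtain ⟨ht, ht'⟩ := h.ratioVal_two hs
  have hρ := h.ratioVal_one_ne_zero hs
  have hu := h.last_ne_zero
  have hcof := h.cofactor_eq hs a
  have hcs := h.coordSum_eq
  have hy := h.segProd_one_mul hs
  obtain ⟨hd0, hd1, hd2⟩ := hd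
  have e (ς) (k : Fin 5) := chartParam_castSucc a ς k
  have e0 := fun ς => e ς 0; have e1 := fun ς => e ς 1
  simp only [Fin.castSucc_zero, Fin.reduceCastSucc] at e0 e1
  set t := ratioPart ς v (ς 2) (ς' 2)
  set u := ratioPart ς v (ς' 4) (ς 4)
  refine ⟨fun h0 => hd0 ?_, ?_⟩
  · have z0 := congrFun h0 0
    have z1 := congrFun h0 1
    simp only [changeDir, Matrix.cons_val_zero, Matrix.cons_val_one, Pi.zero_apply, ht'] at z0 z1
    ext i
    fin_cases i
    · simpa [hρ, ht] using z0
    · exact z1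
  · simp only [changeDir, Matrix.cons_val_zero, Matrix.cons_val_one, ht']
    rcases Set.pair_eq_pair_iff.mp hs with ⟨h0, h1⟩ | ⟨h0, h1⟩
    · have hv : v 0 = v' 0 := by
        have := h (ς 0) (ς 1)
        rw [h0, h1, ratioPart_apply ς', ratioPart_apply ς', ← h0, ← h1, ratioPart_apply,
          ratioPart_apply, (segProd_values v).1, (segProd_values v').1,
          segProd_of_le v (by decide), segProd_of_le v' (by decide), mul_one, mul_one] at this
        exact this
      rw [← h1, ratioPart_apply, (segProd_values v).2.2.2.2.1] at hy
      rw [← h1, ratioVal_self, hy, e0, e1, ← h0, ← h1, ← e0, ← e1, ← hv]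
      constructor
      · field_simp
        linear_combination hd1
      -- The comparison of cofactors contains the common factor `x`. For `x = 0` it says nothing,
      -- but both cofactors vanish.
      · rcases eq_or_ne (v 0) 0 with hv0 | hv0
        · have z : cofactor (chartParam a ς) v = 0 := by simp [cofactor, hv0]
          have z' : cofactor (chartParam a ς') v' = 0 := by simp [cofactor, ← hv, hv0]
          rw [z', mul_zero, add_zero]
          rw [z, mul_zero, add_zero, hcs] at hd2
          have : d 0 * coordSum v' = 0 := mul_left_cancel₀ hu (by linear_combination hd2)
          field_simp
          linear_combination this
        · rw [← hv] at hcof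
          have hcof' : cofactor (chartParam a ς) v = t * u * cofactor (chartParam a ς') v' :=
            mul_left_cancel₀ hv0 (by linear_combination hcof)
          rw [hcof', hcs] at hd2
          field_simp
          refine mul_left_cancel₀ hu ?_
          linear_combination hd2
    · obtain ⟨hx, hx'⟩ := h.mul_eq_one_of_swap h0 h1
      have hv0 : v 0 ≠ 0 := left_ne_zero_of_mul (hx ▸ one_ne_zero)
      have hv0' : v' 0 = (v 0)⁻¹ := eq_inv_of_mul_eq_one_right hx
      rw [← h0, ratioPart_apply, (segProd_values v).2.1] at hy
      rw [hx', hy, e0, e1, ← h0, ← h1, ← e0, ← e1, hv0']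
      have hcof' : cofactor (chartParam a ς) v
          = v 0 ^ 2 * t * u * cofactor (chartParam a ς') v' := by
        linear_combination v 0 * hcof - cofactor (chartParam a ς) v * hx
      rw [hcof', hcs] at hd2
      constructor
      · field_simp
        linear_combination hd1
      · field_simp
        refine mul_left_cancel₀ hu ?_
        linear_combination hd2

lemma perm_zero_one_of_lt : ∀ σ : Equiv.Perm (Fin 5),
    (σ 0 < σ 2 ∧ σ 0 < σ 3 ∧ σ 0 < σ 4 ∧ σ 1 < σ 2 ∧ σ 1 < σ 3 ∧ σ 1 < σ 4) →
      (σ 0 = 0 ∧ σ 1 = 1) ∨ (σ 0 = 1 ∧ σ 1 = 0) := by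
  decide +kernel

/-- If `y = 0`, the ratios of the first two homogeneous coordinates by the other three vanish. This
property of the point forces the same two indices to come first in every chart containing it. -/
lemma SamePoint.pair_eq_of_eq_zero (h : SamePoint ς v ς' v') (hv : v 1 = 0) :
    ({ς 0, ς 1} : Set (Fin 5)) = {ς' 0, ς' 1} := by
  have key : ∀ k m : Fin 5, k ≤ 1 → 2 ≤ m → ς'.symm (ς k) < ς'.symm (ς m) := by
    intro k m hk hm
    by_contra hc
    have h1 : ratioPart ς v (ς k) (ς m) = 0 := by
      rw [ratioPart_apply, ← segProd_mul v (hk.trans (by decide : (1 : Fin 5) ≤ 2)) hm,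
        ← segProd_mul v hk (by decide : (1 : Fin 5) ≤ 2), (segProd_values v).2.2.2.2.1, hv]
      ring
    rw [h.eq_zero_iff, ratioPart_of_le _ _ (not_lt.mp hc)] at h1
    exact one_ne_zero h1
  have := perm_zero_one_of_lt (ς.trans ς'.symm) ⟨key 0 2 (by decide) (by decide),
    key 0 3 (by decide) (by decide), key 0 4 (by decide) (by decide),
    key 1 2 (by decide) (by decide), key 1 3 (by decide) (by decide),
    key 1 4 (by decide) (by decide)⟩
  simp only [Equiv.trans_apply, Equiv.symm_apply_eq] at this
  rw [Set.pair_eq_pair_iff]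
  exact this

end Dir


open MvPolynomial

/-! ### The exceptional quadrics over the nodes in the torus -/

section Exc

variable {K : Type*} [Field K]

/-- The `2 × 2` minors of two vectors. -/
def wedge {R : Type*} [CommRing R] (b τ : Fin 5 → R) : Fin 5 × Fin 5 → R :=
  fun ij => τ ij.1 * b ij.2 - τ ij.2 * b ij.1

/-- The quadratic form defining the tangent cone at a node. -/
def coneForm (b : Fin 5 → K) (s : Fin 5 × Fin 5 → K) : K :=
  ∑ ij, s ij ^ 2 / (b ij.1 * b ij.2)

/-- The points of the blow-up of a node in the torus, by equations. -/
def IsExc (b x : Fin 5 → K) (s : Fin 5 × Fin 5 → K) : Prop :=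
  s ≠ 0 ∧ ((∃ u : K, s = u • wedge b x) ∨
    (wedge b x = 0 ∧ ∃ τ, s = wedge b τ ∧ coneForm b s = 0))

/-- The parameters are proportional to the squares of the coordinates and of their sum. -/
def IsNodeParam (a : Fin 6 → K) (b : Fin 5 → K) : Prop :=
  (∀ i, b i ≠ 0) ∧ ∃ c : K, c ≠ 0 ∧ ∀ i, phiVec b i = c * a i

lemma phiVec_castSucc (b : Fin 5 → K) (i : Fin 5) : phiVec b i.castSucc = b i ^ 2 := by
  simp [phiVec]

lemma phiVec_five (b : Fin 5 → K) : phiVec b 5 = (∑ i, b i) ^ 2 :=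
  Fin.snoc_last (α := fun _ => K) _ _

lemma IsExc.smul {b x : Fin 5 → K} {s : Fin 5 × Fin 5 → K} (h : IsExc b x s) {u : K}
    (hu : u ≠ 0) : IsExc b x (u • s) := by
  refine ⟨smul_ne_zero hu h.1, h.2.imp ?_ ?_⟩
  · rintro ⟨w, rfl⟩
    exact ⟨u * w, by rw [mul_smul]⟩
  · rintro ⟨h0, τ, hτ, hs⟩
    refine ⟨h0, u • τ, ?_, ?_⟩
    · rw [hτ]; ext ij; simp [wedge]; ring
    · have : coneForm b (u • s) = u ^ 2 * coneForm b s := by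
        rw [coneForm, coneForm, Finset.mul_sum]
        exact Finset.sum_congr rfl fun ij _ => by simp [mul_pow, mul_div_assoc]
      rw [this, hs, mul_zero]

lemma wedge_smul_right (b x : Fin 5 → K) (u : K) : wedge b (u • x) = u • wedge b x := by
  ext ij; simp [wedge]; ring

lemma isExc_smul_iff {b x : Fin 5 → K} {s : Fin 5 × Fin 5 → K} {u : K} (hu : u ≠ 0) :
    IsExc b (u • x) s ↔ IsExc b x s := by
  simp only [IsExc, wedge_smul_right, smul_eq_zero, hu, false_or]
  refine and_congr_right fun _ => or_congr_left ⟨?_, ?_⟩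
  · rintro ⟨w, rfl⟩; exact ⟨w * u, by rw [mul_smul]⟩
  · rintro ⟨w, rfl⟩; exact ⟨w * u⁻¹, by rw [smul_smul, inv_mul_cancel_right₀ hu]⟩

/-- Only the hyperplane `∑ τ i = 0` matters for the cone: moving `τ` along `b` does not change the
minors, and on this hyperplane the form is diagonal. -/
lemma coneForm_wedge {b : Fin 5 → K} (hb : ∀ i, b i ≠ 0) (τ : Fin 5 → K) :
    coneForm b (wedge b τ) = 2 * ((∑ i, b i) * (∑ i, τ i ^ 2 / b i) - (∑ i, τ i) ^ 2) := by
  have h : ∀ i j, (τ i * b j - τ j * b i) ^ 2 / (b i * b j)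
      = τ i ^ 2 / b i * b j + b i * (τ j ^ 2 / b j) - 2 * (τ i * τ j) := by
    intro i j
    have := hb i; have := hb j
    field_simp
    ring
  simp only [coneForm, wedge, Fintype.sum_prod_type, h, Finset.sum_sub_distrib,
    Finset.sum_add_distrib, ← Finset.mul_sum, ← Finset.sum_mul]
  ring

/-- The point of the chart, over the torus point with unit coordinates. -/
def unitCoords {L : Type*} [CommRing L] (ς : Equiv.Perm (Fin 5)) (B : Fin 5 → Lˣ) : Fin 4 → L :=
  fun k => ↑(B (ς k.castSucc) / B (ς k.succ))

lemma aeval_homCoord_unitCoords {L : Type*} [CommRing L] [Algebra K L] (ς : Equiv.Perm (Fin 5))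
    (B : Fin 5 → Lˣ) (i : Fin 5) :
    aeval (unitCoords ς B) (homCoord K ς i) = ↑(B i / B (ς 4)) := by
  obtain ⟨k, rfl⟩ := ς.surjective i
  rw [aeval_homCoord, Equiv.symm_apply_apply, Finset.prod_filter, Fin.prod_univ_four]
  simp only [unitCoords]
  fin_cases k <;> simp [← Units.val_mul, Fin.le_def, Fin.ext_iff]

lemma eval_homCoord_chartCoords (ς : Equiv.Perm (Fin 5)) {b : Fin 5 → K} (hb : ∀ i, b i ≠ 0)
    (i : Fin 5) : eval (chartCoords ς b) (homCoord K ς i) = b i / b (ς 4) := by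
  have := aeval_homCoord_unitCoords (K := K) ς (fun i => Units.mk0 (b i) (hb i)) i
  have e : unitCoords ς (fun i => Units.mk0 (b i) (hb i)) = chartCoords ς b := by
    funext k; simp [unitCoords, chartCoords]
  rw [e] at this
  simpa using this

/-- The coefficients of the equation, as a quadratic form in the generators of the ideal of a
torus point. -/
noncomputable def coneCoeff (K : Type*) [Field K] (ς : Equiv.Perm (Fin 5)) (ij : Fin 5 × Fin 5) :
    MvPolynomial (Fin 4) K :=
  if ij.1 = ij.2 then 0 else ∏ m ∈ ({ij.1, ij.2} : Finset (Fin 5))ᶜ, homCoord K ς m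

/-- This is Lagrange's identity for `(∑ H i) * (∑ β i ^ 2 / H i) - (∑ β i) ^ 2`, with denominators
cleared by `∏ H i`. The factor `2` arises because the sum runs over ordered pairs. -/
lemma sum_prod_compl_mul_sq {R : Type*} [CommRing R] (H β : Fin 5 → R) :
    ∑ i, ∑ j, (if i = j then 0 else ∏ m ∈ ({i, j} : Finset (Fin 5))ᶜ, H m)
        * (H i * β j - H j * β i) ^ 2
      = 2 * ((∑ i, H i) * (∑ i, β i ^ 2 * ∏ m ∈ ({i} : Finset (Fin 5))ᶜ, H m)
          - (∑ i, β i) ^ 2 * ∏ i, H i) := by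
  have e : ∀ i j : Fin 5, ({i, j} : Finset (Fin 5))ᶜ
      = Finset.univ.filter fun m => m ≠ i ∧ m ≠ j := by decide
  have e1 : ∀ i : Fin 5, ({i} : Finset (Fin 5))ᶜ = Finset.univ.filter fun m => m ≠ i := by decide
  simp only [e, e1, Finset.prod_filter, Fin.sum_univ_five, Fin.prod_univ_five]
  simp [Fin.ext_iff]
  ring

/-- For `β = b` the squares in Lagrange's identity are `c` times the parameters, so its right-hand
side is a multiple of the equation. The extra monomial is the product of the homogeneous coordinates
other than the first of the chart, a unit on the torus. This shows that the node is singular and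
gives its tangent cone. -/
lemma sum_coneCoeff {a : Fin 6 → K} {b : Fin 5 → K} {c : K}
    (hc : ∀ i, phiVec b i = c * a i) (ς : Equiv.Perm (Fin 5)) :
    ∑ ij, coneCoeff K ς ij * pointGens b ς ij ^ 2
      = localEq a ς * (C (2 * c) * (X 1 * X 2 ^ 2 * X 3 ^ 3)) := by
  have h0 := sum_prod_compl_mul_sq (fun k => homCoord K ς (ς k)) (fun k => C (b (ς k)))
  have h1 : ∑ ij, coneCoeff K ς ij * pointGens b ς ij ^ 2
      = ∑ i, ∑ j, (if i = j then 0 else ∏ m ∈ ({i, j} : Finset (Fin 5))ᶜ, homCoord K ς (ς m))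
        * (homCoord K ς (ς i) * C (b (ς j)) - homCoord K ς (ς j) * C (b (ς i))) ^ 2 := by
    rw [Fintype.sum_prod_type, ← Equiv.sum_comp ς]
    refine Finset.sum_congr rfl fun i _ => ?_
    rw [← Equiv.sum_comp ς]
    refine Finset.sum_congr rfl fun j _ => ?_
    simp only [coneCoeff, pointGens, ς.injective.eq_iff]
    congr 2
    have e : ({ς i, ς j} : Finset (Fin 5))ᶜ = ({i, j} : Finset (Fin 5))ᶜ.map ς.toEmbedding := by
      ext m
      obtain ⟨n, rfl⟩ := ς.surjective m
      simp
    rw [e, Finset.prod_map]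
    rfl
  rw [h1, h0]
  have hH : ∀ k : Fin 5, homCoord K ς (ς k)
      = ![X 0 * X 1 * X 2 * X 3, X 1 * X 2 * X 3, X 2 * X 3, X 3, 1] k := by
    intro k
    rw [homCoord, Equiv.symm_apply_apply, Finset.prod_filter, Fin.prod_univ_four]
    fin_cases k <;> simp [Fin.le_def]
  have hb : ∀ k : Fin 5, (C (b (ς k)) : MvPolynomial (Fin 4) K) ^ 2
      = C c * C (chartParam a ς k.castSucc) := by
    intro k
    rw [chartParam_castSucc, ← C_pow, ← C_mul, ← hc, phiVec_castSucc]
  have hS : (∑ k, C (b (ς k)) : MvPolynomial (Fin 4) K) ^ 2 = C c * C (chartParam a ς 5) := by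
    rw [Equiv.sum_comp ς fun i => (C (b i) : MvPolynomial (Fin 4) K), ← map_sum, ← C_pow,
      ← C_mul, chartParam_five, ← hc, phiVec_five]
  have hF := hom_localEq (RingHom.id _) a ς
  simp only [RingHom.id_apply] at hF
  have e1 : ∀ i : Fin 5, ({i} : Finset (Fin 5))ᶜ = Finset.univ.filter fun m => m ≠ i := by decide
  have e2 : (C 2 : MvPolynomial (Fin 4) K) = 2 := map_ofNat C 2
  rw [hF, hS]
  simp only [e2, hb, hH, e1, Finset.prod_filter, Fin.sum_univ_five, Fin.prod_univ_five, eqVal,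
    coordSum, C_mul]
  simp [Fin.ext_iff]
  ring

lemma eval_pointGens (b : Fin 5 → K) (ς : Equiv.Perm (Fin 5)) (v : Fin 4 → K) :
    (fun ij => eval v (pointGens b ς ij)) = wedge b fun i => ratioPart ς v i (ς 4) := by
  ext ij
  simp [pointGens, wedge, eval_homCoord]

lemma eq_chartCoords_of_wedge_eq_zero {b : Fin 5 → K} (hb : ∀ i, b i ≠ 0)
    {ς : Equiv.Perm (Fin 5)} {v : Fin 4 → K}
    (h : wedge b (fun i => ratioPart ς v i (ς 4)) = 0) : v = chartCoords ς b := by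
  have hx : ∀ i, ratioPart ς v i (ς 4) = b i / b (ς 4) := by
    intro i
    have := congrFun h (i, ς 4)
    simp only [wedge, ratioPart_self, Pi.zero_apply, one_mul] at this
    rw [eq_div_iff (hb _)]
    linear_combination this
  funext m
  have h1 := ratioPart_last_eq_mul (ς := ς) (v := v) (i := ς m.castSucc) (j := ς m.succ)
    (by rw [ratioPart_apply, segProd_of_le _ Fin.castSucc_lt_succ.le])
  rw [hx, hx, ratioPart_apply, segProd_castSucc_succ] at h1
  have := hb (ς m.succ)
  have := hb (ς 4)
  rw [chartCoords, eq_div_iff (hb _)]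
  field_simp at h1
  linear_combination -h1

lemma wedge_chartCoords {b : Fin 5 → K} (hb : ∀ i, b i ≠ 0) (ς : Equiv.Perm (Fin 5)) :
    wedge b (fun i => ratioPart ς (chartCoords ς b) i (ς 4)) = 0 := by
  ext ij
  simp only [wedge, ← eval_homCoord, eval_homCoord_chartCoords ς hb, Pi.zero_apply]
  ring

lemma eval_coneCoeff {b : Fin 5 → K} (hb : ∀ i, b i ≠ 0) (ς : Equiv.Perm (Fin 5))
    (s : Fin 5 × Fin 5 → K) (hs : ∀ i, s (i, i) = 0) :
    ∑ ij, eval (chartCoords ς b) (coneCoeff K ς ij) * s ij ^ 2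
      = (∏ i, b i) / b (ς 4) ^ 3 * coneForm b s := by
  rw [coneForm, Finset.mul_sum]
  refine Finset.sum_congr rfl fun ij _ => ?_
  obtain ⟨i, j⟩ := ij
  rcases eq_or_ne i j with rfl | hij
  · simp [hs]
  · have h1 : ∏ m, b m = b i * b j * ∏ m ∈ ({i, j} : Finset (Fin 5))ᶜ, b m := by
      rw [← Finset.prod_mul_prod_compl ({i, j} : Finset (Fin 5)), Finset.prod_pair hij]
    have h2 : (({i, j} : Finset (Fin 5))ᶜ).card = 3 := by
      rw [Finset.card_compl, Finset.card_pair hij]; rfl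
    simp only [coneCoeff, if_neg hij, map_prod, eval_homCoord_chartCoords ς hb,
      Finset.prod_div_distrib, Finset.prod_const, h1, h2]
    have := hb i; have := hb j; have := hb (ς 4)
    field_simp

lemma IsNodeParam.sum_ne_zero {a : Fin 6 → K} {b : Fin 5 → K} (h : IsNodeParam a b)
    (ha : a 5 ≠ 0) : ∑ i, b i ≠ 0 := by
  obtain ⟨-, c, hc, hca⟩ := h
  intro h0
  have := hca 5
  rw [phiVec_five, h0] at this
  simp [hc, ha] at this

/-- Outside the centre the fibre coordinates are proportional to the generators. Over the centre,
linear relations between the minors make `s` a vector of minors, and the equation itself is a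
quadratic relation that puts `s` on the tangent cone. -/
lemma IsBlowUpPoint.isExc {a : Fin 6 → K} {b : Fin 5 → K} (h : IsNodeParam a b)
    {ς : Equiv.Perm (Fin 5)} {v : Fin 4 → K} {s : Fin 5 × Fin 5 → K}
    (hs : IsBlowUpPoint (localEq a ς) (pointGens b ς) v s) :
    IsExc b (fun i => ratioPart ς v i (ς 4)) s := by
  have hb := h.1
  obtain ⟨-, c, -, hca⟩ := h
  refine ⟨?_, ?_⟩
  · rintro rfl
    obtain ⟨i, hi⟩ := hs.1
    simp at hi
  have e (q : MvPolynomial (Fin 4) K) : aeval v q = eval v q := rfl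
  rw [← eval_pointGens]
  by_cases h0 : (fun ij => eval v (pointGens b ς ij)) = 0
  · right
    refine ⟨h0, ?_⟩
    rw [eval_pointGens] at h0
    have hv := eq_chartCoords_of_wedge_eq_zero hb h0
    have hlin : ∀ i j, s (i, j) * b 0 = s (i, 0) * b j - s (j, 0) * b i := by
      intro i j
      have := hs.2 1 (C (C (b 0)) * X (i, j) - C (C (b j)) * X (i, 0) + C (C (b i)) * X (j, 0)) (by
        have hX : ∀ (r : K) (k : Fin 5 × Fin 5), (C (C r) * X k :
            MvPolynomial (Fin 5 × Fin 5) (MvPolynomial (Fin 4) K)).IsHomogeneous 1 := fun r k => by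
          simpa using (isHomogeneous_C _ (C r)).mul (isHomogeneous_X _ k)
        exact ((hX _ _).sub (hX _ _)).add (hX _ _)) (by
        have e0 : eval (pointGens b ς) (C (C (b 0)) * X (i, j) - C (C (b j)) * X (i, 0)
            + C (C (b i)) * X (j, 0)) = 0 := by
          simp [pointGens]
          ring
        rw [e0]
        exact zero_mem _)
      simp at this
      linear_combination this
    have hw : s = wedge b fun i => s (i, 0) / b 0 := by
      ext ⟨i, j⟩
      have := hb 0
      simp only [wedge]
      field_simp
      linear_combination hlin i j
    refine ⟨_, hw, ?_⟩
    have hq := hs.quadratic (coneCoeff K ς) (by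
      rw [sum_coneCoeff hca]
      exact Ideal.mul_mem_right _ _ (Ideal.subset_span rfl))
    simp only [e] at hq
    rw [hv, eval_coneCoeff hb ς s (fun i => by rw [hw]; simp [wedge])] at hq
    refine (mul_eq_zero.mp hq).resolve_left (div_ne_zero ?_ (pow_ne_zero _ (hb _)))
    exact Finset.prod_ne_zero_iff.mpr fun i _ => hb i
  · left
    obtain ⟨k, hk⟩ := Function.ne_iff.mp h0
    simp only [Pi.zero_apply] at hk
    refine ⟨s k / eval v (pointGens b ς k), ?_⟩
    ext ij
    have := hs.mul_comm_eq k ij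
    simp only [e] at this
    simp only [Pi.smul_apply, smul_eq_mul]
    field_simp
    linear_combination this

/-- A neighbourhood of a torus point, with generic coordinates. -/
noncomputable def arcUnit {b : Fin 5 → K} (hb : ∀ i, b i ≠ 0) (i : Fin 5) :
    (PowerSeries (MvPolynomial (Fin 5) K))ˣ :=
  IsUnit.unit (a := PowerSeries.C (C (b i)) + PowerSeries.X * PowerSeries.C (X i)) (by
    rw [PowerSeries.isUnit_iff_constantCoeff]
    simpa using hb i)

lemma coe_arcUnit {b : Fin 5 → K} (hb : ∀ i, b i ≠ 0) (i : Fin 5) :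
    (arcUnit hb i : PowerSeries (MvPolynomial (Fin 5) K))
      = PowerSeries.C (C (b i)) + PowerSeries.X * PowerSeries.C (X i) := rfl

/-- Evaluation at the centre of the neighbourhood, in the direction `τ`. -/
noncomputable def arcEval (τ : Fin 5 → K) : PowerSeries (MvPolynomial (Fin 5) K) →+* K :=
  (eval τ).comp PowerSeries.constantCoeff

lemma arcEval_arcUnit {b : Fin 5 → K} (hb : ∀ i, b i ≠ 0) (τ : Fin 5 → K) (i : Fin 5) :
    arcEval τ (arcUnit hb i) = b i := by
  simp [arcEval, coe_arcUnit]

lemma arcEval_div {b : Fin 5 → K} (hb : ∀ i, b i ≠ 0) (τ : Fin 5 → K) (i j : Fin 5) :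
    arcEval τ ↑(arcUnit hb i / arcUnit hb j) = b i / b j := by
  have h : (↑(arcUnit hb i / arcUnit hb j) * ↑(arcUnit hb j) :
      PowerSeries (MvPolynomial (Fin 5) K)) = ↑(arcUnit hb i) := by
    rw [← Units.val_mul, div_mul_cancel]
  have := congrArg (arcEval τ) h
  rwa [map_mul, arcEval_arcUnit, arcEval_arcUnit, ← eq_div_iff (hb j)] at this

/-- Over the node the strict transform is computed on the generic arc `b + t τ`, with power series
in `t` so that the torus coordinates are units. The generators are divisible by `t`, the equation by
`t ^ 2`, and at `t = 0` the quotient of the latter is the cone form up to a unit. -/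
lemma isBlowUpPoint_point_of_isExc (h2 : (2 : K) ≠ 0) {a : Fin 6 → K} {b : Fin 5 → K}
    (h : IsNodeParam a b) (ha : a 5 ≠ 0) {ς : Equiv.Perm (Fin 5)} {v : Fin 4 → K}
    {s : Fin 5 × Fin 5 → K} (hF : eqVal (chartParam a ς) v = 0)
    (hs : IsExc b (fun i => ratioPart ς v i (ς 4)) s) :
    IsBlowUpPoint (localEq a ς) (pointGens b ς) v s := by
  have hS := h.sum_ne_zero ha
  have hb := h.1
  obtain ⟨-, c, hc0, hca⟩ := h
  obtain ⟨hs0, ⟨u, hu⟩ | ⟨h0, τ, hτ, hcone⟩⟩ := hs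
  · obtain ⟨k, hk⟩ := Function.ne_iff.mp hs0
    refine isBlowUpPoint_of_eq_mul (by rw [aeval_localEq]; exact hF) u (fun ij => ?_)
      ⟨k, Ne.isUnit hk⟩
    rw [hu, ← eval_pointGens]; rfl
  obtain rfl := eq_chartCoords_of_wedge_eq_zero hb h0
  set Ψ : MvPolynomial (Fin 4) K →ₐ[K] PowerSeries (MvPolynomial (Fin 5) K) :=
    aeval (unitCoords ς (arcUnit hb)) with hΨ
  have hρ : ∀ τ' q, arcEval τ' (Ψ q) = eval (chartCoords ς b) q := by
    intro τ' q
    have : (arcEval τ').comp Ψ.toRingHom = eval (chartCoords ς b) := by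
      ext i
      · simp [arcEval, PowerSeries.algebraMap_apply]
      · simp [Ψ, unitCoords, arcEval_div hb, chartCoords]
    exact congrArg (fun φ => φ q) this
  set g : Fin 5 × Fin 5 → PowerSeries (MvPolynomial (Fin 5) K) := fun ij =>
    PowerSeries.C (wedge (fun i => C (b i)) X ij) * ↑(arcUnit hb (ς 4))⁻¹ with hg
  have hgen : ∀ ij, Ψ (pointGens b ς ij) = PowerSeries.X * g ij := by
    intro ij
    simp only [pointGens, map_sub, map_mul, Ψ, aeval_homCoord_unitCoords, div_eq_mul_inv,
      Units.val_mul, coe_arcUnit, g, wedge, algHom_C, PowerSeries.algebraMap_apply, algebraMap_eq]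
    ring
  have hgρ : ∀ τ' ij, arcEval τ' (g ij) = (b (ς 4))⁻¹ * wedge b τ' ij := by
    intro τ' ij
    have : arcEval τ' ↑(arcUnit hb (ς 4))⁻¹ = (b (ς 4))⁻¹ := by
      refine eq_inv_of_mul_eq_one_left ?_
      have := congrArg (arcEval τ') (Units.inv_mul (arcUnit hb (ς 4)))
      rwa [map_mul, arcEval_arcUnit, map_one] at this
    simp only [g, map_mul, this]
    simp [arcEval, wedge]
    ring
  have hW : IsUnit (Ψ (C (2 * c) * (X 1 * X 2 ^ 2 * X 3 ^ 3))) := by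
    simp only [map_mul, map_pow, Ψ, aeval_X, unitCoords]
    refine IsUnit.mul ?_ (((Units.isUnit _).mul ((Units.isUnit _).pow 2)).mul
      ((Units.isUnit _).pow 3))
    rw [← map_mul, ← map_mul]
    exact (Ne.isUnit (mul_ne_zero h2 hc0)).map (Ψ.toRingHom.comp C)
  obtain ⟨W, hW⟩ := hW
  set E := (∑ ij, Ψ (coneCoeff K ς ij) * g ij ^ 2) * ↑W⁻¹ with hE
  have hΨF : Ψ (localEq a ς) = PowerSeries.X ^ 2 * E := by
    have := congrArg Ψ (sum_coneCoeff hca ς)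
    rw [map_mul Ψ, ← hW, map_sum] at this
    simp only [map_mul, map_pow, hgen] at this
    refine W.isUnit.mul_right_cancel ?_
    rw [← this, hE, mul_assoc, Units.inv_mul_cancel_right, Finset.mul_sum]
    exact Finset.sum_congr rfl fun ij _ => by ring
  have hEρ : ∀ τ', arcEval τ' E = arcEval τ' ↑W⁻¹ * ((∏ i, b i) / b (ς 4) ^ 3
      * ((b (ς 4))⁻¹ ^ 2 * coneForm b (wedge b τ'))) := by
    intro τ'
    have h3 : (b (ς 4))⁻¹ ^ 2 * coneForm b (wedge b τ')
        = coneForm b fun ij => (b (ς 4))⁻¹ * wedge b τ' ij := by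
      rw [coneForm, coneForm, Finset.mul_sum]
      exact Finset.sum_congr rfl fun ij _ => by ring
    rw [h3, ← eval_coneCoeff hb ς _ (fun i => by simp [wedge]), hE, map_mul, map_sum, mul_comm]
    simp only [map_mul, map_pow, hρ, hgρ]
  have hnd : ¬ PowerSeries.X ∣ E := by
    intro hdvd
    have h3 : ∀ τ', coneForm b (wedge b τ') = 0 := by
      intro τ'
      have h4 : arcEval τ' E = 0 := by
        rw [arcEval, RingHom.comp_apply, PowerSeries.X_dvd_iff.mp hdvd, map_zero]
      rw [hEρ] at h4
      have h5 : arcEval τ' ↑W⁻¹ ≠ 0 := (W⁻¹.isUnit.map (arcEval τ')).ne_zero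
      have h6 : ∏ i, b i ≠ 0 := Finset.prod_ne_zero_iff.mpr fun i _ => hb i
      have h7 := hb (ς 4)
      refine (mul_eq_zero.mp ((mul_eq_zero.mp ((mul_eq_zero.mp h4).resolve_left h5)).resolve_left
        (div_ne_zero h6 (pow_ne_zero _ h7)))).resolve_left (pow_ne_zero _ (inv_ne_zero h7))
    -- If the cone form vanished identically, testing it on unit vectors would make every `b m`
    -- equal to the sum `S`. Then `S = 5 S`, which contradicts `S ≠ 0` outside characteristic `2`.
    have h4 : ∀ m, ∑ i, b i = b m := by
      intro m
      have := h3 (Pi.single m 1)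
      rw [coneForm_wedge hb] at this
      have h5 : ∑ i, (Pi.single m (1 : K) : Fin 5 → K) i ^ 2 / b i = (b m)⁻¹ := by
        rw [Finset.sum_eq_single m]
        · simp
        · intro i _ hi; simp [hi]
        · simp
      rw [h5] at this
      have hm := hb m
      simp [h2] at this
      field_simp at this
      linear_combination this
    have h5 : ∑ i, b i = 5 * ∑ i, b i := by
      nth_rewrite 1 [Finset.sum_congr rfl fun m _ => (h4 m).symm]
      simp
    have h6 : 2 * (2 * ∑ i, b i) = 0 := by linear_combination -h5
    simp [h2, hS] at h6
  have key : IsBlowUpPoint (localEq a ς) (pointGens b ς) (chartCoords ς b)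
      (fun ij => (b (ς 4))⁻¹ * s ij) := by
    obtain ⟨k, hk⟩ := Function.ne_iff.mp hs0
    refine isBlowUpPoint_of_lift Ψ.toRingHom (arcEval τ) (e := 2) PowerSeries.X_prime hnd g hgen
      hΨF (hρ τ) (fun ij => ?_) ?_ ⟨k, (mul_ne_zero (inv_ne_zero (hb _)) hk).isUnit⟩
    · rw [hgρ, hτ]
    · rw [hEρ, ← hτ, hcone]; simp
  convert key.mul_left (hb (ς 4)).isUnit using 1
  ext ij
  rw [mul_inv_cancel_left₀ (hb _)]

end Exc


open MvPolynomial

/-! ### The glued variety in terms of normal chart points -/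

section Glue

variable {K : Type*} [Field K]

/-- The factor by which directions change between charts that meet the same surface. -/
noncomputable def dirFactor (ς : Equiv.Perm (Fin 5)) (v : Fin 4 → K) (ς' : Equiv.Perm (Fin 5)) :
    K :=
  ratioVal ς v (ς 1) (ς' 1) ^ 2 * ratioVal ς v (ς' 2) (ς 2)

variable {ς ς' ς'' : Equiv.Perm (Fin 5)} {v v' v'' : Fin 4 → K}

lemma changeDir_eq (d : Fin 2 → K) : changeDir ς v ς' d = ![d 0 * dirFactor ς v ς', d 1] := by
  rw [changeDir, dirFactor, mul_assoc]

lemma dirFactor_self : dirFactor ς v ς = 1 := by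
  simp [dirFactor, ratioVal_self]

lemma SamePoint.dirFactor_ne_zero (h : SamePoint ς v ς' v')
    (hs : ({ς 0, ς 1} : Set (Fin 5)) = {ς' 0, ς' 1}) : dirFactor ς v ς' ≠ 0 := by
  obtain ⟨h1, h2⟩ := h.ratioVal_two hs
  rw [dirFactor, h2]
  exact mul_ne_zero (pow_ne_zero _ (h.ratioVal_one_ne_zero hs)) (inv_ne_zero h1)

lemma ratioPart_one_of_pair_eq (v : Fin 4 → K)
    (hs : ({ς 0, ς 1} : Set (Fin 5)) = {ς' 0, ς' 1}) : ratioPart ς v (ς 1) (ς' 1) = 1 := by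
  refine ratioPart_of_le _ _ ?_
  have : ς' 1 ∈ ({ς 0, ς 1} : Set (Fin 5)) := by rw [hs]; simp
  rcases this with h | h
  · rw [h]; simp
  · rw [h]

lemma ratioPart_two_of_pair_eq (v : Fin 4 → K)
    (hs : ({ς 0, ς 1} : Set (Fin 5)) = {ς' 0, ς' 1}) : ratioPart ς v (ς' 2) (ς 2) = 1 :=
  ratioPart_of_le _ _ (by
    rw [Equiv.symm_apply_apply]; exact two_le_symm_of_pair_eq hs le_rfl)

lemma SamePoint.dirFactor_mul (h : SamePoint ς v ς' v')
    (hs : ({ς 0, ς 1} : Set (Fin 5)) = {ς' 0, ς' 1})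
    (hs' : ({ς' 0, ς' 1} : Set (Fin 5)) = {ς'' 0, ς'' 1}) :
    dirFactor ς v ς'' = dirFactor ς v ς' * dirFactor ς' v' ς'' := by
  have h1 := h.mul_right (i := ς'' 1) (ratioPart_one_of_pair_eq v (hs.trans hs'))
    (ratioPart_one_of_pair_eq v hs) (ratioPart_one_of_pair_eq v' hs')
  have h2 := h.mul_left (i := ς'' 2) (ratioPart_two_of_pair_eq v (hs.trans hs'))
    (ratioPart_two_of_pair_eq v hs) (ratioPart_two_of_pair_eq v' hs')
  simp only [dirFactor, ratioVal, ratioPart_one_of_pair_eq v (hs.trans hs'),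
    ratioPart_one_of_pair_eq v hs, ratioPart_one_of_pair_eq v' hs',
    ratioPart_two_of_pair_eq v (hs.trans hs'), ratioPart_two_of_pair_eq v hs,
    ratioPart_two_of_pair_eq v' hs', h1, h2, one_div, mul_inv]
  ring

lemma eq_of_rep_cross_eq {d d' : ℙ K (Fin 2 → K)}
    (h : d.rep 0 * d'.rep 1 = d'.rep 0 * d.rep 1) : d = d' := by
  rw [← d.mk_rep, ← d'.mk_rep, Projectivization.mk_eq_mk_iff']
  by_cases h0 : d'.rep 0 = 0
  · have h1 : d'.rep 1 ≠ 0 := fun h1 => d'.rep_nonzero (by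
      ext i; fin_cases i
      · exact h0
      · exact h1)
    refine ⟨d.rep 1 / d'.rep 1, ?_⟩
    ext i
    fin_cases i
    · simp only [Fin.zero_eta, Pi.smul_apply, smul_eq_mul]
      field_simp
      linear_combination -h
    · simp [h1]
  · refine ⟨d.rep 0 / d'.rep 0, ?_⟩
    ext i
    fin_cases i
    · simp [h0]
    · simp only [Fin.mk_one, Pi.smul_apply, smul_eq_mul]
      field_simp
      linear_combination h

lemma isDir_rep_mk {c : Fin 6 → K} {d : Fin 2 → K} (h : IsDir c v d) :
    IsDir c v (Projectivization.mk K d h.1).rep := by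
  obtain ⟨u, hu⟩ := Projectivization.exists_smul_eq_mk_rep K d h.1
  rw [← hu]
  exact h.smul u.ne_zero

lemma isExc_rep_mk {b x : Fin 5 → K} {s : Fin 5 × Fin 5 → K} (h : IsExc b x s) :
    IsExc b x (Projectivization.mk K s h.1).rep := by
  obtain ⟨u, hu⟩ := Projectivization.exists_smul_eq_mk_rep K s h.1
  rw [← hu]
  exact h.smul u.ne_zero

variable {a : Fin 6 → K} {B : Set (ℙ K (Fin 5 → K))}

lemma chartParam_ne_zero (ha : ∀ i, a i ≠ 0) (ς : Equiv.Perm (Fin 5)) (k : Fin 6) :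
    chartParam a ς k ≠ 0 := by
  refine Fin.lastCases ?_ (fun i => ?_) k
  · exact (chartParam_five a ς) ▸ ha 5
  · rw [chartParam_castSucc]; exact ha _

namespace ChartPoint

variable (P Q : ChartPoint K a B)

lemma eqVal_eq_zero : eqVal (chartParam a P.chart) P.pt = 0 := by
  rw [← eval_localEq]; exact P.on_threefold

lemma isDir : IsDir (chartParam a P.chart) P.pt P.dir.rep := P.dir_mem.isDir

lemma isExc (hB : ∀ b ∈ B, IsNodeParam a b.rep) (b : B) :
    IsExc b.1.rep (fun i => ratioPart P.chart P.pt i (P.chart 4)) (P.exc b).rep :=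
  (P.exc_mem b).isExc (hB b.1 b.2)

/-- The same point, from equations for its components. -/
def ofEquations (h2 : (2 : K) ≠ 0) (ha : ∀ i, a i ≠ 0) (hB : ∀ b ∈ B, IsNodeParam a b.rep)
    (ς : Equiv.Perm (Fin 5)) (v : Fin 4 → K) (hF : eqVal (chartParam a ς) v = 0)
    (d : ℙ K (Fin 2 → K)) (hd : IsDir (chartParam a ς) v d.rep)
    (e : B → ℙ K (Fin 5 × Fin 5 → K))
    (he : ∀ b : B, IsExc b.1.rep (fun i => ratioPart ς v i (ς 4)) (e b).rep) :
    ChartPoint K a B where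
  chart := ς
  pt := v
  on_threefold := by rw [eval_localEq]; exact hF
  dir := d
  dir_mem := isBlowUpPoint_surface_of_isDir (chartParam_ne_zero ha ς 1) hd
  exc := e
  exc_mem b := isBlowUpPoint_point_of_isExc h2 (hB b.1 b.2) (ha 5) hF (he b)

end ChartPoint

lemma glued_iff (P Q : ChartPoint K a B) : Glued P Q ↔
    SamePoint P.chart P.pt Q.chart Q.pt ∧
    (({P.chart 0, P.chart 1} : Set (Fin 5)) = {Q.chart 0, Q.chart 1} →
      P.dir.rep 0 * dirFactor P.chart P.pt Q.chart * Q.dir.rep 1 = Q.dir.rep 0 * P.dir.rep 1) ∧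
    P.exc = Q.exc := by
  have e : P.dir.rep 0 * dirFactor P.chart P.pt Q.chart * Q.dir.rep 1
      = P.dir.rep 0 * Q.dir.rep 1 * ratioVal P.chart P.pt (P.chart 1) (Q.chart 1) ^ 2
        * ratioVal P.chart P.pt (Q.chart 2) (P.chart 2) := by
    rw [dirFactor]; ring
  rw [e]; rfl

/-- Transitivity is delicate because directions are compared only between charts meeting the same
surface, and the middle chart may meet another one. -/
lemma glued_equivalence : Equivalence (Glued (K := K) (a := a) (B := B)) := by
  refine ⟨fun P => ?_, fun {P Q} h => ?_, fun {P Q R} h h' => ?_⟩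
  · rw [glued_iff]
    exact ⟨SamePoint.refl _ _, fun _ => by rw [dirFactor_self, mul_one], rfl⟩
  · rw [glued_iff] at h ⊢
    obtain ⟨h1, h2, h3⟩ := h
    refine ⟨h1.symm, fun hs => ?_, h3.symm⟩
    have h4 := h2 hs.symm
    have h5 := h1.dirFactor_mul hs.symm hs
    rw [dirFactor_self] at h5
    refine mul_left_cancel₀ (h1.dirFactor_ne_zero hs.symm) ?_
    linear_combination -h4 - Q.dir.rep 0 * P.dir.rep 1 * h5
  · rw [glued_iff] at h h' ⊢
    obtain ⟨h1, h2, h3⟩ := h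
    obtain ⟨h1', h2', h3'⟩ := h'
    refine ⟨h1.trans h1', fun hs => ?_, h3.trans h3'⟩
    -- For `y = 0` the middle chart meets the same surface and the factors multiply. For `y ≠ 0` the
    -- direction is determined by the point.
    by_cases hv : R.pt 1 = 0
    · have hQ := h1'.symm.pair_eq_of_eq_zero hv
      have e2 := h2 (hs.trans hQ)
      have e2' := h2' hQ.symm
      have e3 := h1.dirFactor_mul (hs.trans hQ) hQ.symm
      rw [e3]
      by_cases hQ1 : Q.dir.rep 1 = 0
      · have hQ0 : Q.dir.rep 0 ≠ 0 := fun h0 => Q.dir.rep_nonzero (by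
          ext i; fin_cases i
          · exact h0
          · exact hQ1)
        rw [hQ1, mul_zero] at e2 e2'
        have hP1 := (mul_eq_zero.mp e2.symm).resolve_left hQ0
        have hR1 := (mul_eq_zero.mp e2').resolve_left
          (mul_ne_zero hQ0 (h1'.dirFactor_ne_zero hQ.symm))
        rw [hP1, hR1, mul_zero, mul_zero]
      · refine mul_left_cancel₀ hQ1 ?_
        linear_combination dirFactor Q.chart Q.pt R.chart * R.dir.rep 1 * e2 + P.dir.rep 1 * e2'
    · have h4 := (h1.trans h1').isDir_changeDir hs P.isDir
      have := h4.cross_eq R.isDir (Or.inl hv)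
      rw [changeDir_eq] at this
      simpa using this

lemma SamePoint.isExc_iff (h : SamePoint ς v ς' v') {b : Fin 5 → K} {s : Fin 5 × Fin 5 → K} :
    IsExc b (fun i => ratioPart ς v i (ς 4)) s
      ↔ IsExc b (fun i => ratioPart ς' v' i (ς' 4)) s := by
  have : (fun i => ratioPart ς v i (ς 4))
      = ratioPart ς v (ς' 4) (ς 4) • fun i => ratioPart ς' v' i (ς' 4) := by
    ext i; exact h.ratioPart_last i
  rw [this, isExc_smul_iff h.last_ne_zero]

/-- The components are transported to the normal chart. If that chart meets a different surface, the
gluing relation puts no condition on the direction, so any admissible one will do. -/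
lemma exists_glued_normal (h2 : (2 : K) ≠ 0) (ha : ∀ i, a i ≠ 0)
    (hB : ∀ b ∈ B, IsNodeParam a b.rep) (P : ChartPoint K a B) :
    ∃ Q : ChartPoint K a B, Normal Q.chart Q.pt ∧ Glued P Q := by
  obtain ⟨ς, v, hn, hsame⟩ := exists_normal P.chart P.pt
  have hF : eqVal (chartParam a ς) v = 0 := by
    rw [hsame.symm.eqVal_eq a, P.eqVal_eq_zero, mul_zero]
  have he : ∀ b : B, IsExc b.1.rep (fun i => ratioPart ς v i (ς 4)) (P.exc b).rep :=
    fun b => hsame.isExc_iff.mp (P.isExc hB b)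
  by_cases hs : ({P.chart 0, P.chart 1} : Set (Fin 5)) = {ς 0, ς 1}
  · have hd := hsame.isDir_changeDir hs P.isDir
    refine ⟨.ofEquations h2 ha hB ς v hF _ (isDir_rep_mk hd) P.exc he, hn, ?_⟩
    rw [glued_iff]
    refine ⟨hsame, fun _ => ?_, rfl⟩
    obtain ⟨u, hu⟩ := Projectivization.exists_smul_eq_mk_rep K _ hd.1
    simp only [ChartPoint.ofEquations, ← hu, Units.smul_def, Pi.smul_apply, smul_eq_mul]
    rw [changeDir_eq]
    simp
    ring
  · obtain ⟨d, hd⟩ := exists_isDir hF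
    refine ⟨.ofEquations h2 ha hB ς v hF _ (isDir_rep_mk hd) P.exc he, hn, ?_⟩
    rw [glued_iff]
    exact ⟨hsame, fun h => absurd h hs, rfl⟩

lemma eq_of_glued_normal {P Q : ChartPoint K a B} (hP : Normal P.chart P.pt)
    (hQ : Normal Q.chart Q.pt) (h : Glued P Q) : P = Q := by
  obtain ⟨h1, h2, h3⟩ := (glued_iff P Q).mp h
  obtain ⟨ς, v, hF, d, hd, e, he⟩ := P
  obtain ⟨ς', v', hF', d', hd', e', he'⟩ := Q
  dsimp only at *
  obtain rfl := h1.chart_eq_of_normal hP hQ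
  obtain rfl := h1.eq_of_chart_eq
  obtain rfl := h3
  have h4 := h2 rfl
  rw [dirFactor_self, mul_one] at h4
  obtain rfl := eq_of_rep_cross_eq h4
  rfl

/-- The normal points of the threefold in charts. -/
abbrev NormalPoint (a : Fin 6 → K) : Type _ :=
  {q : Equiv.Perm (Fin 5) × (Fin 4 → K) // eqVal (chartParam a q.1) q.2 = 0 ∧ Normal q.1 q.2}

/-- The directions over a point of the threefold. -/
abbrev DirFibre (a : Fin 6 → K) (q : Equiv.Perm (Fin 5) × (Fin 4 → K)) : Type _ :=
  {d : ℙ K (Fin 2 → K) // IsDir (chartParam a q.1) q.2 d.rep}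

/-- The fibre of the blow-up of a torus point over a point of the threefold. -/
abbrev ExcFibre (b : ℙ K (Fin 5 → K)) (q : Equiv.Perm (Fin 5) × (Fin 4 → K)) : Type _ :=
  {e : ℙ K (Fin 5 × Fin 5 → K) // IsExc b.rep (fun i => ratioPart q.1 q.2 i (q.1 4)) e.rep}

lemma card_bigResolution (h2 : (2 : K) ≠ 0) (ha : ∀ i, a i ≠ 0)
    (hB : ∀ b ∈ B, IsNodeParam a b.rep) :
    Nat.card (BigResolution K a B)
      = Nat.card (Σ q : NormalPoint a, DirFibre a q.1 × ∀ b : B, ExcFibre b.1 q.1) := by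
  refine (Nat.card_eq_of_bijective (fun x => Quot.mk _ (.ofEquations h2 ha hB x.1.1.1 x.1.1.2
    x.1.2.1 x.2.1.1 x.2.1.2 (fun b => (x.2.2 b).1) fun b => (x.2.2 b).2)) ⟨?_, ?_⟩).symm
  · rintro ⟨⟨⟨ς, v⟩, hF, hn⟩, ⟨d, hd⟩, e⟩ ⟨⟨⟨ς', v'⟩, hF', hn'⟩, ⟨d', hd'⟩, e'⟩ h
    have h := eq_of_glued_normal (by exact hn) (by exact hn')
      ((glued_equivalence.quot_mk_eq_iff _ _).mp h)
    simp only [ChartPoint.ofEquations, ChartPoint.mk.injEq] at h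
    obtain ⟨rfl, rfl, rfl, h4⟩ := h
    obtain rfl : e = e' := funext fun b => Subtype.ext (congrFun h4 b)
    rfl
  · intro x
    obtain ⟨P, rfl⟩ := Quot.exists_rep x
    obtain ⟨Q, hn, hQ⟩ := exists_glued_normal h2 ha hB P
    refine ⟨⟨⟨(Q.chart, Q.pt), Q.eqVal_eq_zero, hn⟩, ⟨Q.dir, Q.isDir⟩,
      fun b => ⟨Q.exc b, Q.isExc hB b⟩⟩, ?_⟩
    exact Quot.sound (glued_equivalence.symm hQ)

end Glue


/-! ### Counting points of quadrics over finite fields -/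

section Quadric

variable {F : Type*} [Field F] [Fintype F] [DecidableEq F]

lemma sum_ite_sq_eq (hF : (2 : F) ≠ 0) (c : F) :
    ∑ u : F, (if u ^ 2 = c then 1 else 0 : ℤ) = quadraticChar F c + 1 := by
  rw [← quadraticChar_card_sqrts (fun h => hF (by
    have := ringChar.Nat.cast_ringChar (R := F)
    rw [h] at this; exact_mod_cast this)) c, Finset.sum_boole]
  simp

lemma sum_sum_ite_mul_eq (c : F) (hc : c ≠ 0) :
    ∑ m : F, ∑ n : F, (if m * n = c then 1 else 0 : ℤ) = Fintype.card F - 1 := by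
  have h : ∀ m : F, ∑ n : F, (if m * n = c then 1 else 0 : ℤ) = 1 - if m = 0 then 1 else 0 := by
    intro m
    rcases eq_or_ne m 0 with rfl | hm
    · simp [hc.symm]
    · have : ∀ n, m * n = c ↔ n = c / m := fun n => by
        rw [eq_div_iff hm, mul_comm]
      simp [this, hm]
  simp [h]

/-- The hyperbola `u ^ 2 = y ^ 2 - c` becomes `m * n = c` in the coordinates `y - u` and `y + u`,
and so has `q - 1` points. -/
lemma sum_quadraticChar_sq_sub (hF : (2 : F) ≠ 0) (c : F) (hc : c ≠ 0) :
    ∑ y : F, quadraticChar F (y ^ 2 - c) = -1 := by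
  have h1 : ∑ y : F, ∑ u : F, (if u ^ 2 = y ^ 2 - c then 1 else 0 : ℤ)
      = Fintype.card F - 1 := by
    rw [← sum_sum_ite_mul_eq c hc, ← Fintype.sum_prod_type', ← Fintype.sum_prod_type']
    let φ : F × F ≃ F × F :=
      { toFun := fun q => (q.1 - q.2, q.1 + q.2)
        invFun := fun q => ((q.1 + q.2) / 2, (q.2 - q.1) / 2)
        left_inv := fun q => by ext <;> dsimp only <;> field_simp <;> ring
        right_inv := fun q => by ext <;> dsimp only <;> field_simp <;> ring }
    refine Fintype.sum_equiv φ _ _ fun q => if_congr ?_ rfl rfl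
    simp only [φ, Equiv.coe_fn_mk]
    constructor <;> intro h <;> linear_combination -h
  simp only [sum_ite_sq_eq hF, Finset.sum_add_distrib, Finset.sum_const, Finset.card_univ,
    nsmul_eq_mul, mul_one] at h1
  linarith

/-- The number of solutions of a binary diagonal quadratic equation. -/
lemma sum_sum_ite_binary (hF : (2 : F) ≠ 0) {α β : F} (hα : α ≠ 0) (hβ : β ≠ 0) (c : F) :
    ∑ x : F, ∑ y : F, (if α * x ^ 2 + β * y ^ 2 = c then 1 else 0 : ℤ)
      = (Fintype.card F - quadraticChar F (-(α * β)))
        + Fintype.card F * quadraticChar F (-(α * β)) * if c = 0 then 1 else 0 := by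
  rw [Finset.sum_comm]
  have h1 : ∀ y : F, ∑ x : F, (if α * x ^ 2 + β * y ^ 2 = c then 1 else 0 : ℤ)
      = quadraticChar F (-(α * β)) * quadraticChar F (y ^ 2 - c / β) + 1 := by
    intro y
    have h2 : ∀ x, α * x ^ 2 + β * y ^ 2 = c ↔ x ^ 2 = (c - β * y ^ 2) / α := fun x => by
      rw [eq_div_iff hα]
      constructor <;> intro h <;> linear_combination h
    simp only [h2]
    rw [sum_ite_sq_eq hF, ← map_mul]
    congr 1
    have h3 : -(α * β) * (y ^ 2 - c / β) = (c - β * y ^ 2) / α * α ^ 2 := by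
      field_simp
      ring
    rw [h3, map_mul, quadraticChar_sq_one' hα, mul_one]
  simp only [h1, Finset.sum_add_distrib, ← Finset.mul_sum]
  split_ifs with hc
  · have h4 : ∀ y : F, quadraticChar F (y ^ 2 - c / β) = 1 - if y = 0 then 1 else 0 := by
      intro y
      rcases eq_or_ne y 0 with rfl | hy
      · simp [hc]
      · simp [hc, hy, quadraticChar_sq_one' hy]
    simp only [h4, Finset.sum_sub_distrib]
    simp
    ring
  · rw [sum_quadraticChar_sq_sub hF _ (div_ne_zero hc hβ)]
    simp
    ring

lemma sum_fin_succ {F M : Type*} [Fintype F] [AddCommMonoid M] {n : ℕ} (f : (Fin (n + 1) → F) → M) :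
    ∑ v, f v = ∑ x : F, ∑ w : Fin n → F, f (Fin.cons x w) := by
  rw [← Fintype.sum_prod_type', ← (Fin.consEquiv fun _ => F).sum_comp]
  rfl

lemma sum_fin_five {F M : Type*} [Fintype F] [AddCommMonoid M] (f : (Fin 5 → F) → M) :
    ∑ v, f v = ∑ x : F, ∑ y : F, ∑ z : F, ∑ w : F, ∑ u : F, f ![x, y, z, w, u] := by
  simp only [sum_fin_succ, Fintype.sum_unique]
  rfl

/-- The number of zeros of a diagonal quadratic form in six variables. -/
lemma sum_ite_senary (hF : (2 : F) ≠ 0) {α : Fin 5 → F} (hα : ∀ i, α i ≠ 0) {β : F}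
    (hβ : β ≠ 0) :
    ∑ v : Fin 5 → F, ∑ y : F, (if ∑ i, α i * v i ^ 2 + β * y ^ 2 = 0 then 1 else 0 : ℤ)
      = (Fintype.card F : ℤ) ^ 5
        + quadraticChar F (-((∏ i, α i) * β)) * (Fintype.card F ^ 3 - Fintype.card F ^ 2) := by
  rw [sum_fin_five]
  have h1 : ∀ x y z w : F, ∑ u : F, ∑ t : F,
      (if ∑ i, α i * (![x, y, z, w, u] : Fin 5 → F) i ^ 2 + β * t ^ 2 = 0 then 1 else 0 : ℤ)
      = (Fintype.card F - quadraticChar F (-(α 4 * β)))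
        + Fintype.card F * quadraticChar F (-(α 4 * β)) *
          if α 2 * z ^ 2 + α 3 * w ^ 2 = -(α 0 * x ^ 2 + α 1 * y ^ 2) then 1 else 0 := by
    intro x y z w
    rw [show (if α 2 * z ^ 2 + α 3 * w ^ 2 = -(α 0 * x ^ 2 + α 1 * y ^ 2) then 1 else 0 : ℤ)
      = if -(α 0 * x ^ 2 + α 1 * y ^ 2 + (α 2 * z ^ 2 + α 3 * w ^ 2)) = 0 then 1 else 0 from
        if_congr (by constructor <;> intro h <;> linear_combination -h) rfl rfl,
      ← sum_sum_ite_binary hF (hα 4) hβ]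
    refine Finset.sum_congr rfl fun u _ => Finset.sum_congr rfl fun t _ => if_congr ?_ rfl rfl
    simp only [Fin.sum_univ_five]
    constructor <;> intro h
    · simp at h; linear_combination h
    · simp; linear_combination h
  have hp : -((∏ i, α i) * β) = -(α 0 * α 1) * -(α 2 * α 3) * -(α 4 * β) := by
    rw [Fin.prod_univ_five]; ring
  rw [hp, map_mul, map_mul]
  simp only [h1, Finset.sum_add_distrib, ← Finset.mul_sum, sum_sum_ite_binary hF (hα 2) (hα 3),
    neg_eq_zero, sum_sum_ite_binary hF (hα 0) (hα 1)]
  simp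
  ring

/-- The number of points of the affine cone over the quadric at a node. -/
lemma sum_ite_cone (hF : (2 : F) ≠ 0) {b : Fin 5 → F} (hb : ∀ i, b i ≠ 0)
    (hS : ∑ i, b i ≠ 0) :
    ∑ τ : Fin 5 → F, (if ∑ i, τ i = 0 ∧ ∑ i, τ i ^ 2 / b i = 0 then 1 else 0 : ℤ)
      = (Fintype.card F : ℤ) ^ 3 + quadraticChar F ((∏ i, b i) * ∑ i, b i)
        * (Fintype.card F ^ 2 - Fintype.card F) := by
  set S := ∑ i, b i with hSdef
  have hq : (Fintype.card F : ℤ) ≠ 0 := by exact_mod_cast Fintype.card_ne_zero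
  -- The form on the hyperplane `∑ τ i = 0` need not be diagonalised. Its orthogonal complement is
  -- spanned by `b`, of norm `S`; the sixth variable, with coefficient `-S`, completes this line to
  -- a hyperbolic plane. Hence the six-variable count is `q ^ 4 * (q - 1)` plus `q` times the wanted
  -- one.
  have h6 := sum_ite_senary hF (α := fun i => (b i)⁻¹) (fun i => inv_ne_zero (hb i)) (β := -S)
    (neg_ne_zero.mpr hS)
  have hχ : quadraticChar F (-((∏ i, (b i)⁻¹) * -S)) = quadraticChar F ((∏ i, b i) * S) := by
    have hP : ∏ i, b i ≠ 0 := Finset.prod_ne_zero_iff.mpr fun i _ => hb i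
    rw [show (∏ i, b i) * S = -((∏ i, (b i)⁻¹) * -S) * (∏ i, b i) ^ 2 by
      rw [Finset.prod_inv_distrib]; field_simp, map_mul _ _ (_ ^ 2), quadraticChar_sq_one' hP,
      mul_one]
  rw [hχ] at h6
  -- decompose along `b` and its orthogonal complement
  have h7 : ∑ v : Fin 5 → F, ∑ y : F,
      (if ∑ i, (b i)⁻¹ * v i ^ 2 + -S * y ^ 2 = 0 then 1 else 0 : ℤ)
      = ∑ τ : Fin 5 → F, (if ∑ i, τ i = 0 then 1 else 0)
        * ∑ x : F, ∑ y : F, (if S * x ^ 2 + -S * y ^ 2 = -∑ i, τ i ^ 2 / b i then 1 else 0) := by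
    have h8 : ∑ τ : Fin 5 → F, (if ∑ i, τ i = 0 then 1 else 0)
        * ∑ x : F, ∑ y : F, (if S * x ^ 2 + -S * y ^ 2 = -∑ i, τ i ^ 2 / b i then 1 else 0 : ℤ)
        = ∑ q : {τ : Fin 5 → F // ∑ i, τ i = 0} × F, ∑ y : F,
          (if S * q.2 ^ 2 + -S * y ^ 2 = -∑ i, q.1.1 i ^ 2 / b i then 1 else 0) := by
      simp only [ite_mul, one_mul, zero_mul]
      rw [← Finset.sum_filter, Finset.sum_subtype (p := fun τ : Fin 5 → F => ∑ i, τ i = 0) _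
        (by simp), Fintype.sum_prod_type]
    rw [h8]
    have hsum : ∀ (τ : Fin 5 → F) (x : F), ∑ i, (τ i + x * b i) = ∑ i, τ i + x * S := by
      intro τ x; rw [Finset.sum_add_distrib, ← Finset.mul_sum]
    have hinv : ∀ v : Fin 5 → F, ∑ i, (v i + (-((∑ i, v i) / S)) * b i) = 0 := by
      intro v; rw [hsum]; field_simp; ring
    let φ : {τ : Fin 5 → F // ∑ i, τ i = 0} × F ≃ (Fin 5 → F) :=
      { toFun := fun q => fun i => q.1.1 i + q.2 * b i
        invFun := fun v => (⟨fun i => v i + (-((∑ i, v i) / S)) * b i, hinv v⟩, (∑ i, v i) / S)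
        left_inv := fun q => by
          have e : (∑ i, (q.1.1 i + q.2 * b i)) / S = q.2 := by
            rw [hsum, q.1.2]; field_simp; ring
          refine Prod.ext (Subtype.ext (funext fun i => ?_)) e
          simp only [e]; ring
        right_inv := fun v => by ext i; dsimp only; ring }
    refine (Fintype.sum_equiv φ _ _ fun q => ?_).symm
    refine Finset.sum_congr rfl fun y _ => if_congr ?_ rfl rfl
    simp only [φ, Equiv.coe_fn_mk]
    have e : ∑ i, (b i)⁻¹ * (q.1.1 i + q.2 * b i) ^ 2
        = ∑ i, q.1.1 i ^ 2 / b i + S * q.2 ^ 2 := by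
      have e1 : ∀ i, (b i)⁻¹ * (q.1.1 i + q.2 * b i) ^ 2
          = q.1.1 i ^ 2 / b i + 2 * q.2 * q.1.1 i + b i * q.2 ^ 2 := by
        intro i
        have := hb i
        field_simp
        ring
      simp only [e1, Finset.sum_add_distrib, ← Finset.mul_sum, ← Finset.sum_mul, q.1.2]
      ring
    rw [e]
    constructor <;> intro h <;> linear_combination h
  have h9 : ∑ τ : Fin 5 → F, (if ∑ i, τ i = 0 then 1 else 0 : ℤ) = (Fintype.card F : ℤ) ^ 4 := by
    rw [sum_fin_five]
    have : ∀ x y z w : F, ∑ u : F, (if ∑ i, (![x, y, z, w, u] : Fin 5 → F) i = 0 then 1 else 0 : ℤ)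
        = 1 := by
      intro x y z w
      have : ∀ u : F, ∑ i, (![x, y, z, w, u] : Fin 5 → F) i = 0 ↔ u = -(x + y + z + w) := by
        intro u
        rw [Fin.sum_univ_five, eq_neg_iff_add_eq_zero, add_comm]; rfl
      simp [this]
    simp only [this]
    simp
    ring
  rw [h7] at h6
  simp only [sum_sum_ite_binary hF hS (neg_ne_zero.mpr hS), mul_neg, neg_neg, ← sq,
    quadraticChar_sq_one' hS, neg_eq_zero, mul_one, mul_add, Finset.sum_add_distrib,
    ← Finset.sum_mul, h9, mul_left_comm _ (Fintype.card F : ℤ), ← Finset.mul_sum] at h6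
  have h10 : ∀ τ : Fin 5 → F, (if ∑ i, τ i = 0 then 1 else 0 : ℤ)
      * (if ∑ i, τ i ^ 2 / b i = 0 then 1 else 0)
      = if ∑ i, τ i = 0 ∧ ∑ i, τ i ^ 2 / b i = 0 then 1 else 0 := by
    intro τ; rw [ite_and]; split_ifs <;> simp
  simp only [h10] at h6
  refine mul_left_cancel₀ hq ?_
  linear_combination h6

end Quadric

/-! ### Counting points of projective cones -/

section Cone

variable {F : Type*} [Field F]

lemma card_cone {V : Type*} [AddCommGroup V] [Module F V] (C : V → Prop)
    (hC : ∀ (u : Fˣ) v, C v → C (u • v)) :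
    Nat.card {v : V // v ≠ 0 ∧ C v}
      = Nat.card {P : ℙ F V // C P.rep} * (Nat.card F - 1) := by
  rw [← Nat.card_units, ← Nat.card_prod]
  refine (Nat.card_eq_of_bijective (fun x => ⟨x.2 • x.1.1.rep,
    (smul_ne_zero_iff_ne x.2).mpr x.1.1.rep_nonzero, hC _ _ x.1.2⟩) ⟨?_, ?_⟩).symm
  · rintro ⟨⟨P, hP⟩, u⟩ ⟨⟨Q, hQ⟩, w⟩ h
    have h1 : u • P.rep = w • Q.rep := congrArg Subtype.val h
    have h2 : P = Q := by
      rw [← P.mk_rep, ← Q.mk_rep, Projectivization.mk_eq_mk_iff]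
      exact ⟨u⁻¹ * w, by rw [mul_smul, ← h1, inv_smul_smul]⟩
    subst h2
    have h3 : u = w := by
      have h4 : (u.1 - w.1) • P.rep = 0 := by
        rw [sub_smul, sub_eq_zero]; exact h1
      exact Units.ext (sub_eq_zero.mp ((smul_eq_zero.mp h4).resolve_right P.rep_nonzero))
    rw [h3]
  · rintro ⟨v, hv, hCv⟩
    obtain ⟨u, hu⟩ := Projectivization.exists_smul_eq_mk_rep F v hv
    refine ⟨⟨⟨Projectivization.mk F v hv, hu ▸ hC u v hCv⟩, u⁻¹⟩, Subtype.ext ?_⟩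
    simp only [← hu, inv_smul_smul]

end Cone


open MvPolynomial

/-! ### The fibres of the resolution over the points of the threefold -/

section Fibres

variable {F : Type*} [Field F]

/-- The nodes of the threefold outside the torus. -/
def IsBoundaryNode (a : Fin 6 → F) (q : Equiv.Perm (Fin 5) × (Fin 4 → F)) : Prop :=
  chartParam a q.1 0 + chartParam a q.1 1 * q.2 0 = 0 ∧ q.2 1 = 0 ∧ q.2 2 = 0 ∧ q.2 3 = -1

lemma isBoundaryNode_iff {a : Fin 6 → F} (ha : ∀ i, a i ≠ 0)
    (q : Equiv.Perm (Fin 5) × (Fin 4 → F)) :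
    IsBoundaryNode a q ↔ q.2 1 = 0 ∧ chartParam a q.1 0 + chartParam a q.1 1 * q.2 0 = 0 ∧
      coordSum q.2 = 0 ∧ cofactor (chartParam a q.1) q.2 = 0 := by
  constructor
  · rintro ⟨h0, h1, h2, h3⟩
    have hc : coordSum q.2 = 0 := by simp [coordSum, h1, h2, h3]
    exact ⟨h1, h0, hc, by simp [cofactor, hc, h2]⟩
  · rintro ⟨h1, h0, h2, h3⟩
    have hx : q.2 0 ≠ 0 := fun hx => by
      rw [hx, mul_zero, add_zero] at h0
      exact chartParam_ne_zero ha q.1 0 h0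
    have h5 := chartParam_ne_zero ha q.1 5
    rw [cofactor, h2, mul_zero, zero_sub, mul_neg, neg_eq_zero] at h3
    have h4 := (mul_eq_zero.mp ((mul_eq_zero.mp h3).resolve_left hx)).resolve_left h5
    rw [coordSum, h1] at h2
    have hz : q.2 2 = 0 := by
      refine (mul_eq_zero.mp h4).resolve_right fun hw => ?_
      rw [hw] at h2
      simp at h2
    rw [hz] at h2
    exact ⟨h0, h1, hz, by linear_combination h2⟩

variable [Fintype F]

open Classical in
lemma card_dirFibre {a : Fin 6 → F} (ha : ∀ i, a i ≠ 0) (q : NormalPoint a) :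
    (Nat.card (DirFibre a q.1) : ℤ)
      = 1 + Fintype.card F * if IsBoundaryNode a q.1 then 1 else 0 := by
  obtain ⟨q, hF, -⟩ := q
  have hb := isBoundaryNode_iff ha q
  split_ifs with h
  · obtain ⟨h1, h2, h3, h4⟩ := hb.mp h
    have : ∀ d : ℙ F (Fin 2 → F), IsDir (chartParam a q.1) q.2 d.rep := fun d =>
      ⟨d.rep_nonzero, by rw [h1, h2]; ring, by rw [h3, h4]; ring⟩
    rw [Nat.card_congr (Equiv.subtypeUnivEquiv this),
      Projectivization.card_of_finrank_two F _ (by simp), Nat.card_eq_fintype_card]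
    push_cast; ring
  · obtain ⟨d, hd⟩ := exists_isDir hF
    have : Unique (DirFibre a q) :=
      { default := ⟨_, isDir_rep_mk hd⟩
        uniq := fun d' => Subtype.ext (eq_of_rep_cross_eq (d'.2.cross_eq (isDir_rep_mk hd) (by
          rw [hb] at h
          by_contra! hc
          exact h ⟨hc.1, hc.2.1, hc.2.2.1, hc.2.2.2⟩))) }
    rw [Nat.card_unique]; simp

omit [Fintype F] in
lemma card_excFibre_of_ne (b : ℙ F (Fin 5 → F)) (q : Equiv.Perm (Fin 5) × (Fin 4 → F))
    (h : wedge b.rep (fun i => ratioPart q.1 q.2 i (q.1 4)) ≠ 0) :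
    Nat.card (ExcFibre b q) = 1 := by
  set s := wedge b.rep (fun i => ratioPart q.1 q.2 i (q.1 4)) with hs
  have hs' : IsExc b.rep (fun i => ratioPart q.1 q.2 i (q.1 4)) s :=
    ⟨h, Or.inl ⟨1, by rw [one_smul]⟩⟩
  have : Unique (ExcFibre b q) :=
    { default := ⟨_, isExc_rep_mk hs'⟩
      uniq := fun e => Subtype.ext (by
        obtain ⟨e, he0, ⟨u, hu⟩ | ⟨h0, -⟩⟩ := e
        · exact e.mk_rep.symm.trans
            ((Projectivization.mk_eq_mk_iff' _ _ _ e.rep_nonzero h).mpr ⟨u, hu.symm⟩)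
        · exact absurd h0 h) }
  exact Nat.card_unique

variable [DecidableEq F]

/-- Since `S ≠ 0`, the hyperplane `∑ τ i = 0` is a complement of the line spanned by `b`, which is
the kernel of `wedge b`. So the fibre is the projective quadric of the diagonal form on this
hyperplane, and `sum_ite_cone` counts its cone. -/
lemma card_excFibre_of_eq (hF : (2 : F) ≠ 0) {a : Fin 6 → F} (ha : ∀ i, a i ≠ 0)
    {b : ℙ F (Fin 5 → F)} (hb : IsNodeParam a b.rep) (q : Equiv.Perm (Fin 5) × (Fin 4 → F))
    (h : wedge b.rep (fun i => ratioPart q.1 q.2 i (q.1 4)) = 0) :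
    (Nat.card (ExcFibre b q) : ℤ) = 1 + Fintype.card F * (Fintype.card F + 1
      + quadraticChar F ((∏ i, b.rep i) * ∑ i, b.rep i)) := by
  have hS := hb.sum_ne_zero (ha 5)
  have hb0 := hb.1
  set β := b.rep
  set x := fun i => ratioPart q.1 q.2 i (q.1 4)
  have h1 := card_cone (F := F) (fun s : Fin 5 × Fin 5 → F => IsExc β x s)
    fun u s hs => hs.smul u.ne_zero
  have h2 : Nat.card {s : Fin 5 × Fin 5 → F // s ≠ 0 ∧ IsExc β x s}
      = Nat.card {τ : Fin 5 → F // (∑ i, τ i = 0 ∧ ∑ i, τ i ^ 2 / β i = 0) ∧ τ ≠ 0} := by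
    have hform : ∀ τ : Fin 5 → F, ∑ i, τ i = 0 → ∑ i, τ i ^ 2 / β i = 0 →
        coneForm β (wedge β τ) = 0 := fun τ h h' => by
      rw [coneForm_wedge hb0, h, h']; ring
    have hinj : ∀ τ τ' : Fin 5 → F, ∑ i, τ i = 0 → ∑ i, τ' i = 0 → wedge β τ = wedge β τ' →
        τ = τ' := by
      intro τ τ' hτ hτ' hw
      have h3 : ∀ i, (τ i - τ' i) * β 0 = (τ 0 - τ' 0) * β i := fun i => by
        have := congrFun hw (i, 0)
        simp only [wedge] at this
        linear_combination this
      have h4 : (τ 0 - τ' 0) * ∑ i, β i = 0 := by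
        rw [Finset.mul_sum, ← Finset.sum_congr rfl fun i _ => h3 i, ← Finset.sum_mul,
          Finset.sum_sub_distrib, hτ, hτ']
        ring
      have h5 := (mul_eq_zero.mp h4).resolve_right hS
      funext i
      have h6 := h3 i
      rw [h5, zero_mul] at h6
      exact sub_eq_zero.mp ((mul_eq_zero.mp h6).resolve_right (hb0 0))
    have hw0 : wedge β (0 : Fin 5 → F) = 0 := by ext ij; simp [wedge]
    have hne : ∀ τ : {τ : Fin 5 → F // (∑ i, τ i = 0 ∧ ∑ i, τ i ^ 2 / β i = 0) ∧ τ ≠ 0},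
        wedge β τ.1 ≠ 0 :=
      fun τ h0 => τ.2.2 (hinj _ _ τ.2.1.1 (by simp) (h0.trans hw0.symm))
    refine (Nat.card_eq_of_bijective (fun τ => ⟨wedge β τ.1, hne τ, hne τ, Or.inr ⟨h, τ.1, rfl,
      hform _ τ.2.1.1 τ.2.1.2⟩⟩) ⟨?_, ?_⟩).symm
    · intro τ τ' hττ
      exact Subtype.ext (hinj _ _ τ.2.1.1 τ'.2.1.1 (congrArg Subtype.val hττ))
    · rintro ⟨s, hs0, hs⟩
      obtain ⟨τ, hτ, hc⟩ : ∃ τ, s = wedge β τ ∧ coneForm β s = 0 := by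
        rcases hs.2 with ⟨u, hu⟩ | ⟨-, h3⟩
        · rw [h, smul_zero] at hu; exact absurd hu hs0
        · exact h3
      set τ' : Fin 5 → F := fun i => τ i - (∑ j, τ j) / (∑ j, β j) * β i with hτ'
      have hw : wedge β τ' = wedge β τ := by
        ext ij; simp only [wedge, τ']; ring
      have hsum : ∑ i, τ' i = 0 := by
        simp only [τ', Finset.sum_sub_distrib, ← Finset.mul_sum]
        field_simp; ring
      have hq : ∑ i, τ' i ^ 2 / β i = 0 := by
        rw [hτ, ← hw, coneForm_wedge hb0, hsum] at hc
        have : 2 * (∑ i, β i) * (∑ i, τ' i ^ 2 / β i) = 0 := by linear_combination hc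
        exact (mul_eq_zero.mp this).resolve_left (mul_ne_zero hF hS)
      refine ⟨⟨τ', ⟨hsum, hq⟩, fun h0 => hs0 ?_⟩, Subtype.ext (hw.trans hτ.symm)⟩
      rw [hτ, ← hw, h0, hw0]
  have h3 : (Nat.card {τ : Fin 5 → F // (∑ i, τ i = 0 ∧ ∑ i, τ i ^ 2 / β i = 0) ∧ τ ≠ 0} : ℤ)
      = (Fintype.card F : ℤ) ^ 3 + quadraticChar F ((∏ i, β i) * ∑ i, β i)
        * (Fintype.card F ^ 2 - Fintype.card F) - 1 := by
    rw [← sum_ite_cone hF hb0 hS, Finset.sum_boole, Nat.card_eq_fintype_card, Fintype.card_subtype,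
      ← Finset.filter_filter, Finset.filter_ne' , Finset.card_erase_of_mem (by simp)]
    rw [Nat.cast_sub (Finset.card_pos.mpr ⟨0, by simp⟩)]
    simp
  have hq : 1 < Fintype.card F := Fintype.one_lt_card
  rw [h2] at h1
  have h4 := congrArg (Nat.cast : ℕ → ℤ) h1
  rw [h3, Nat.card_eq_fintype_card (α := F), Nat.cast_mul, Nat.cast_sub hq.le, Nat.cast_one] at h4
  have hq' : (Fintype.card F : ℤ) - 1 ≠ 0 := by
    have : (1 : ℤ) < Fintype.card F := by exact_mod_cast hq
    omega
  refine mul_right_cancel₀ hq' ?_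
  change (Nat.card {P : ℙ F (Fin 5 × Fin 5 → F) // IsExc β x P.rep} : ℤ) * _ = _
  rw [← h4]
  ring

/-! ### The points of the threefold at the nodes -/

omit [Fintype F] [DecidableEq F] in
lemma eqVal_chartCoords (hF : (2 : F) ≠ 0) {a : Fin 6 → F} {b : Fin 5 → F}
    (hb : IsNodeParam a b) (ς : Equiv.Perm (Fin 5)) :
    eqVal (chartParam a ς) (chartCoords ς b) = 0 := by
  obtain ⟨hb0, c, hc, hca⟩ := hb
  have h1 := congrArg (eval (chartCoords ς b)) (sum_coneCoeff hca ς)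
  have h2 : ∀ ij, eval (chartCoords ς b) (pointGens b ς ij) = 0 := fun ij =>
    congrFun ((eval_pointGens b ς _).trans (wedge_chartCoords hb0 ς)) ij
  have h3 : ∀ k, chartCoords ς b k ≠ 0 := fun k => div_ne_zero (hb0 _) (hb0 _)
  rw [map_sum] at h1
  simp only [map_mul, map_pow, h2, eval_localEq, eval_C, eval_X] at h1
  simp [h3, hc, hF] at h1
  exact h1

omit [Fintype F] [DecidableEq F] in
-- At a torus point no coordinate vanishes, so there is one block and the identity is the only
-- normal chart.
lemma wedge_eq_zero_iff {b : Fin 5 → F} (hb : ∀ i, b i ≠ 0)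
    {q : Equiv.Perm (Fin 5) × (Fin 4 → F)} (hq : Normal q.1 q.2) :
    wedge b (fun i => ratioPart q.1 q.2 i (q.1 4)) = 0 ↔ q = (1, chartCoords 1 b) := by
  constructor
  · intro h
    obtain ⟨ς, v⟩ := q
    obtain rfl : v = chartCoords ς b := eq_chartCoords_of_wedge_eq_zero hb h
    have h1 : ∀ k, chartCoords ς b k ≠ 0 := fun k => div_ne_zero (hb _) (hb _)
    have h2 : ∀ i, level ς (chartCoords ς b) i = 0 := fun i => by simp [level, h1]
    have h3 : ς = 1 := (Equiv.Perm.monotone_iff ς).mp fun k l hkl => by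
      rcases hkl.eq_or_lt with rfl | hlt
      · exact le_rfl
      · exact (hq k l hlt (by rw [h2, h2])).le
    rw [h3]
  · rintro rfl
    exact wedge_chartCoords hb 1

omit [Fintype F] [DecidableEq F] in
lemma normal_one (v : Fin 4 → F) : Normal 1 v := fun _ _ hkl _ => hkl

omit [Fintype F] [DecidableEq F] in
lemma eq_of_chartCoords_eq {b b' : ℙ F (Fin 5 → F)} (hb : ∀ i, b.rep i ≠ 0)
    (hb' : ∀ i, b'.rep i ≠ 0) (h : chartCoords 1 b.rep = chartCoords 1 b'.rep) : b = b' := by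
  have h1 : ∀ i, b.rep i / b.rep 4 = b'.rep i / b'.rep 4 := fun i => by
    have e := eval_homCoord_chartCoords 1 hb i
    have e' := eval_homCoord_chartCoords 1 hb' i
    rw [h] at e
    exact e.symm.trans e'
  rw [← b.mk_rep, ← b'.mk_rep, Projectivization.mk_eq_mk_iff']
  refine ⟨b.rep 4 / b'.rep 4, ?_⟩
  ext i
  have := h1 i
  have := hb 4
  have := hb' 4
  rw [Pi.smul_apply, smul_eq_mul]
  field_simp at *
  linear_combination -(h1 i)

open Classical in
/-- The number of points of the resolution in terms of points of the threefold. -/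
lemma card_bigResolution_eq (hF : (2 : F) ≠ 0) {a : Fin 6 → F} (ha : ∀ i, a i ≠ 0)
    {B : Set (ℙ F (Fin 5 → F))} (hB : ∀ b ∈ B, IsNodeParam a b.rep) :
    (Nat.card (BigResolution F a B) : ℤ) = Nat.card (NormalPoint a)
      + Fintype.card F * Nat.card {q : NormalPoint a // IsBoundaryNode a q.1}
      + ∑ᶠ b ∈ B, (Fintype.card F : ℤ) * (Fintype.card F + 1
        + quadraticChar F ((∏ i, b.rep i) * ∑ i, b.rep i)) := by
  have : Finite (ℙ F (Fin 5 → F)) := (Projectivization.finite_iff_of_finite F _).mpr inferInstance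
  have : Finite (ℙ F (Fin 5 × Fin 5 → F)) :=
    (Projectivization.finite_iff_of_finite F _).mpr inferInstance
  have : Finite (ℙ F (Fin 2 → F)) := (Projectivization.finite_iff_of_finite F _).mpr inferInstance
  have : Fintype (NormalPoint a) := Fintype.ofFinite _
  have : Fintype B := Fintype.ofFinite _
  set e : B → ℤ := fun b => (Fintype.card F : ℤ) * (Fintype.card F + 1
        + quadraticChar F ((∏ i, b.1.rep i) * ∑ i, b.1.rep i)) with he
  have hexc : ∀ (q : NormalPoint a) (b : B), (Nat.card (ExcFibre b.1 q.1) : ℤ)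
      = 1 + if q.1 = (1, chartCoords 1 b.1.rep) then e b else 0 := by
    intro q b
    have h1 := wedge_eq_zero_iff (hB b.1 b.2).1 q.2.2
    split_ifs with h
    · rw [card_excFibre_of_eq hF ha (hB b.1 b.2) q.1 (h1.mpr h)]
    · rw [card_excFibre_of_ne b.1 q.1 (mt h1.mp h)]; simp
  -- Distinct centres lie under distinct points, so at most one factor of the product differs from
  -- `1`.
  have hprod : ∀ q : NormalPoint a, (∏ b : B, (Nat.card (ExcFibre b.1 q.1) : ℤ))
      = 1 + ∑ b : B, if q.1 = (1, chartCoords 1 b.1.rep) then e b else 0 := by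
    intro q
    simp only [hexc]
    by_cases h : ∃ b : B, q.1 = (1, chartCoords 1 b.1.rep)
    · obtain ⟨b, hb⟩ := h
      have huniq : ∀ b' : B, b' ≠ b → ¬ q.1 = (1, chartCoords 1 b'.1.rep) := by
        intro b' hne hb'
        exact hne (Subtype.ext (eq_of_chartCoords_eq (hB b'.1 b'.2).1 (hB b.1 b.2).1
          (Prod.ext_iff.mp (hb'.symm.trans hb)).2))
      rw [Finset.prod_eq_single b (fun b' _ hne => by rw [if_neg (huniq b' hne), add_zero])
        (fun h => absurd (Finset.mem_univ _) h),
        Finset.sum_eq_single b (fun b' _ hne => by rw [if_neg (huniq b' hne)])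
        (fun h => absurd (Finset.mem_univ _) h)]
    · push Not at h
      simp [h]
  -- Boundary nodes have `y = 0`, so they are never centres in the torus.
  have hdisj : ∀ q : NormalPoint a, ((if IsBoundaryNode a q.1 then 1 else 0 : ℤ)
      * ∑ b : B, if q.1 = (1, chartCoords 1 b.1.rep) then e b else 0) = 0 := by
    intro q
    split_ifs with h
    · rw [one_mul]
      refine Finset.sum_eq_zero fun b _ => if_neg fun hq => ?_
      have h2 := h.2.1
      rw [hq] at h2
      exact div_ne_zero ((hB b.1 b.2).1 _) ((hB b.1 b.2).1 _) h2
    · rw [zero_mul]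
  have hone : ∀ b : B, ∑ q : NormalPoint a,
      (if q.1 = (1, chartCoords 1 b.1.rep) then e b else 0) = e b := by
    intro b
    rw [Finset.sum_eq_single (⟨(1, chartCoords 1 b.1.rep),
      eqVal_chartCoords hF (hB b.1 b.2) 1, normal_one _⟩ : NormalPoint a)]
    · simp
    · intro q _ hq
      exact if_neg fun h => hq (Subtype.ext h)
    · simp
  rw [card_bigResolution hF ha hB, Nat.card_sigma]
  push_cast
  simp only [Nat.card_prod, Nat.card_pi]
  push_cast
  simp only [hprod, card_dirFibre ha]
  have hterm : ∀ q : NormalPoint a, (1 + (Fintype.card F : ℤ) * if IsBoundaryNode a q.1 then 1 else 0)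
      * (1 + ∑ b : B, if q.1 = (1, chartCoords 1 b.1.rep) then e b else 0)
      = 1 + (Fintype.card F : ℤ) * (if IsBoundaryNode a q.1 then 1 else 0)
        + ∑ b : B, if q.1 = (1, chartCoords 1 b.1.rep) then e b else 0 := by
    intro q
    linear_combination (Fintype.card F : ℤ) * hdisj q
  simp only [hterm, Finset.sum_add_distrib]
  rw [Finset.sum_comm, Finset.sum_congr rfl fun b _ => hone b, ← Finset.mul_sum,
    Finset.sum_boole, finsum_mem_eq_finite_toFinset_sum _ (Set.toFinite B)]
  congr 1
  · congr 1
    · simp [Nat.card_eq_fintype_card]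
    · rw [Nat.card_eq_fintype_card, Fintype.card_subtype]
  · rw [Finset.sum_subtype (p := fun b => b ∈ B) _ (by simp)]

end Fibres


/-! ### Counting the points of the threefold -/

/-- The number of members of a set of positions before a given one. -/
def levelOf (Z : Fin 4 → Bool) (k : Fin 5) : ℕ :=
  (Finset.univ.filter fun m : Fin 4 => m.castSucc < k ∧ Z m = true).card

/-- The permutation is increasing between the positions in the set. -/
def IsAscending (Z : Fin 4 → Bool) (ς : Equiv.Perm (Fin 5)) : Prop :=
  ∀ k l : Fin 5, k < l → levelOf Z k = levelOf Z l → ς k < ς l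

instance (Z : Fin 4 → Bool) : DecidablePred (IsAscending Z) := fun ς => by
  unfold IsAscending; infer_instance

/-- The number of permutations that are increasing between the positions in the set. -/
def ascCount (Z : Fin 4 → Bool) : ℕ := (Finset.univ.filter (IsAscending Z)).card

-- These are multinomial coefficients, `5!` divided by the factorials of the block sizes, and they
-- count the orbits of each type. The four remaining boundary types have `x = w = 0`, where the
-- equation is the nonzero constant `c 0`.
set_option maxRecDepth 100000 in
lemma ascCount_values :
    ascCount ![true, false, false, false] = 5 ∧ ascCount ![false, true, false, false] = 10 ∧
    ascCount ![false, false, true, false] = 10 ∧ ascCount ![false, false, false, true] = 5 ∧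
    ascCount ![true, true, false, false] = 20 ∧ ascCount ![true, false, true, false] = 30 ∧
    ascCount ![false, true, true, false] = 30 ∧ ascCount ![false, true, false, true] = 30 ∧
    ascCount ![false, false, true, true] = 20 ∧ ascCount ![true, true, true, false] = 60 ∧
    ascCount ![false, true, true, true] = 60 := by
  decide +kernel

section Count

variable {F : Type*} [Field F] [Fintype F] [DecidableEq F]

omit [Fintype F] in
lemma normal_iff_isAscending (ς : Equiv.Perm (Fin 5)) (v : Fin 4 → F) :
    Normal ς v ↔ IsAscending (fun m => decide (v m = 0)) ς := by
  have : ∀ k, level ς v (ς k) = levelOf (fun m => decide (v m = 0)) k := by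
    intro k
    simp only [level, levelOf, Equiv.symm_apply_apply, decide_eq_true_eq]
  simp only [Normal, IsAscending, this]

lemma sum_eq_zero_add_sum_units (f : F → ℤ) : ∑ x, f x = f 0 + ∑ u : Fˣ, f u := by
  rw [Fintype.sum_eq_add_sum_compl 0, ← (unitsEquivNeZero (G₀ := F)).symm.sum_comp]
  congr 1
  rw [Finset.sum_subtype (p := fun x : F => x ≠ 0) _ (by simp)]
  exact Finset.sum_congr rfl fun u _ => by simp [unitsEquivNeZero]

omit [Field F] [DecidableEq F] in
lemma sum_fin_four (f : (Fin 4 → F) → ℤ) :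
    ∑ v, f v = ∑ x : F, ∑ y : F, ∑ z : F, ∑ w : F, f ![x, y, z, w] := by
  simp only [sum_fin_succ, Fintype.sum_unique]
  rfl

lemma card_units_eq : ((Fintype.card Fˣ : ℕ) : ℤ) = Fintype.card F - 1 := by
  rw [Fintype.card_units, Nat.cast_sub Fintype.card_pos, Nat.cast_one]

lemma sum_units_ite_linear (s t : F) (ht : t ≠ 0) :
    ∑ z : Fˣ, (if s + t * z = 0 then 1 else 0 : ℤ) = 1 - if s = 0 then 1 else 0 := by
  have h := sum_eq_zero_add_sum_units fun z : F => (if s + t * z = 0 then 1 else 0 : ℤ)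
  have h1 : ∀ z : F, s + t * z = 0 ↔ z = -s / t := fun z => by
    rw [eq_div_iff ht]
    constructor <;> intro h <;> linear_combination h
  have h2 : ∑ z : F, (if s + t * z = 0 then 1 else 0 : ℤ) = 1 := by
    simp only [h1]; simp
  rw [h2] at h
  simp only [mul_zero, add_zero] at h
  linarith

lemma sum_units_ite_one {s t : F} (hs : s ≠ 0) (ht : t ≠ 0) :
    ∑ z : Fˣ, (if s + t * z = 0 then 1 else 0 : ℤ) = 1 := by
  rw [sum_units_ite_linear s t ht, if_neg hs, sub_zero]

lemma sum_units_ite_two {s t r : F} (hs : s ≠ 0) (ht : t ≠ 0) (hr : r ≠ 0) :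
    ∑ x : Fˣ, ∑ y : Fˣ, (if s + t * x + r * (x * y) = 0 then 1 else 0 : ℤ)
      = Fintype.card F - 2 := by
  have h : ∀ x : Fˣ, ∑ y : Fˣ, (if s + t * x + r * (x * y) = 0 then 1 else 0 : ℤ)
      = 1 - if s + t * x = 0 then 1 else 0 := fun x => by
    rw [← sum_units_ite_linear _ (r * x) (mul_ne_zero hr x.ne_zero)]
    simp only [mul_assoc]
  simp only [h, Finset.sum_sub_distrib, sum_units_ite_one hs ht]
  rw [Finset.sum_const, Finset.card_univ, nsmul_eq_mul, card_units_eq]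
  ring

lemma sum_units_ite_three {s t r u : F} (hs : s ≠ 0) (ht : t ≠ 0) (hr : r ≠ 0) (hu : u ≠ 0) :
    ∑ x : Fˣ, ∑ y : Fˣ, ∑ z : Fˣ,
      (if s + t * x + r * (x * y) + u * (x * y * z) = 0 then 1 else 0 : ℤ)
      = (Fintype.card F - 1) ^ 2 - (Fintype.card F - 2) := by
  have h : ∀ x y : Fˣ, ∑ z : Fˣ,
      (if s + t * x + r * (x * y) + u * (x * y * z) = 0 then 1 else 0 : ℤ)
      = 1 - if s + t * x + r * (x * y) = 0 then 1 else 0 := fun x y => by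
    rw [← sum_units_ite_linear _ (u * (x * y)) (mul_ne_zero hu (mul_ne_zero x.ne_zero y.ne_zero))]
    simp only [mul_assoc]
  simp only [h, Finset.sum_sub_distrib, sum_units_ite_two hs ht hr]
  simp only [Finset.sum_const, Finset.card_univ, nsmul_eq_mul, card_units_eq]
  ring

omit [Fintype F] in
lemma ite_mul_eq_zero (s t : F) : (if s * t = 0 then 1 else 0 : ℤ)
    = (if s = 0 then 1 else 0) + (if t = 0 then 1 else 0)
      - (if s = 0 then 1 else 0) * (if t = 0 then 1 else 0) := by
  by_cases hs : s = 0 <;> by_cases ht : t = 0 <;> simp [hs, ht]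

/-- Summation over all coordinate vectors, according to the vanishing coordinates. -/
lemma sum_fin_four_units (f : (Fin 4 → F) → ℤ) : ∑ v, f v =
    (∑ x : Fˣ, ∑ y : Fˣ, ∑ z : Fˣ, ∑ w : Fˣ, f ![x, y, z, w])
    + (∑ y : Fˣ, ∑ z : Fˣ, ∑ w : Fˣ, f ![0, y, z, w])
    + (∑ x : Fˣ, ∑ z : Fˣ, ∑ w : Fˣ, f ![x, 0, z, w])
    + (∑ x : Fˣ, ∑ y : Fˣ, ∑ w : Fˣ, f ![x, y, 0, w])
    + (∑ x : Fˣ, ∑ y : Fˣ, ∑ z : Fˣ, f ![x, y, z, 0])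
    + (∑ z : Fˣ, ∑ w : Fˣ, f ![0, 0, z, w])
    + (∑ y : Fˣ, ∑ w : Fˣ, f ![0, y, 0, w])
    + (∑ y : Fˣ, ∑ z : Fˣ, f ![0, y, z, 0])
    + (∑ x : Fˣ, ∑ w : Fˣ, f ![x, 0, 0, w])
    + (∑ x : Fˣ, ∑ z : Fˣ, f ![x, 0, z, 0])
    + (∑ x : Fˣ, ∑ y : Fˣ, f ![x, y, 0, 0])
    + (∑ w : Fˣ, f ![0, 0, 0, w]) + (∑ z : Fˣ, f ![0, 0, z, 0])
    + (∑ y : Fˣ, f ![0, y, 0, 0]) + (∑ x : Fˣ, f ![x, 0, 0, 0]) + f ![0, 0, 0, 0] := by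
  rw [sum_fin_four]
  simp only [sum_eq_zero_add_sum_units, Finset.sum_add_distrib]
  ring

/-- The boundary points of the threefold in a chart, according to the vanishing coordinates. -/
lemma sum_boundary {c : Fin 6 → F} (hc : ∀ k, c k ≠ 0) (g : (Fin 4 → Bool) → ℤ) :
    ∑ v : Fin 4 → F, (if eqVal c v = 0 then g (fun m => decide (v m = 0)) else 0)
      = g ![false, false, false, false] * (∑ x : Fˣ, ∑ y : Fˣ, ∑ z : Fˣ, ∑ w : Fˣ,
          if eqVal c ![(x : F), y, z, w] = 0 then 1 else 0)
        + (g ![true, false, false, false] + g ![false, false, false, true])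
          * ((Fintype.card F - 1) ^ 2 - (Fintype.card F - 2))
        + (g ![false, true, false, false] + g ![false, false, true, false])
          * ((Fintype.card F - 1) ^ 2 + (Fintype.card F - 2) ^ 2)
        + (g ![true, true, false, false] + g ![false, false, true, true]) * (Fintype.card F - 2)
        + (g ![true, false, true, false] + g ![false, true, false, true]) * (Fintype.card F - 1)
        + g ![false, true, true, false] * (2 * Fintype.card F - 3)
        + g ![true, true, true, false] + g ![false, true, true, true] := by
  have hg : ∀ v : Fin 4 → F, (if eqVal c v = 0 then g (fun m => decide (v m = 0)) else 0)
      = g (fun m => decide (v m = 0)) * if eqVal c v = 0 then 1 else 0 := fun v => by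
    split_ifs <;> simp
  have hZ : ∀ x y z w : F, (fun m => decide ((![x, y, z, w] : Fin 4 → F) m = 0))
      = ![decide (x = 0), decide (y = 0), decide (z = 0), decide (w = 0)] := by
    intro x y z w; funext m; fin_cases m <;> rfl
  simp only [hg]
  rw [sum_fin_four_units]
  simp only [hZ, Units.ne_zero, decide_false, decide_true, ← Finset.mul_sum]
  have hN : ∀ t : ℤ, ∑ _x : Fˣ, t = (Fintype.card F - 1) * t := fun t => by
    rw [Finset.sum_const, Finset.card_univ, nsmul_eq_mul, card_units_eq]
  have h1 := hc 0; have h2 := hc 1; have h3 := hc 2; have h4 := hc 3; have h5 := hc 4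
  have o : (1 : F) ≠ 0 := one_ne_zero
  have e1 : ∑ y : Fˣ, ∑ z : Fˣ, ∑ w : Fˣ, (if eqVal c ![(0 : F), y, z, w] = 0 then 1 else 0 : ℤ)
      = (Fintype.card F - 1) ^ 2 - (Fintype.card F - 2) := by
    rw [← sum_units_ite_three o o o o, Finset.sum_comm, Finset.sum_congr rfl fun z _ =>
      Finset.sum_comm, Finset.sum_comm]
    refine Finset.sum_congr rfl fun w _ => Finset.sum_congr rfl fun z _ =>
      Finset.sum_congr rfl fun y _ => if_congr ?_ rfl rfl
    simp [eqVal, coordSum, h1]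
  have e2 : ∑ x : Fˣ, ∑ z : Fˣ, ∑ w : Fˣ, (if eqVal c ![(x : F), 0, z, w] = 0 then 1 else 0 : ℤ)
      = (Fintype.card F - 1) ^ 2 + (Fintype.card F - 2) ^ 2 := by
    have : ∀ x z w : F, eqVal c ![(x : F), 0, z, w]
        = (c 0 + c 1 * x) * (1 + 1 * w + 1 * (w * z)) := fun x z w => by
      simp [eqVal, coordSum]
    simp only [this, ite_mul_eq_zero, Finset.sum_add_distrib, Finset.sum_sub_distrib,
      ← Finset.mul_sum]
    have h : ∑ z : Fˣ, ∑ w : Fˣ, (if 1 + 1 * (w : F) + 1 * (w * z) = 0 then 1 else 0 : ℤ)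
        = Fintype.card F - 2 := by
      rw [Finset.sum_comm]; exact sum_units_ite_two o o o
    simp only [h, hN, ← Finset.mul_sum, ← Finset.sum_mul, sum_units_ite_one h1 h2]
    ring
  have e3 : ∑ x : Fˣ, ∑ y : Fˣ, ∑ w : Fˣ, (if eqVal c ![(x : F), y, 0, w] = 0 then 1 else 0 : ℤ)
      = (Fintype.card F - 1) ^ 2 + (Fintype.card F - 2) ^ 2 := by
    have : ∀ x y w : F, eqVal c ![(x : F), y, 0, w]
        = (c 0 + c 1 * x + c 2 * (x * y)) * (1 + 1 * w) := fun x y w => by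
      simp [eqVal, coordSum]
    simp only [this, ite_mul_eq_zero, Finset.sum_add_distrib, Finset.sum_sub_distrib,
      ← Finset.mul_sum, hN, mul_one, sum_units_ite_one o o,
      sum_units_ite_two h1 h2 h3]
    ring
  have e4 : ∑ x : Fˣ, ∑ y : Fˣ, ∑ z : Fˣ, (if eqVal c ![(x : F), y, z, 0] = 0 then 1 else 0 : ℤ)
      = (Fintype.card F - 1) ^ 2 - (Fintype.card F - 2) := by
    rw [← sum_units_ite_three h1 h2 h3 h4]
    simp [eqVal, coordSum]
  have e5 : ∑ z : Fˣ, ∑ w : Fˣ, (if eqVal c ![(0 : F), 0, z, w] = 0 then 1 else 0 : ℤ)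
      = Fintype.card F - 2 := by
    rw [← sum_units_ite_two o o o, Finset.sum_comm]
    simp [eqVal, coordSum, h1]
  have e6 : ∑ y : Fˣ, ∑ w : Fˣ, (if eqVal c ![(0 : F), y, 0, w] = 0 then 1 else 0 : ℤ)
      = Fintype.card F - 1 := by
    have : ∀ y w : F, eqVal c ![(0 : F), y, 0, w] = 0 ↔ 1 + 1 * w = 0 := fun y w => by
      simp [eqVal, coordSum, h1]
    simp only [this, sum_units_ite_one o o, hN, mul_one]
  have e7 : ∑ y : Fˣ, ∑ z : Fˣ, (if eqVal c ![(0 : F), y, z, 0] = 0 then 1 else 0 : ℤ) = 0 := by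
    simp [eqVal, coordSum, h1]
  have e8 : ∑ x : Fˣ, ∑ w : Fˣ, (if eqVal c ![(x : F), 0, 0, w] = 0 then 1 else 0 : ℤ)
      = 2 * Fintype.card F - 3 := by
    have : ∀ x w : F, eqVal c ![(x : F), 0, 0, w] = (c 0 + c 1 * x) * (1 + 1 * w) :=
      fun x w => by simp [eqVal, coordSum]
    simp only [this, ite_mul_eq_zero, Finset.sum_add_distrib, Finset.sum_sub_distrib,
      ← Finset.mul_sum, hN, mul_one, sum_units_ite_one o o,
      sum_units_ite_one h1 h2]
    ring
  have e9 : ∑ x : Fˣ, ∑ z : Fˣ, (if eqVal c ![(x : F), 0, z, 0] = 0 then 1 else 0 : ℤ)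
      = Fintype.card F - 1 := by
    have : ∀ x z : F, eqVal c ![(x : F), 0, z, 0] = c 0 + c 1 * x :=
      fun x w => by simp [eqVal, coordSum]
    simp only [this, hN, ← Finset.mul_sum, sum_units_ite_one h1 h2, mul_one]
  have e10 : ∑ x : Fˣ, ∑ y : Fˣ, (if eqVal c ![(x : F), y, 0, 0] = 0 then 1 else 0 : ℤ)
      = Fintype.card F - 2 := by
    rw [← sum_units_ite_two h1 h2 h3]
    simp [eqVal, coordSum]
  have e11 : ∑ w : Fˣ, (if eqVal c ![(0 : F), 0, 0, w] = 0 then 1 else 0 : ℤ) = 1 := by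
    refine Eq.trans ?_ (sum_units_ite_one o o)
    exact Finset.sum_congr rfl fun w _ => if_congr (by simp [eqVal, coordSum, h1]) rfl rfl
  have e12 : ∑ z : Fˣ, (if eqVal c ![(0 : F), 0, z, 0] = 0 then 1 else 0 : ℤ) = 0 := by
    simp [eqVal, coordSum, h1]
  have e13 : ∑ y : Fˣ, (if eqVal c ![(0 : F), y, 0, 0] = 0 then 1 else 0 : ℤ) = 0 := by
    simp [eqVal, coordSum, h1]
  have e14 : ∑ x : Fˣ, (if eqVal c ![(x : F), 0, 0, 0] = 0 then 1 else 0 : ℤ) = 1 := by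
    refine Eq.trans ?_ (sum_units_ite_one h1 h2)
    exact Finset.sum_congr rfl fun w _ => if_congr (by simp [eqVal, coordSum]) rfl rfl
  have e15 : (if eqVal c ![(0 : F), 0, 0, 0] = 0 then 1 else 0 : ℤ) = 0 := by
    simp [eqVal, coordSum, h1]
  rw [e1, e2, e3, e4, e5, e6, e7, e8, e9, e10, e11, e12, e13, e14, e15]
  ring

lemma isAscending_false_iff (ς : Equiv.Perm (Fin 5)) :
    IsAscending ![false, false, false, false] ς ↔ ς = 1 := by
  constructor
  · intro h
    refine (Equiv.Perm.monotone_iff ς).mp fun k l hkl => ?_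
    rcases hkl.eq_or_lt with rfl | hlt
    · exact le_rfl
    · have : ∀ k, levelOf ![false, false, false, false] k = 0 := by decide
      exact (h k l hlt (by rw [this, this])).le
  · rintro rfl k l hkl -
    exact hkl

omit [Field F] [Fintype F] [DecidableEq F] in
lemma chartParam_one (a : Fin 6 → F) : chartParam a 1 = a := by
  funext k
  refine Fin.lastCases ?_ (fun i => ?_) k
  · exact chartParam_five a 1
  · rw [chartParam_castSucc]; rfl

/-- The number of points of the threefold in terms of its points in the torus. -/
lemma card_normalPoint {a : Fin 6 → F} (ha : ∀ i, a i ≠ 0) :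
    (Nat.card (NormalPoint a) : ℤ) = (∑ x : Fˣ, ∑ y : Fˣ, ∑ z : Fˣ, ∑ w : Fˣ,
          if eqVal a ![(x : F), y, z, w] = 0 then 1 else 0)
      + (50 * (Fintype.card F : ℤ) ^ 2 + 10 * Fintype.card F + 20) := by
  have h1 : (Nat.card (NormalPoint a) : ℤ) = ∑ ς : Equiv.Perm (Fin 5), ∑ v : Fin 4 → F,
      (if eqVal (chartParam a ς) v = 0 then
        (if IsAscending (fun m => decide (v m = 0)) ς then 1 else 0) else 0) := by
    classical
    rw [Nat.card_eq_fintype_card, Fintype.card_subtype, ← Finset.sum_boole,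
      Fintype.sum_prod_type]
    refine Finset.sum_congr rfl fun ς _ => Finset.sum_congr rfl fun v _ => ?_
    simp only [normal_iff_isAscending, ite_and]
  have h2 : ∀ Z, ∑ ς : Equiv.Perm (Fin 5), (if IsAscending Z ς then 1 else 0 : ℤ) = ascCount Z :=
    fun Z => by rw [Finset.sum_boole]; rfl
  rw [h1, Finset.sum_congr rfl fun ς _ => sum_boundary (chartParam_ne_zero ha ς)
    fun Z => if IsAscending Z ς then 1 else 0]
  -- The open orbit is counted only once, in the identity chart.
  have h3 : ∀ T : Equiv.Perm (Fin 5) → ℤ, ∑ ς : Equiv.Perm (Fin 5),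
      (if IsAscending ![false, false, false, false] ς then 1 else 0) * T ς = T 1 := fun T => by
    simp [isAscending_false_iff]
  obtain ⟨m1, m2, m3, m4, m5, m6, m7, m8, m9, m10, m11⟩ := ascCount_values
  simp only [Finset.sum_add_distrib, ← Finset.sum_mul, h3, h2, m1, m2, m3, m4, m5, m6, m7, m8,
    m9, m10, m11, chartParam_one]
  push_cast
  ring

omit [Fintype F] in
-- There is one node in each chart, with `y = z = 0` and the other coordinates nonzero. Normality
-- leaves one chart for each ordered partition with blocks of sizes `2, 1, 2`.
lemma card_isBoundaryNode {a : Fin 6 → F} (ha : ∀ i, a i ≠ 0) :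
    Nat.card {q : NormalPoint a // IsBoundaryNode a q.1} = 30 := by
  have h : ascCount ![false, true, true, false] = 30 := ascCount_values.2.2.2.2.2.2.1
  rw [← h, ascCount, ← Fintype.card_subtype, ← Nat.card_eq_fintype_card]
  set node : Equiv.Perm (Fin 5) → Fin 4 → F := fun ς =>
    ![-chartParam a ς 0 / chartParam a ς 1, 0, 0, -1] with hnode
  have hZ : ∀ ς, (fun m => decide (node ς m = 0)) = ![false, true, true, false] := by
    intro ς
    funext m
    fin_cases m <;> simp [node, chartParam_ne_zero ha ς]
  have hv : ∀ q : Equiv.Perm (Fin 5) × (Fin 4 → F), IsBoundaryNode a q ↔ q.2 = node q.1 := by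
    intro q
    have h1 := chartParam_ne_zero ha q.1 1
    constructor
    · rintro ⟨h0, h2, h3, h4⟩
      funext m
      fin_cases m
      · simp [node]; field_simp; linear_combination h0
      · exact h2
      · exact h3
      · exact h4
    · intro hq
      rw [IsBoundaryNode, hq]
      refine ⟨?_, rfl, rfl, rfl⟩
      simp [node]; field_simp; ring
  refine Nat.card_eq_of_bijective (fun q => ⟨q.1.1.1, ?_⟩) ⟨?_, ?_⟩
  · have h1 := q.1.2.2
    rwa [normal_iff_isAscending, (hv _).mp q.2, hZ] at h1
  · rintro ⟨⟨⟨ς, v⟩, hF, hn⟩, hq⟩ ⟨⟨⟨ς', v'⟩, hF', hn'⟩, hq'⟩ h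
    obtain rfl : ς = ς' := congrArg Subtype.val h
    obtain rfl : v = v' := ((hv _).mp hq).trans ((hv _).mp hq').symm
    rfl
  · rintro ⟨ς, hς⟩
    have hb : IsBoundaryNode a (ς, node ς) := (hv _).mpr rfl
    obtain ⟨h1, h2, h3, -⟩ := (isBoundaryNode_iff ha _).mp hb
    dsimp only at h1 h2 h3
    refine ⟨⟨⟨(ς, node ς), ?_, ?_⟩, hb⟩, rfl⟩
    · have e := eqVal_eq (chartParam a ς) (node ς)
      rw [h1, h2] at e
      exact e.trans (by ring)
    · rw [normal_iff_isAscending, hZ]; exact hς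

end Count


/-! ### The points of the threefold in the torus -/

section Torus

variable {F : Type*} [Field F] [Fintype F] [DecidableEq F]

lemma sum_ite_quadratic (hF : (2 : F) ≠ 0) {α : F} (hα : α ≠ 0) (β γ : F) :
    ∑ t : F, (if α * t ^ 2 + β * t + γ = 0 then 1 else 0 : ℤ)
      = quadraticChar F (β ^ 2 - 4 * α * γ) + 1 := by
  rw [← sum_ite_sq_eq hF]
  have h2α : 2 * α ≠ 0 := mul_ne_zero hF hα
  refine Fintype.sum_equiv ((Equiv.mulLeft₀ (2 * α) h2α).trans (Equiv.addRight β)) _ _ fun t =>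
    if_congr ?_ rfl rfl
  simp only [Equiv.trans_apply, Equiv.mulLeft₀_apply, Equiv.coe_addRight]
  constructor
  · intro h
    linear_combination 4 * α * h
  · intro h
    have : 2 * (2 * α) * (α * t ^ 2 + β * t + γ) = 0 := by linear_combination h
    exact (mul_eq_zero.mp this).resolve_left (mul_ne_zero hF h2α)

/-- Clearing `t` gives `B t ^ 2 + (A B + c - d) t + c A = 0`, with discriminant `(A B - c - d) ^ 2 -
4 c d`. The root `t = 0` must be removed when `A = 0`, one root is lost when `B = 0`, and for `A = B
= 0`, `c = d` every `t` is a solution. -/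
lemma sum_units_ite_torus (hF : (2 : F) ≠ 0) {c d : F} (hc : c ≠ 0) (A B : F) :
    ∑ t : Fˣ, (if (A + t) * (c / t + B) = d then 1 else 0 : ℤ)
      = (quadraticChar F ((A * B - c - d) ^ 2 - 4 * c * d) + 1)
        - (if A = 0 then 1 else 0) - (if B = 0 then 1 else 0)
        + if c = d then (Fintype.card F : ℤ) * ((if A = 0 then 1 else 0) * if B = 0 then 1 else 0)
          else 0 := by
  have h1 : ∑ t : F, (if B * t ^ 2 + (A * B + c - d) * t + c * A = 0 then 1 else 0 : ℤ)
      = (if A = 0 then 1 else 0) + ∑ t : Fˣ, (if (A + t) * (c / t + B) = d then 1 else 0) := by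
    rw [sum_eq_zero_add_sum_units]
    congr 1
    · refine if_congr ?_ rfl rfl
      simp [hc]
    · refine Finset.sum_congr rfl fun t _ => if_congr ?_ rfl rfl
      have ht := t.ne_zero
      constructor
      · intro h
        field_simp
        linear_combination h
      · intro h
        field_simp at h
        linear_combination h
  have h2 : ∑ t : F, (if B * t ^ 2 + (A * B + c - d) * t + c * A = 0 then 1 else 0 : ℤ)
      = (quadraticChar F ((A * B - c - d) ^ 2 - 4 * c * d) + 1) - (if B = 0 then 1 else 0)
        + if c = d then (Fintype.card F : ℤ) * ((if A = 0 then 1 else 0) * if B = 0 then 1 else 0)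
          else 0 := by
    by_cases hB : B = 0
    · subst hB
      have e : (A * 0 - c - d) ^ 2 - 4 * c * d = (c - d) ^ 2 := by ring
      rw [e]
      by_cases hcd : c = d
      · subst hcd
        by_cases hA : A = 0
        · simp [hA]
        · simp [hA, hc]
      · have hcd' : c - d ≠ 0 := sub_ne_zero.mpr hcd
        have e2 : ∀ t : F, 0 * t ^ 2 + (A * 0 + c - d) * t + c * A = 0 ↔ t = -(c * A) / (c - d) := by
          intro t
          rw [eq_div_iff hcd']
          constructor <;> intro h <;> linear_combination h
        simp only [e2, quadraticChar_sq_one' hcd']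
        simp [hcd]
    · rw [sum_ite_quadratic hF hB]
      simp only [hB, if_false, mul_zero, ite_self, add_zero, sub_zero]
      congr 2
      ring
  linarith

/-- The chart coordinates are replaced by the homogeneous ones, normalised by `X₅ = 1`; the variable
`t` is `X₁ = xyzw`. -/
lemma sum_torus_param (a : Fin 6 → F) :
    (∑ x : Fˣ, ∑ y : Fˣ, ∑ z : Fˣ, ∑ w : Fˣ, if eqVal a ![(x : F), y, z, w] = 0 then 1 else 0 : ℤ)
      = ∑ x : Fˣ, ∑ y : Fˣ, ∑ z : Fˣ, ∑ t : Fˣ,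
        if ((1 + x + y + z : F) + t) * (a 0 / t + (a 1 / x + a 2 / y + a 3 / z + a 4)) = a 5 then 1
          else 0 := by
  simp only [← Fintype.sum_prod_type']
  let φ : Fˣ × Fˣ × Fˣ × Fˣ ≃ Fˣ × Fˣ × Fˣ × Fˣ :=
    { toFun := fun u => (u.2.1 * u.2.2.1 * u.2.2.2, u.2.2.1 * u.2.2.2, u.2.2.2,
        u.1 * u.2.1 * u.2.2.1 * u.2.2.2)
      invFun := fun u => (u.2.2.2 / u.1, u.1 / u.2.1, u.2.1 / u.2.2.1, u.2.2.1)
      left_inv := fun u => by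
        ext <;> simp
      right_inv := fun u => by
        ext <;> simp }
  refine Fintype.sum_equiv φ _ _ fun u => if_congr ?_ rfl rfl
  obtain ⟨x, y, z, w⟩ := u
  have hx := x.ne_zero; have hy := y.ne_zero; have hz := z.ne_zero; have hw := w.ne_zero
  simp only [φ, Equiv.coe_fn_mk, Units.val_mul, eqVal, coordSum, Matrix.cons_val_zero,
    Matrix.cons_val_one, Matrix.cons_val]
  field_simp
  constructor <;> intro h <;> linear_combination h

lemma sum_units_inv (f : Fˣ → ℤ) : ∑ x : Fˣ, f x⁻¹ = ∑ x, f x :=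
  Equiv.sum_comp (Equiv.inv Fˣ) f

lemma sum_units_ite_plane {s t r u : F} (hs : s ≠ 0) (ht : t ≠ 0) (hr : r ≠ 0) (hu : u ≠ 0) :
    ∑ x : Fˣ, ∑ y : Fˣ, ∑ z : Fˣ, (if s + t * x + r * y + u * z = 0 then 1 else 0 : ℤ)
      = (Fintype.card F - 1) ^ 2 - (Fintype.card F - 2) := by
  rw [← sum_units_ite_three hs ht hr hu]
  refine Finset.sum_congr rfl fun x _ => ?_
  rw [← Equiv.sum_comp (Equiv.mulLeft x)]
  refine Finset.sum_congr rfl fun y _ => ?_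
  rw [← Equiv.sum_comp (Equiv.mulLeft (x * y))]
  simp [mul_assoc]

/-- The number of points on the plane cubic in terms of the points in the torus. -/
lemma card_ellipticCurve {a b c t : F} (ht : t ≠ 0) (ha : a ≠ 0) (hb : b ≠ 0) (hc : c ≠ 0) :
    (Nat.card (ellipticCurve a b c t) : ℤ) - 6 = ∑ x : Fˣ, ∑ y : Fˣ, ∑ z : Fˣ,
      (if (1 + x + y + z : F) = 0 then 1 else 0)
        * if (a / x + b / y + t / z + c : F) = 0 then 1 else 0 := by
  set G : F → F → F → F := fun x y z =>
    (x + y + z) * (a * (x * y) + b * (y * z) + c * (z * x)) - t * (x * y * z) with hG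
  have hN : ∀ t : ℤ, ∑ _x : Fˣ, t = (Fintype.card F - 1) * t := fun t => by
    rw [Finset.sum_const, Finset.card_univ, nsmul_eq_mul, card_units_eq]
  have hq : 1 < Fintype.card F := Fintype.one_lt_card
  have hq' : (Fintype.card F : ℤ) - 1 ≠ 0 := by
    have : (1 : ℤ) < Fintype.card F := by exact_mod_cast hq
    omega
  have h1 := card_cone (F := F) (fun v : Fin 3 → F => (v 0 + v 1 + v 2)
      * (a * (v 0 * v 1) + b * (v 1 * v 2) + c * (v 2 * v 0)) = t * (v 0 * v 1 * v 2))
    fun u v hv => by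
      simp only [Pi.smul_apply, Units.smul_def, smul_eq_mul]
      linear_combination (u : F) ^ 3 * hv
  have h2 : (Nat.card {v : Fin 3 → F // v ≠ 0 ∧ (v 0 + v 1 + v 2)
      * (a * (v 0 * v 1) + b * (v 1 * v 2) + c * (v 2 * v 0)) = t * (v 0 * v 1 * v 2)} : ℤ)
      = ∑ x : F, ∑ y : F, ∑ z : F, (if G x y z = 0 then 1 else 0) - 1 := by
    have e : ∑ x : F, ∑ y : F, ∑ z : F, (if G x y z = 0 then 1 else 0 : ℤ)
        = ∑ v : Fin 3 → F, if G (v 0) (v 1) (v 2) = 0 then 1 else 0 := by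
      simp only [sum_fin_succ, Fintype.sum_unique]
      rfl
    have e' : ∀ v : Fin 3 → F, G (v 0) (v 1) (v 2) = 0 ↔ (v 0 + v 1 + v 2)
        * (a * (v 0 * v 1) + b * (v 1 * v 2) + c * (v 2 * v 0)) = t * (v 0 * v 1 * v 2) :=
      fun v => sub_eq_zero
    rw [e, Finset.sum_boole, Nat.card_eq_fintype_card, Fintype.card_subtype]
    simp only [e', and_comm (a := _ ≠ _)]
    rw [← Finset.filter_filter, Finset.filter_ne', Finset.card_erase_of_mem (by simp),
      Nat.cast_sub (Finset.card_pos.mpr ⟨0, by simp⟩), Nat.cast_one]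
  -- The six points off the torus are the three coordinate points and one further point on each
  -- coordinate line. On such a line the cubic reduces to the vanishing of the sum of the two other
  -- coordinates.
  have h3 : ∑ x : F, ∑ y : F, ∑ z : F, (if G x y z = 0 then 1 else 0 : ℤ)
      = ∑ x : Fˣ, ∑ y : Fˣ, ∑ z : Fˣ, (if G x y z = 0 then 1 else 0)
        + 6 * (Fintype.card F - 1) + 1 := by
    have hunit : ∑ z : Fˣ, (if (1 : F) + 1 * z = 0 then 1 else 0 : ℤ) = 1 :=
      sum_units_ite_one one_ne_zero one_ne_zero
    have k1 : ∀ y z : Fˣ, G 0 y z = 0 ↔ (y + 1 * z : F) = 0 := fun y z => by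
      simp [hG, hb]
    have k2 : ∀ x z : Fˣ, G x 0 z = 0 ↔ (x + 1 * z : F) = 0 := fun y z => by
      simp [hG, hc]
    have k3 : ∀ x y : Fˣ, G x y 0 = 0 ↔ (x + 1 * y : F) = 0 := fun y z => by
      simp [hG, ha]
    have kk : ∀ y : Fˣ, ∑ z : Fˣ, (if (y + 1 * z : F) = 0 then 1 else 0 : ℤ) = 1 := fun y =>
      sum_units_ite_one y.ne_zero one_ne_zero
    have k4 : ∀ x : F, G x 0 0 = 0 := fun x => by simp [hG]
    have k5 : ∀ x : F, G 0 x 0 = 0 := fun x => by simp [hG]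
    have k6 : ∀ x : F, G 0 0 x = 0 := fun x => by simp [hG]
    simp only [sum_eq_zero_add_sum_units, Finset.sum_add_distrib, k1, k2, k3, k4, k5, k6,
      if_true, kk, hN]
    ring
  have h4 : ∑ x : Fˣ, ∑ y : Fˣ, ∑ z : Fˣ, (if G x y z = 0 then 1 else 0 : ℤ)
      = (Fintype.card F - 1) * ∑ x : Fˣ, ∑ y : Fˣ, if G y 1 x = 0 then 1 else 0 := by
    rw [← hN, Finset.sum_comm]
    refine Finset.sum_congr rfl fun s _ => ?_
    rw [Finset.sum_comm, ← Equiv.sum_comp (Equiv.mulLeft s)]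
    refine Finset.sum_congr rfl fun x _ => ?_
    rw [← Equiv.sum_comp (Equiv.mulLeft s)]
    refine Finset.sum_congr rfl fun y _ => if_congr ?_ rfl rfl
    have e : G (s * y) s (s * x) = s ^ 3 * G y 1 x := by simp only [hG]; ring
    simp only [Equiv.coe_mulLeft, Units.val_mul, e]
    simp
  -- The linear equation eliminates `z`. If `1 + x + y = 0`, no unit `z` exists, and the cubic has
  -- no point there either because `t ≠ 0`.
  have h5 : ∀ x y : Fˣ, (∑ z : Fˣ, (if (1 + x + y + z : F) = 0 then 1 else 0)
        * if (a / x + b / y + t / z + c : F) = 0 then 1 else 0 : ℤ)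
      = if G y 1 x = 0 then 1 else 0 := by
    intro x y
    have hx := x.ne_zero
    have hy := y.ne_zero
    by_cases h0 : (1 + x + y : F) = 0
    · have e : ∀ z : Fˣ, (1 + x + y + z : F) ≠ 0 := fun z => by
        rw [h0, zero_add]; exact z.ne_zero
      have e' : G y 1 x ≠ 0 := by
        have : G y 1 x = -(t * (y * x)) := by
          simp only [hG]
          linear_combination (a * y + b * x + c * (x * y)) * h0
        rw [this]
        exact neg_ne_zero.mpr (mul_ne_zero ht (mul_ne_zero hy hx))
      simp [e, e']
    · set z₀ : Fˣ := Units.mk0 (-(1 + x + y : F)) (neg_ne_zero.mpr h0) with hz₀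
      have hz : (z₀ : F) = -(1 + x + y) := rfl
      rw [Finset.sum_eq_single z₀]
      · rw [if_pos (by rw [hz]; ring), one_mul]
        refine if_congr ?_ rfl rfl
        rw [hz]
        have e : G y 1 x = (x * y * (1 + x + y)) * (a / x + b / y + t / (-(1 + x + y)) + c) := by
          simp only [hG]; field_simp; ring
        rw [e]
        simp [h0]
      · intro z _ hne
        rw [if_neg, zero_mul]
        intro h
        exact hne (Units.ext (by rw [hz]; linear_combination h))
      · simp
  simp only [h5]
  have h6 := congrArg (Nat.cast : ℕ → ℤ) h1
  rw [h2, h3, h4, Nat.card_eq_fintype_card (α := F), Nat.cast_mul, Nat.cast_sub hq.le,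
    Nat.cast_one] at h6
  refine mul_left_cancel₀ hq' ?_
  change _ = ((Nat.card (ellipticCurve a b c t) : ℕ) : ℤ) * _ at h6
  linear_combination -h6

/-- The number of points of the threefold in the torus. -/
lemma sum_torus (hF : (2 : F) ≠ 0) {a : Fin 6 → F} (ha : ∀ i, a i ≠ 0) :
    (∑ x : Fˣ, ∑ y : Fˣ, ∑ z : Fˣ, ∑ w : Fˣ, if eqVal a ![(x : F), y, z, w] = 0 then 1 else 0 : ℤ)
      = (∑ x : Fˣ, ∑ y : Fˣ, ∑ z : Fˣ, (quadraticChar F (discr a x y z) + 1))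
        - 2 * ((Fintype.card F - 1) ^ 2 - (Fintype.card F - 2))
        + if a 0 = a 5 then
            (Fintype.card F : ℤ) * (Nat.card (ellipticCurve (a 1) (a 2) (a 4) (a 3)) - 6)
          else 0 := by
  rw [sum_torus_param, card_ellipticCurve (ha 3) (ha 1) (ha 2) (ha 4)]
  simp only [sum_units_ite_torus hF (ha 0)]
  have h1 : ∑ x : Fˣ, ∑ y : Fˣ, ∑ z : Fˣ, (if (1 + x + y + z : F) = 0 then 1 else 0 : ℤ)
      = (Fintype.card F - 1) ^ 2 - (Fintype.card F - 2) := by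
    have o : (1 : F) ≠ 0 := one_ne_zero
    simpa using sum_units_ite_plane o o o o
  have h2 : ∑ x : Fˣ, ∑ y : Fˣ, ∑ z : Fˣ,
      (if (a 1 / x + a 2 / y + a 3 / z + a 4 : F) = 0 then 1 else 0 : ℤ)
      = (Fintype.card F - 1) ^ 2 - (Fintype.card F - 2) := by
    rw [← sum_units_ite_plane (ha 4) (ha 1) (ha 2) (ha 3), ← sum_units_inv]
    refine Finset.sum_congr rfl fun x _ => ?_
    rw [← sum_units_inv]
    refine Finset.sum_congr rfl fun y _ => ?_
    rw [← sum_units_inv]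
    refine Finset.sum_congr rfl fun z _ => if_congr ?_ rfl rfl
    simp only [Units.val_inv_eq_inv_val, div_inv_eq_mul]
    constructor <;> intro h <;> linear_combination h
  simp only [Finset.sum_add_distrib, Finset.sum_sub_distrib, h1, h2]
  have h3 : ∀ x y z : Fˣ, discr a (x : F) y z = ((1 + x + y + z)
      * (a 1 / x + a 2 / y + a 3 / z + a 4) - a 0 - a 5) ^ 2 - 4 * a 0 * a 5 := fun _ _ _ => rfl
  simp only [h3]
  by_cases h : a 0 = a 5
  · simp only [h, if_true, ← Finset.mul_sum]
    ring
  · simp only [h, if_false, Finset.sum_const_zero]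
    ring

end Torus


open MvPolynomial

/-! ### Singular points in the torus -/

section Singular

variable {K : Type*} [Field K]

lemma isSingularAt_localEq_one_iff (a : Fin 6 → K) (v : Fin 4 → K) :
    IsSingularAt (localEq a 1) v ↔ eqVal a v = 0 ∧
      (a 0 + a 1 * v 0 + a 2 * (v 0 * v 1) + a 3 * (v 0 * v 1 * v 2)
            + a 4 * (v 0 * v 1 * v 2 * v 3)) * (v 3 * v 2 * v 1)
          + coordSum v * (a 1 + a 2 * v 1 + a 3 * (v 2 * v 1) + a 4 * (v 3 * (v 2 * v 1)))
          - a 5 * (v 3 * (v 2 * v 1)) = 0 ∧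
      (a 0 + a 1 * v 0 + a 2 * (v 0 * v 1) + a 3 * (v 0 * v 1 * v 2)
            + a 4 * (v 0 * v 1 * v 2 * v 3)) * (v 3 * v 2 + v 0 * (v 3 * v 2))
          + coordSum v * (a 2 * v 0 + a 3 * (v 2 * v 0) + a 4 * (v 3 * (v 2 * v 0)))
          - a 5 * (v 3 * (v 2 * v 0)) = 0 ∧
      (a 0 + a 1 * v 0 + a 2 * (v 0 * v 1) + a 3 * (v 0 * v 1 * v 2)
            + a 4 * (v 0 * v 1 * v 2 * v 3)) * (v 3 + v 1 * v 3 + v 0 * (v 1 * v 3))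
          + coordSum v * (a 3 * (v 0 * v 1) + a 4 * (v 3 * (v 0 * v 1)))
          - a 5 * (v 3 * (v 0 * v 1)) = 0 ∧
      (a 0 + a 1 * v 0 + a 2 * (v 0 * v 1) + a 3 * (v 0 * v 1 * v 2)
            + a 4 * (v 0 * v 1 * v 2 * v 3)) * (1 + v 2 + v 1 * v 2 + v 0 * (v 1 * v 2))
          + coordSum v * (a 4 * (v 0 * v 1 * v 2)) - a 5 * (v 0 * v 1 * v 2) = 0 := by
  rw [IsSingularAt, eval_localEq, chartParam_one]
  refine and_congr_right fun _ => ?_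
  simp [localEq, coordSum, Fin.forall_fin_succ, Derivation.leibniz, pderiv_X]

/-- Up to a factor, the parameters are determined by a singular point in the torus. -/
lemma isNodeParam_of_isSingularAt {a : Fin 6 → K} (ha : a 5 ≠ 0) {b : Fin 5 → K}
    (hb : ∀ i, b i ≠ 0) (h : IsSingularAt (localEq a 1) (chartCoords 1 b)) : IsNodeParam a b := by
  obtain ⟨h, h0, h1, h2, h3⟩ := (isSingularAt_localEq_one_iff a _).mp h
  set v := chartCoords 1 b with hv
  have e0 : v 0 = b 0 / b 1 := rfl
  have e1 : v 1 = b 1 / b 2 := rfl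
  have e2 : v 2 = b 2 / b 3 := rfl
  have e3 : v 3 = b 3 / b 4 := rfl
  have b0 := hb 0; have b1 := hb 1; have b2 := hb 2; have b3 := hb 3; have b4 := hb 4
  set l := a 0 + a 1 * v 0 + a 2 * (v 0 * v 1) + a 3 * (v 0 * v 1 * v 2)
            + a 4 * (v 0 * v 1 * v 2 * v 3) with hl
  set m := coordSum v with hm
  have hlm : l * m = a 5 * (v 0 * v 1 * v 2 * v 3) := sub_eq_zero.mp h
  have hv0 : ∀ k, v k ≠ 0 := fun k => div_ne_zero (hb _) (hb _)
  have hlm0 : l * m ≠ 0 := by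
    rw [hlm]
    exact mul_ne_zero ha (mul_ne_zero (mul_ne_zero (mul_ne_zero (hv0 0) (hv0 1)) (hv0 2)) (hv0 3))
  have hl0 : l ≠ 0 := left_ne_zero_of_mul hlm0
  have hm0 : m ≠ 0 := right_ne_zero_of_mul hlm0
  -- Differences of the derivations `v k * ∂ / ∂ v k` are the logarithmic derivatives in the
  -- homogeneous coordinates. Their vanishing says that `b i ^ 2` is proportional to `a i`, with the
  -- same factor for all `i`; the equation of the threefold then supplies the last parameter.
  have r0 : l * (v 0 * v 1 * v 2 * v 3) = a 0 * m := by
    linear_combination v 0 * h0 - hlm + m * hl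
  have r1 : l * (v 1 * v 2 * v 3) = a 1 * v 0 * m := by
    linear_combination v 1 * h1 - v 0 * h0
  have r2 : l * (v 2 * v 3) = a 2 * (v 0 * v 1) * m := by
    linear_combination v 2 * h2 - v 1 * h1
  have r3 : l * v 3 = a 3 * (v 0 * v 1 * v 2) * m := by
    linear_combination v 3 * h3 - v 2 * h2
  have r4 : l = a 4 * (v 0 * v 1 * v 2 * v 3) * m := by
    have hm' : m = 1 + v 3 + v 3 * v 2 + v 3 * v 2 * v 1 + v 3 * v 2 * v 1 * v 0 := rfl
    linear_combination hlm - v 3 * h3 - l * hm'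
  have hS : ∑ i, b i = b 4 * m := by
    rw [Fin.sum_univ_five, hm, coordSum, e0, e1, e2, e3]
    field_simp
    ring
  refine ⟨hb, b 0 * b 4 * m / l, div_ne_zero (mul_ne_zero (mul_ne_zero b0 b4) hm0) hl0, ?_⟩
  clear_value l m
  rw [e0, e1, e2, e3] at r0 r1 r2 r3 r4 hlm
  field_simp at r0 r1 r2 r3 r4 hlm
  intro i
  refine Fin.lastCases ?_ (fun i => ?_) i
  · change phiVec b 5 = _ * a 5
    rw [phiVec_five, hS]
    field_simp
    linear_combination hlm
  · rw [phiVec_castSucc]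
    fin_cases i
    · change b 0 ^ 2 = _ * a 0
      field_simp
      linear_combination r0
    · change b 1 ^ 2 = _ * a 1
      field_simp
      linear_combination r1
    · change b 2 ^ 2 = _ * a 2
      field_simp
      linear_combination r2
    · change b 3 ^ 2 = _ * a 3
      field_simp
      linear_combination r3
    · change b 4 ^ 2 = _ * a 4
      field_simp
      linear_combination r4

lemma IsNodeParam.isSingularAt {a : Fin 6 → K} {b : Fin 5 → K} (h : IsNodeParam a b) :
    IsSingularAt (localEq a 1) (chartCoords 1 b) := by
  obtain ⟨hb, c, hc, hca⟩ := h
  rw [isSingularAt_localEq_one_iff]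
  set v := chartCoords 1 b with hv
  have e0 : v 0 = b 0 / b 1 := rfl
  have e1 : v 1 = b 1 / b 2 := rfl
  have e2 : v 2 = b 2 / b 3 := rfl
  have e3 : v 3 = b 3 / b 4 := rfl
  have b0 := hb 0; have b1 := hb 1; have b2 := hb 2; have b3 := hb 3; have b4 := hb 4
  have a0 : a 0 = b 0 ^ 2 / c := by
    rw [eq_div_iff hc, mul_comm, ← hca]; exact phiVec_castSucc b 0
  have a1 : a 1 = b 1 ^ 2 / c := by
    rw [eq_div_iff hc, mul_comm, ← hca]; exact phiVec_castSucc b 1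
  have a2 : a 2 = b 2 ^ 2 / c := by
    rw [eq_div_iff hc, mul_comm, ← hca]; exact phiVec_castSucc b 2
  have a3 : a 3 = b 3 ^ 2 / c := by
    rw [eq_div_iff hc, mul_comm, ← hca]; exact phiVec_castSucc b 3
  have a4 : a 4 = b 4 ^ 2 / c := by
    rw [eq_div_iff hc, mul_comm, ← hca]; exact phiVec_castSucc b 4
  have a5 : a 5 = (b 0 + b 1 + b 2 + b 3 + b 4) ^ 2 / c := by
    rw [eq_div_iff hc, mul_comm, ← hca, phiVec_five, Fin.sum_univ_five]
  simp only [eqVal, coordSum, a0, a1, a2, a3, a4, a5, e0, e1, e2, e3]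
  clear_value v
  refine ⟨?_, ?_, ?_, ?_, ?_⟩ <;> · field_simp; ring

/-- For nonzero parameters the condition is closed in projective space. In this form it can be
reduced modulo a prime and compared over field extensions. -/
lemma isNodeParam_iff {a : Fin 6 → K} (ha : ∀ i, a i ≠ 0) (b : Fin 5 → K) :
    IsNodeParam a b ↔ b ≠ 0 ∧ ∀ i j, phiVec b i * a j = phiVec b j * a i := by
  constructor
  · rintro ⟨hb, c, -, hca⟩
    refine ⟨fun h => hb 0 (by rw [h]; rfl), fun i j => ?_⟩
    rw [hca, hca]
    ring
  · rintro ⟨h0, h⟩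
    obtain ⟨j, hj⟩ := Function.ne_iff.mp h0
    have hj' : phiVec b j.castSucc ≠ 0 := by
      rw [phiVec_castSucc]
      exact pow_ne_zero 2 hj
    have hb : ∀ i : Fin 5, b i ≠ 0 := fun i hi => by
      have h1 := h i.castSucc j.castSucc
      rw [phiVec_castSucc, hi, zero_pow two_ne_zero, zero_mul] at h1
      exact mul_ne_zero hj' (ha _) h1.symm
    refine ⟨hb, phiVec b j.castSucc / a j.castSucc, div_ne_zero hj' (ha _), fun i => ?_⟩
    rw [div_mul_eq_mul_div, eq_div_iff (ha _)]
    exact h i _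

lemma map_phiVec_aux {R : Type*} [CommRing R] (f : R →+* K) (b : Fin 5 → R) (i : Fin 6) :
    f ((Fin.snoc (fun i => b i ^ 2) ((∑ i, b i) ^ 2) : Fin 6 → R) i)
      = phiVec (fun i => f (b i)) i := by
  refine Fin.lastCases ?_ (fun i => ?_) i
  · simp only [phiVec, Fin.snoc_last, map_pow, map_sum]
  · simp [phiVec]

lemma isNodeParam_map_iff {L : Type*} [Field L] (f : K →+* L) {a : Fin 6 → K} (ha : ∀ i, a i ≠ 0)
    (b : Fin 5 → K) :
    IsNodeParam (fun i => f (a i)) (fun i => f (b i)) ↔ IsNodeParam a b := by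
  rw [isNodeParam_iff ha, isNodeParam_iff fun i => (map_ne_zero f).mpr (ha i)]
  refine and_congr ?_ (forall₂_congr fun i j => ?_)
  · refine not_congr ⟨fun h => ?_, fun h => ?_⟩
    · ext i
      exact (map_eq_zero f).mp (congrFun h i)
    · rw [h]; ext i; simp
  · rw [← map_phiVec_aux, ← map_phiVec_aux, ← map_mul, ← map_mul, f.injective.eq_iff]
    rfl

lemma IsNodeParam.smul {a : Fin 6 → K} {b : Fin 5 → K} (h : IsNodeParam a b) {u : K}
    (hu : u ≠ 0) : IsNodeParam a (u • b) := by
  obtain ⟨hb, c, hc, hca⟩ := h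
  refine ⟨fun i => mul_ne_zero hu (hb i), u ^ 2 * c, mul_ne_zero (pow_ne_zero 2 hu) hc,
    fun i => ?_⟩
  rw [mul_assoc, ← hca]
  refine Fin.lastCases ?_ (fun i => ?_) i
  · simp only [phiVec, Fin.snoc_last, Pi.smul_apply, smul_eq_mul, ← Finset.mul_sum, mul_pow]
  · simp [phiVec, mul_pow]

lemma isNodeParam_rep_mk {a : Fin 6 → K} {b : Fin 5 → K} (h : IsNodeParam a b) (h0 : b ≠ 0) :
    IsNodeParam a (Projectivization.mk K b h0).rep := by
  obtain ⟨u, hu⟩ := Projectivization.exists_smul_eq_mk_rep K b h0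
  rw [← hu]
  exact h.smul u.ne_zero

lemma chartCoords_smul (ς : Equiv.Perm (Fin 5)) (b : Fin 5 → K) {u : K} (hu : u ≠ 0) :
    chartCoords ς (u • b) = chartCoords ς b := by
  funext k
  exact mul_div_mul_left _ _ hu

/-- The chart coordinates of such a point have prescribed squares. Finiteness is needed to compare
dimensions of tangent spaces. -/
lemma finite_isNodeParam {a : Fin 6 → K} (ha : ∀ i, a i ≠ 0) :
    {b : ℙ K (Fin 5 → K) | IsNodeParam a b.rep}.Finite := by
  have hfin : ∀ c : K, {x : K | x ^ 2 = c}.Finite := fun c => by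
    classical
    refine ((Polynomial.nthRoots 2 c).toFinset.finite_toSet).subset fun x hx => ?_
    simpa [Polynomial.mem_nthRoots] using hx
  refine Set.Finite.of_finite_image (f := fun b => chartCoords 1 b.rep)
    ((Set.Finite.pi fun k : Fin 4 => hfin (a k.castSucc.castSucc / a k.succ.castSucc)).subset ?_)
    fun b hb b' hb' h => eq_of_chartCoords_eq hb.1 hb'.1 h
  rintro _ ⟨b, hb, rfl⟩ k -
  have h := ((isNodeParam_iff ha _).mp hb).2 k.castSucc.castSucc k.succ.castSucc
  rw [phiVec_castSucc, phiVec_castSucc] at h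
  change (b.rep k.castSucc / b.rep k.succ) ^ 2 = _
  rw [div_pow, div_eq_div_iff (pow_ne_zero 2 (hb.1 _)) (ha _), h, mul_comm]

end Singular

/-! ### Tangent vectors at a singular point outside the centres -/

section Tangent

variable {K : Type*} [Field K]

/-- The differential of a polynomial. -/
noncomputable def differential {n : ℕ} (v t : Fin n → K) (q : MvPolynomial (Fin n) K) : K :=
  ∑ k, t k * eval v (pderiv k q)

lemma aeval_dualNumber {n : ℕ} (v t : Fin n → K) (q : MvPolynomial (Fin n) K) :
    aeval (fun k => (TrivSqZeroExt.inl (v k) + TrivSqZeroExt.inr (t k) : DualNumber K)) q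
      = TrivSqZeroExt.inl (eval v q) + TrivSqZeroExt.inr (differential v t q) := by
  unfold differential
  induction q using MvPolynomial.induction_on with
  | C r => simp [TrivSqZeroExt.algebraMap_eq_inl]
  | add q r hq hr =>
    simp only [map_add, hq, hr, mul_add, Finset.sum_add_distrib, TrivSqZeroExt.inl_add,
      TrivSqZeroExt.inr_add]
    abel
  | mul_X q i hq =>
    simp only [map_mul, hq, aeval_X, Derivation.leibniz, eval_X, map_add, smul_eq_mul]
    ext
    · simp
    · simp only [mul_add, Finset.sum_add_distrib, pderiv_X, Pi.single_apply]
      simp only [TrivSqZeroExt.snd_mul, TrivSqZeroExt.snd_add, TrivSqZeroExt.fst_add,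
        TrivSqZeroExt.fst_inl, TrivSqZeroExt.fst_inr, TrivSqZeroExt.snd_inl,
        TrivSqZeroExt.snd_inr, MulOpposite.smul_eq_mul_unop, MulOpposite.unop_op, smul_eq_mul]
      simp [Finset.mul_sum, mul_left_comm, mul_comm]
      exact add_comm _ _

lemma isBlowUpPoint_dualNumber {n : ℕ} {ι : Type*} {F : MvPolynomial (Fin n) K}
    {f : ι → MvPolynomial (Fin n) K} {v : Fin n → K} (hF : IsSingularAt F v) {s : ι → K}
    (hs : s ≠ 0) {u : K} (hu : ∀ i, s i = u * eval v (f i)) (t : Fin n → K) (c : K) :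
    IsBlowUpPoint F f (fun k => (TrivSqZeroExt.inl (v k) + TrivSqZeroExt.inr (t k) : DualNumber K))
      (fun i => (TrivSqZeroExt.inl (s i)
        + TrivSqZeroExt.inr (u * differential v t (f i) + c * eval v (f i)) : DualNumber K)) := by
  obtain ⟨i, hi⟩ := Function.ne_iff.mp hs
  refine isBlowUpPoint_of_eq_mul ?_ (TrivSqZeroExt.inl u + TrivSqZeroExt.inr c) (fun i => ?_)
    ⟨i, ?_⟩
  · rw [aeval_dualNumber, hF.1, differential]
    simp [hF.2]
  · rw [aeval_dualNumber, hu]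
    ext
    · simp
    · simp [mul_comm]
  · rw [TrivSqZeroExt.isUnit_iff_isUnit_fst]
    simpa using hi

variable {a : Fin 6 → K} {B : Set (ℙ K (Fin 5 → K))}

/-- Tangent vectors at a singular point outside the centres. -/
noncomputable def tangentLift (P : ChartPoint K a B) (u : K) (w : B → K) :
    ((Fin 4 → K) × K × (B → K)) →ₗ[K] (Fin 4 → K) × (Fin 2 → K) × (B → Fin 5 × Fin 5 → K) where
  toFun x := (x.1,
    fun i => u * differential P.pt x.1 (surfaceGens a P.chart i)
      + x.2.1 * eval P.pt (surfaceGens a P.chart i),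
    fun b ij => w b * differential P.pt x.1 (pointGens b.1.rep P.chart ij)
      + x.2.2 b * eval P.pt (pointGens b.1.rep P.chart ij))
  map_add' x y := by
    ext <;> simp [differential, add_mul, Finset.sum_add_distrib, mul_add] <;> ring
  map_smul' r x := by
    ext <;> simp [differential, mul_add, Finset.mul_sum, mul_assoc, mul_left_comm]

/-- The blow-up is singular at a singular point of the threefold outside the centres. -/
lemma not_isNonsingularAt [Finite B] (P : ChartPoint K a B)
    (hP : IsSingularAt (localEq a P.chart) P.pt)
    (hdir : (fun i => eval P.pt (surfaceGens a P.chart i)) ≠ 0)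
    (hexc : ∀ b : B, (fun ij => eval P.pt (pointGens b.1.rep P.chart ij)) ≠ 0)
    {u : K} (hu : ∀ i, P.dir.rep i = u * eval P.pt (surfaceGens a P.chart i))
    {w : B → K} (hw : ∀ b ij, (P.exc b).rep ij = w b * eval P.pt (pointGens b.1.rep P.chart ij)) :
    ¬ IsNonsingularAt P := by
  have : Fintype B := Fintype.ofFinite B
  intro h
  have hinj : Function.Injective (tangentLift P u w) := by
    rw [← LinearMap.ker_eq_bot, LinearMap.ker_eq_bot']
    rintro ⟨t, c, γ⟩ h0
    obtain ⟨h1, h2, h3⟩ := by simpa only [tangentLift, LinearMap.coe_mk, AddHom.coe_mk,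
      Prod.mk_eq_zero] using h0
    subst h1
    obtain ⟨i, hi⟩ := Function.ne_iff.mp hdir
    have h4 := congrFun h2 i
    simp [differential] at h4
    refine Prod.ext rfl (Prod.ext (h4.resolve_right hi) (funext fun b => ?_))
    obtain ⟨i, hi⟩ := Function.ne_iff.mp (hexc b)
    have h5 := congrFun (congrFun h3 b) i
    simp [differential] at h5
    exact h5.resolve_right hi
  have hle : LinearMap.range (tangentLift P u w) ≤ Submodule.span K (tangentVectors P) := by
    rintro _ ⟨x, rfl⟩
    exact Submodule.subset_span ⟨isBlowUpPoint_dualNumber hP P.dir.rep_nonzero hu _ _,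
      fun b => isBlowUpPoint_dualNumber hP (P.exc b).rep_nonzero (hw b) _ _⟩
  -- Since the differential of the equation vanishes, all four directions lift. Together with one
  -- rescaling for the surface and one for each point centre, this gives dimension at least `4 + (1
  -- + Nat.card B)`.
  have h1 := Submodule.finrank_mono hle
  rw [LinearMap.finrank_range_of_inj hinj, h] at h1
  simp [Nat.card_eq_fintype_card] at h1

/-- If the blow-up is nonsingular, then every singular point in the torus is a centre. -/
lemma mem_of_forall_isNonsingularAt (ha : ∀ i, a i ≠ 0) (hB : ∀ b ∈ B, IsNodeParam a b.rep)
    (h : ∀ P : ChartPoint K a B, IsNonsingularAt P) {b : ℙ K (Fin 5 → K)}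
    (hb : IsNodeParam a b.rep) : b ∈ B := by
  by_contra hbB
  have : Finite B := (finite_isNodeParam ha).subset hB
  set v := chartCoords 1 b.rep with hv
  have hsing : IsSingularAt (localEq a 1) v := hb.isSingularAt
  have hdir : (fun i => eval v (surfaceGens a 1 i)) ≠ 0 := fun h0 => by
    have h1 := congrFun h0 1
    simp only [surfaceGens, Matrix.cons_val_one, Matrix.cons_val_zero, eval_X, Pi.zero_apply] at h1
    exact div_ne_zero (hb.1 ((1 : Equiv.Perm (Fin 5)) 1)) (hb.1 ((1 : Equiv.Perm (Fin 5)) 2)) h1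
  have hexc : ∀ b' : B, (fun ij => eval v (pointGens b'.1.rep 1 ij)) ≠ 0 := fun b' h0 => by
    rw [eval_pointGens] at h0
    have h1 := eq_chartCoords_of_wedge_eq_zero (hB b'.1 b'.2).1 h0
    exact hbB (eq_of_chartCoords_eq hb.1 (hB b'.1 b'.2).1 h1 ▸ b'.2)
  have hF : aeval v (localEq a 1) = 0 := hsing.1
  obtain ⟨u, hu⟩ := Projectivization.exists_smul_eq_mk_rep K _ hdir
  choose w hw using fun b' => Projectivization.exists_smul_eq_mk_rep K _ (hexc b')
  have hu' : ∀ i, (Projectivization.mk K _ hdir).rep i = u * eval v (surfaceGens a 1 i) :=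
    fun i => (congrFun hu i).symm
  have hw' : ∀ b' ij, (Projectivization.mk K _ (hexc b')).rep ij
      = w b' * eval v (pointGens b'.1.rep 1 ij) := fun b' ij => (congrFun (hw b') ij).symm
  let P : ChartPoint K a B :=
    { chart := 1
      pt := v
      on_threefold := hsing.1
      dir := Projectivization.mk K _ hdir
      dir_mem := isBlowUpPoint_of_eq_mul hF u hu'
        ((Function.ne_iff.mp (Projectivization.rep_nonzero _)).imp fun _ hi => Ne.isUnit hi)
      exc := fun b' => Projectivization.mk K _ (hexc b')
      exc_mem := fun b' => isBlowUpPoint_of_eq_mul hF (w b') (hw' b')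
        ((Function.ne_iff.mp (Projectivization.rep_nonzero _)).imp fun _ hi => Ne.isUnit hi) }
  exact not_isNonsingularAt P hsing hdir hexc hu' (w := fun b' => w b') hw' (h P)

end Tangent


open MvPolynomial

/-! ### Reduction of the nodes -/

section Reduction

variable {p : ℕ} [Fact p.Prime] {a : Fin 6 → ℤ}

lemma intCast_ne_zero_of_zmod (ha : ∀ i, (a i : ZMod p) ≠ 0) {K : Type*} [Field K] [Algebra (ZMod p) K]
    (i : Fin 6) : (a i : K) ≠ 0 := by
  rw [← map_intCast (algebraMap (ZMod p) K)]
  exact (map_ne_zero _).mpr (ha i)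

lemma IsReductionOfNode.smul {v : Fin 5 → AlgebraicClosure (ZMod p)} (h : IsReductionOfNode p a v)
    {u : AlgebraicClosure (ZMod p)} (hu : u ≠ 0) : IsReductionOfNode p a (u • v) := by
  obtain ⟨red, β, hβ, hs, c, hc, hv⟩ := h
  exact ⟨red, β, hβ, hs, u * c, mul_ne_zero hu hc, fun i => by
    rw [Pi.smul_apply, smul_eq_mul, hv, mul_assoc]⟩

/-- The proportionality of `φ(b)` and `a` consists of identities between algebraic integers, to
which the reduction map applies. -/
lemma IsReductionOfNode.isNodeParam (ha : ∀ i, (a i : ZMod p) ≠ 0)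
    {v : Fin 5 → AlgebraicClosure (ZMod p)} (h : IsReductionOfNode p a v) (hv0 : v ≠ 0) :
    IsNodeParam (fun i => (a i : AlgebraicClosure (ZMod p))) v := by
  obtain ⟨red, β, hβ, hs, c, hc, hv⟩ := h
  have ha' : ∀ i, (a i : AlgebraicClosure ℚ) ≠ 0 := fun i h0 => ha i (by
    rw [Int.cast_eq_zero] at h0
    rw [h0, Int.cast_zero])
  have hβ' : ∀ i, (β i : AlgebraicClosure ℚ) ≠ 0 := fun i h0 => hβ i (Subtype.ext h0)
  have h1 := ((isNodeParam_iff ha' _).mp (isNodeParam_of_isSingularAt (ha' 5) hβ' hs)).2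
  have hsmul : v = c • fun i => red (β i) := funext hv
  rw [hsmul]
  refine IsNodeParam.smul ?_ hc
  refine (isNodeParam_iff (fun i => intCast_ne_zero_of_zmod ha i) _).mpr ⟨fun h0 => hv0 (by
    rw [hsmul, h0, smul_zero]), fun i j => ?_⟩
  set ψ : Fin 6 → AlgInt := Fin.snoc (fun i => β i ^ 2) ((∑ i, β i) ^ 2) with hψ
  have h2 : ψ i * a j = ψ j * a i := by
    refine Subtype.ext ?_
    have h3 := h1 i j
    have e := map_phiVec_aux (algebraMap AlgInt (AlgebraicClosure ℚ)) β
    rw [show (fun i => (β i : AlgebraicClosure ℚ))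
      = fun i => algebraMap AlgInt (AlgebraicClosure ℚ) (β i) from rfl, ← e, ← e] at h3
    simpa using h3
  have h3 := congrArg red h2
  rw [map_mul, map_mul, map_intCast, map_intCast, map_phiVec_aux, map_phiVec_aux] at h3
  exact h3

variable {K : Type} [Field K] [Algebra (ZMod p) K] [Algebra K (AlgebraicClosure (ZMod p))]

lemma isNodeParam_of_mem_reducedNodes (ha : ∀ i, (a i : ZMod p) ≠ 0) {b : ℙ K (Fin 5 → K)}
    (hb : b ∈ reducedNodes p a K) : IsNodeParam (fun i => (a i : K)) b.rep := by
  have h := IsReductionOfNode.isNodeParam ha hb fun h0 => b.rep_nonzero (by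
    ext i
    exact (map_eq_zero (algebraMap K (AlgebraicClosure (ZMod p)))).mp (congrFun h0 i))
  rw [← isNodeParam_map_iff (algebraMap K (AlgebraicClosure (ZMod p)))
    fun i => intCast_ne_zero_of_zmod ha i]
  simpa using h

/-- If the reduction is smooth, then every singular point in the torus is the reduction of one. -/
lemma HasSmoothReduction.isReductionOfNode (h : HasSmoothReduction p a)
    {v : Fin 5 → AlgebraicClosure (ZMod p)}
    (hv : IsNodeParam (fun i => (a i : AlgebraicClosure (ZMod p))) v) : IsReductionOfNode p a v := by
  have hv0 : v ≠ 0 := fun h0 => hv.1 0 (congrFun h0 0)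
  have hmem := mem_of_forall_isNonsingularAt (fun i => intCast_ne_zero_of_zmod h.1 i)
    (fun b hb => isNodeParam_of_mem_reducedNodes h.1 hb) h.2.2 (isNodeParam_rep_mk hv hv0)
  obtain ⟨u, hu⟩ := Projectivization.exists_smul_eq_mk_rep (AlgebraicClosure (ZMod p)) v hv0
  have h1 : IsReductionOfNode p a (Projectivization.mk _ v hv0).rep := hmem
  have h2 := h1.smul (u⁻¹).ne_zero
  rw [← hu] at h2
  convert h2 using 1
  ext i
  simp [Units.smul_def]

/-- One inclusion is reduction of the closed condition. The other uses smoothness over the algebraic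
closure, to which both sides are compared by base change. -/
lemma HasSmoothReduction.reducedNodes_eq (h : HasSmoothReduction p a) :
    reducedNodes p a K = phiFibre fun i => (a i : K) := by
  ext b
  refine ⟨isNodeParam_of_mem_reducedNodes h.1, fun hb => ?_⟩
  have hb' : IsNodeParam (fun i => (a i : K)) b.rep := hb
  rw [← isNodeParam_map_iff (algebraMap K (AlgebraicClosure (ZMod p)))
    fun i => intCast_ne_zero_of_zmod h.1 i] at hb'
  exact h.isReductionOfNode (by simpa using hb')

/-- The entries of the first column at the point `(1, 1, 1, 1)` are the even integers `8, 30, 28,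
26`. -/
lemma det_hessian_eq_zero {K : Type*} [Field K] (h2 : (2 : K) = 0) :
    (Matrix.of fun i j : Fin 4 => eval (fun _ => 1 : Fin 4 → K)
      (pderiv i (pderiv j (localEq (fun _ => (1 : K)) 1)))).det = 0 := by
  refine Matrix.det_eq_zero_of_column_eq_zero 0 fun i => ?_
  fin_cases i <;> simp [localEq, Derivation.leibniz, pderiv_X]
  · linear_combination 4 * h2
  · linear_combination 15 * h2
  · linear_combination 14 * h2
  · linear_combination 13 * h2

/-- In characteristic `2` the reduction is never smooth. -/
lemma HasSmoothReduction.two_ne_zero (h : HasSmoothReduction p a) : (2 : ZMod p) ≠ 0 := by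
  intro h2
  obtain rfl : p = 2 := by
    have : p ∣ 2 := (ZMod.natCast_eq_zero_iff 2 p).mp (by exact_mod_cast h2)
    exact (Nat.prime_dvd_prime_iff_eq Fact.out Nat.prime_two).mp this
  have h1 : ∀ i, (a i : AlgebraicClosure (ZMod 2)) = 1 := fun i => by
    have h1 : (a i : ZMod 2) = 1 := Fin.eq_one_of_ne_zero _ (h.1 i)
    rw [← map_intCast (algebraMap (ZMod 2) (AlgebraicClosure (ZMod 2))), h1, map_one]
  have h2' : (2 : AlgebraicClosure (ZMod 2)) = 0 := by
    rw [← map_ofNat (algebraMap (ZMod 2) (AlgebraicClosure (ZMod 2))), h2, map_zero]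
  set o : Fin 5 → AlgebraicClosure (ZMod 2) := fun _ => 1 with ho
  have ho0 : o ≠ 0 := fun h0 => one_ne_zero (congrFun h0 0)
  have hn : IsNodeParam (fun i => (a i : AlgebraicClosure (ZMod 2))) o := by
    refine ⟨fun _ => one_ne_zero, 1, one_ne_zero, fun i => ?_⟩
    simp only [h1]
    refine Fin.lastCases ?_ (fun i => ?_) i
    · change phiVec o 5 = _
      rw [phiVec_five]
      simp only [ho, Fin.sum_univ_five]
      linear_combination 12 * h2'
    · rw [phiVec_castSucc]
      simp [ho]
  -- Modulo `2` all parameters are `1`, so `(1 : ⋯ : 1)` is a singular point. Smoothness makes it a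
  -- centre, and the centres are required to be nodes, against the degenerate Hessian.
  have hmem := mem_of_forall_isNonsingularAt (fun i => intCast_ne_zero_of_zmod h.1 i)
    (fun b hb => isNodeParam_of_mem_reducedNodes h.1 hb) h.2.2 (isNodeParam_rep_mk hn ho0)
  obtain ⟨u, hu⟩ := Projectivization.exists_smul_eq_mk_rep (AlgebraicClosure (ZMod 2)) o ho0
  have h3 := (h.2.1 _ hmem).2
  rw [← hu, Units.smul_def, chartCoords_smul _ _ u.ne_zero] at h3
  have h4 : chartCoords 1 o = fun _ => 1 := funext fun k => div_one 1
  simp only [h1, h4] at h3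
  exact h3 (det_hessian_eq_zero h2')

end Reduction

end A4

/-! ### Assembly of the point count. -/

theorem mainTheorem10 (p : ℕ) [Fact p.Prime] (a : Fin 6 → ℤ) (ha : ∃ i, ¬ (p : ℤ) ∣ a i)
    (hgood : A4.HasSmoothReduction p a) :
    (Nat.card (A4.ReducedBigResolution p a (ZMod p)) : ℤ) =
      48 * (p : ℤ) ^ 2 + 46 * (p : ℤ) + 14
      + (∑ x : (ZMod p)ˣ, ∑ y : (ZMod p)ˣ, ∑ z : (ZMod p)ˣ,
          (quadraticChar (ZMod p)
            (A4.discr (fun i => (a i : ZMod p)) (x : ZMod p) (y : ZMod p) (z : ZMod p)) + 1))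
      + (∑ᶠ b ∈ A4.phiFibre (fun i => (a i : ZMod p)),
          (p : ℤ) * ((p : ℤ) + 1
            + quadraticChar (ZMod p) ((∏ i, b.rep i) * ∑ i, b.rep i)))
      + (if (a 0 : ZMod p) = (a 5 : ZMod p) then
          (p : ℤ) * ((Nat.card (A4.ellipticCurve (a 1 : ZMod p) (a 2 : ZMod p) (a 4 : ZMod p)
            (a 3 : ZMod p)) : ℤ) - 6)
        else 0) := by
  have h2 := hgood.two_ne_zero
  rw [A4.ReducedBigResolution, A4.card_bigResolution_eq h2 hgood.1 fun b hb =>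
      A4.isNodeParam_of_mem_reducedNodes hgood.1 hb, A4.card_normalPoint hgood.1,
    A4.card_isBoundaryNode hgood.1, A4.sum_torus h2 hgood.1, hgood.reducedNodes_eq, ZMod.card]
  -- The polynomial part is `50 p ^ 2 + 10 p + 20` from the boundary, `30 p` from the boundary nodes
  -- and `-2 p ^ 2 + 6 p - 6` from the corrections in the torus.
  ring
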